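/- Let $p$ be a prime with $p \equiv 1 \pmod 4$, and let $\overline{\mathbb{F}}_p$ be an algebraic closure of $\mathbb{F}_p$. For each $\lambda \in \mathbb{F}_p$ fix a square root $\sqrt{\lambda^2-\lambda+1} \in \overline{\mathbb{F}}_p$, and for $\varepsilon \in \{1,-1\}$ put $$\Lambda^{\varepsilon}(\lambda) = (1-\lambda)\left(\lambda + \varepsilon\sqrt{\lambda^2-\lambda+1}\right)^2, \qquad E_{\Lambda^{\varepsilon}(\lambda)} : y^2 = x(x-1)\left(x-\Lambda^{\varepsilon}(\lambda)\right).$$ Let $E$ be an elliptic curve over $\overline{\mathbb{F}}_p$ whose endomorphism ring contains $\mathbb{Z}\left[\frac{1+\sqrt{-3p}}{2}\right]$, that is, there is an injective ring homomorphism $\mathbb{Z}\left[\frac{1+\sqrt{-3p}}{2}\right] \to \mathrm{End}(E)$. Then there are $\lambda \in \mathbb{F}_p$ and $\varepsilon \in \{1,-1\}$ such that $E$ is isomorphic over $\overline{\mathbb{F}}_p$ to $E_{\Lambda^{\varepsilon}(\lambda)}$ (so that $\lambda \neq 0, 1$). -/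

import Mathlib

open scoped Polynomial.Bivariate

/-- The quadratic order `ℤ[(1 + √(-3p)) / 2]`, as a subring of `ℂ`. -/
noncomputable def orderSqrtNegThree (p : ℕ) : Subalgebra ℤ ℂ :=
  Algebra.adjoin ℤ {(1 + (Real.sqrt (3 * (p : ℝ)) : ℂ) * Complex.I) / 2}

/-- Let `W` be an elliptic curve over an algebraically closed field `k`. A group endomorphism `f` of
`W(k)` is an endomorphism of the elliptic curve `W` if it is zero or is given by rational functions:
there are polynomials `u, v, d` in two variables over `k` such that, for all but finitely many
affine points `(x, y)` of `W`, one has `d(x, y) ≠ 0` and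
`f (x, y) = (u(x, y) / d(x, y), v(x, y) / d(x, y))`.
(A rational map from a smooth projective curve extends to a morphism, so such an `f` is
a morphism of curves fixing the origin, and every such morphism is of this form.) -/
def IsCurveEndomorphism {k : Type*} [Field k] [DecidableEq k] (W : WeierstrassCurve k)
    (f : AddMonoid.End W.toAffine.Point) : Prop :=
  f = 0 ∨ ∃ u v d : k[X][Y], ∃ S : Set W.toAffine.Point, S.Finite ∧
    ∀ (x y : k) (h : W.toAffine.Nonsingular x y),
      WeierstrassCurve.Affine.Point.some x y h ∉ S →
        d.evalEval x y ≠ 0 ∧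
        ∃ h' : W.toAffine.Nonsingular (u.evalEval x y / d.evalEval x y)
            (v.evalEval x y / d.evalEval x y),
          f (WeierstrassCurve.Affine.Point.some x y h) =
            WeierstrassCurve.Affine.Point.some _ _ h'

/-- The endomorphism ring of `W` contains (a copy of) the ring `R`. Here `End(W)` is the set of
endomorphisms of `W` inside the ring `AddMonoid.End W(k)`, with pointwise addition and with
composition as multiplication; so an embedding of rings `R → End(W)` is an injective ring
homomorphism into `AddMonoid.End W(k)` all of whose values are endomorphisms of the curve. -/
def EndomorphismRingContains {k : Type*} [Field k] [DecidableEq k] (W : WeierstrassCurve k)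
    (R : Type*) [Ring R] : Prop :=
  ∃ φ : R →+* AddMonoid.End W.toAffine.Point,
    Function.Injective φ ∧ ∀ r : R, IsCurveEndomorphism W (φ r)

/-- The curve `y² = x (x - 1) (x - t)`. -/
def legendreCurve {k : Type*} [Field k] (t : k) : WeierstrassCurve k where
  a₁ := 0
  a₂ := -(1 + t)
  a₃ := 0
  a₄ := t
  a₆ := 0

/-- `(1 - l) (l + s)²`: for a square root `s` of `l² - l + 1` this is `Λ⁺(l)`, and `Λ⁻(l)` is
obtained from the other square root `-s`. -/
def bigLambda {k : Type*} [Field k] (l s : k) : k := (1 - l) * (l + s) ^ 2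

/-! Put `E` in Legendre form with parameter `L`, let `ω` generate the order and let `α = 2ω - 1`, so
that `α² = -3p`. Since `α + 1 = 2ω`, the endomorphism `α` fixes every point of order two. Everything
is then read on the `x`-line: a nonzero endomorphism has the form `(x, y) ↦ (u(x), y v(x))`,
products become compositions of the functions `u`, and signs disappear. So the function `a` of `α`
satisfies `a ∘ a = U (3 * p)`, where `U n` belongs to multiplication by `n`.

Pulling back the invariant differential gives `(U n)' = n * V n` (`IsMultiplication.der_U`). Hence
`U (3 * p)`, and with it `a`, has derivative zero, and `a = u ^ p`. Comparison with the separable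
function `U 3` shows that `U p` is even a `p²`-th power (`exists_U_char_eq`). Its root has degree at
most one, because `U n` has degree at most `n²`, and it respects the labels of the points of order
two, so it is the identity: `U p = X ^ p²` and `L ^ p² = L`, the supersingular situation. What
remains of `α` is a map `u` of degree at most three from the curve of parameter `L` to that of
parameter `M = L ^ p`, with `u ~ c X` at infinity and `9 c ^ (p + p²) = 1` (`exists_descent`).

Such maps form a rational family (`IsTorsionKummerMap.exists_param`): ramification forces the shape
of `u`, and there is `n` with `n² c = 1`, `16 n L = (3 - n)(1 + n)³` and `16 n³ M = (3 - n)³ (1 +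
n)`. Together with `M = L ^ p` this leaves `n ^ (p + 1) = ±3`, and the plus sign would force `n² =
1` (`pow_mul_eq_neg_three`). When `n ^ (p + 1) = -3`, the element `λ = (n + n ^ p + 2) / 4` lies in
the prime field, `(n - n ^ p) / 4` is a square root of `λ² - λ + 1`, and the formula for `L` is the
one for `Λ` (`exists_bigLambda_eq`). -/

section RationalFunctions

open Polynomial Filter

variable {k : Type*} [Field k]

/-! ### Rational functions as functions at almost all points, and their composition. -/

namespace RatFunc

/-- The value of a rational function at a point of the base field. -/
noncomputable def ev (f : RatFunc k) (x : k) : k := f.eval (RingHom.id k) x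

theorem ev_eq (f : RatFunc k) (x : k) : f.ev x = f.num.eval x / f.denom.eval x := rfl

@[simp] theorem ev_X (x : k) : (X : RatFunc k).ev x = x := by simp [ev]

@[simp] theorem ev_C (c x : k) : (C c).ev x = c := by simp [ev]

theorem eventually_eval_ne_zero {p : k[X]} (hp : p ≠ 0) : ∀ᶠ x in cofinite, p.eval x ≠ 0 := by
  have h : {x | p.IsRoot x}.Finite := Polynomial.finite_setOfPred_isRoot hp
  exact h.compl_mem_cofinite

theorem eventually_denom_ne_zero (f : RatFunc k) : ∀ᶠ x in cofinite, f.denom.eval x ≠ 0 :=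
  eventually_eval_ne_zero f.denom_ne_zero

theorem eventually_ev_notMem {f : RatFunc k} (hf : ¬ ∃ c, f = C c) {s : Set k} (hs : s.Finite) :
    ∀ᶠ x in cofinite, f.ev x ∉ s := by
  have key : ∀ v ∈ s, ∀ᶠ x in cofinite, f.ev x ≠ v := by
    intro v _
    have h : f.num - Polynomial.C v * f.denom ≠ 0 := by
      intro h
      refine hf ⟨v, ?_⟩
      rw [← num_div_denom f, sub_eq_zero.1 h, map_mul, mul_div_assoc, div_self
        (by simpa using f.denom_ne_zero), mul_one, algebraMap_C]
    filter_upwards [eventually_eval_ne_zero h, f.eventually_denom_ne_zero] with x hx hd hv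
    rw [ev_eq, div_eq_iff hd] at hv
    apply hx
    simp [hv]
  filter_upwards [(hs.eventually_all).2 key] with x hx hm
  exact hx _ hm rfl

theorem tendsto_ev {f : RatFunc k} (hf : ¬ ∃ c, f = C c) : Tendsto f.ev cofinite cofinite := by
  intro s hs
  have := eventually_ev_notMem hf (s := sᶜ) hs
  rw [mem_map]
  filter_upwards [this] with x hx using by simpa using hx

section Germ

variable [Infinite k]

/-- Polynomials as germs of functions along the hyperfilter. -/
noncomputable def polyGerm (k : Type*) [Field k] [Infinite k] :
    k[X] →+* Germ (hyperfilter k : Filter k) k :=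
  (Germ.coeRingHom _).comp (RingHom.pi fun x => evalRingHom x)

theorem polyGerm_injective : Function.Injective (polyGerm k) := by
  rw [injective_iff_map_eq_zero]
  intro p hp
  by_contra h
  have h1 := (eventually_eval_ne_zero h).filter_mono (hyperfilter_le_cofinite (α := k))
  have h2 : ∀ᶠ x in (hyperfilter k : Filter k), p.eval x = 0 := Germ.coe_eq.1 hp
  exact (h1.and h2).exists.elim fun x hx => hx.1 hx.2

/-- Rational functions as germs of functions along the hyperfilter. -/
noncomputable def toGerm (k : Type*) [Field k] [Infinite k] :
    RatFunc k →+* Germ (hyperfilter k : Filter k) k :=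
  IsFractionRing.lift (polyGerm_injective (k := k))

/-- The hyperfilter is an ultrafilter, so the germs form a field and division is respected. Formulas
can thus be compared pointwise without tracking denominators. -/
theorem toGerm_apply (f : RatFunc k) : toGerm k f = ((fun x => f.ev x : k → k) : Germ _ k) := by
  conv_lhs => rw [← num_div_denom f]
  rw [map_div₀, toGerm, IsFractionRing.lift_algebraMap, IsFractionRing.lift_algebraMap]
  rfl

theorem toGerm_injective : Function.Injective (toGerm k) := (toGerm k).injective

theorem toGerm_C (c : k) : toGerm k (C c) = ((fun _ => c : k → k) : Germ _ k) := by
  simp [toGerm_apply]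

theorem coe_germ_eq {k : Type*} [Infinite k] {f g : k → k} (h : ∀ᶠ x in cofinite, f x = g x) :
    (f : Germ (hyperfilter k : Filter k) k) = g :=
  Germ.coe_eq.2 (h.filter_mono hyperfilter_le_cofinite)

theorem eq_of_eventually {f g : RatFunc k} (h : ∀ᶠ x in cofinite, f.ev x = g.ev x) : f = g :=
  toGerm_injective <| by
    rw [toGerm_apply, toGerm_apply]
    exact coe_germ_eq h

end Germ

/-- Composition of rational functions: `comp z f = f(z)`. -/
noncomputable def comp (z f : RatFunc k) : RatFunc k := aeval z f.num / aeval z f.denom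

/-- Composition with a fixed nonconstant rational function. -/
noncomputable def compHom (z : RatFunc k) (hz : ¬ ∃ c, z = C c) : RatFunc k →+* RatFunc k :=
  IsFractionRing.lift (g := (aeval z : k[X] →ₐ[k] RatFunc k).toRingHom)
    (transcendental_iff_injective.1 (transcendental_of_ne_C z hz))

theorem compHom_algebraMap (z : RatFunc k) (hz : ¬ ∃ c, z = C c) (p : k[X]) :
    compHom z hz (algebraMap _ _ p) = aeval z p :=
  IsFractionRing.lift_algebraMap _ p

theorem compHom_apply (z : RatFunc k) (hz : ¬ ∃ c, z = C c) (f : RatFunc k) :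
    compHom z hz f = comp z f := by
  conv_lhs => rw [← num_div_denom f]
  rw [map_div₀, compHom_algebraMap, compHom_algebraMap, comp]

theorem compHom_X (z : RatFunc k) (hz : ¬ ∃ c, z = C c) : compHom z hz X = z := by
  rw [← algebraMap_X, compHom_algebraMap, aeval_X]

theorem compHom_C (z : RatFunc k) (hz : ¬ ∃ c, z = C c) (c : k) : compHom z hz (C c) = C c := by
  rw [← algebraMap_C, compHom_algebraMap, aeval_C]; rfl

theorem aeval_ne_zero {z : RatFunc k} (hz : ¬ ∃ c, z = C c) {p : k[X]} (hp : p ≠ 0) :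
    aeval z p ≠ 0 := fun h =>
  hp ((transcendental_iff.1 (transcendental_of_ne_C z hz)) p h)

theorem toGerm_comp [Infinite k] {z f : RatFunc k} :
    toGerm k (comp z f) = ((fun x => f.ev (z.ev x) : k → k) : Germ _ k) := by
  have key : ∀ p : k[X], toGerm k (aeval z p) =
      ((fun x => p.eval (z.ev x) : k → k) : Germ _ k) := by
    intro p
    induction p using Polynomial.induction_on' with
    | add p q hp hq => rw [map_add, map_add, hp, hq]; exact congrArg _ (_root_.funext fun x => (Polynomial.eval_add ..).symm)
    | monomial n a =>
      rw [aeval_monomial, map_mul, map_pow, toGerm_apply z, algebraMap_eq_C, toGerm_C]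
      simp only [eval_monomial]; rfl
  rw [comp, map_div₀, key, key]
  rfl

theorem comp_ev [Infinite k] {z f g : RatFunc k}
    (h : ∀ᶠ x in cofinite, f.ev (z.ev x) = g.ev x) : comp z f = g :=
  toGerm_injective <| by
    rw [toGerm_comp, toGerm_apply]
    exact coe_germ_eq h

end RatFunc

end RationalFunctions

section RationalFunctions

open Polynomial Filter

variable {k : Type*} [Field k]

namespace RatFunc

theorem algebraMap_denom_ne_zero (f : RatFunc k) : algebraMap k[X] (RatFunc k) f.denom ≠ 0 := by
  simpa using f.denom_ne_zero

theorem mul_denom (f : RatFunc k) :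
    f * algebraMap k[X] (RatFunc k) f.denom = algebraMap k[X] (RatFunc k) f.num := by
  have := num_div_denom f
  rwa [div_eq_iff f.algebraMap_denom_ne_zero, eq_comm] at this

/-! ### The derivation `d/dx` and `p`-th powers. -/

section Deriv

/-- The homomorphism `f ↦ f + f' ε` from rational functions to dual numbers. -/
noncomputable def dualHom (k : Type*) [Field k] : RatFunc k →+* TrivSqZeroExt (RatFunc k) (RatFunc k) :=
  IsLocalization.lift (M := nonZeroDivisors k[X])
    (g := (aeval (TrivSqZeroExt.inl X + TrivSqZeroExt.inr 1 :
      TrivSqZeroExt (RatFunc k) (RatFunc k)) : k[X] →ₐ[k] _).toRingHom) <| by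
    rintro ⟨p, hp⟩
    rw [TrivSqZeroExt.isUnit_iff_isUnit_fst]
    have h : (TrivSqZeroExt.fstHom k (RatFunc k) (RatFunc k)).comp (aeval (TrivSqZeroExt.inl X +
        TrivSqZeroExt.inr 1)) = aeval (X : RatFunc k) := by
      ext; simp
    have h2 : TrivSqZeroExt.fst (aeval (TrivSqZeroExt.inl X + TrivSqZeroExt.inr 1 :
        TrivSqZeroExt (RatFunc k) (RatFunc k)) p) = aeval (X : RatFunc k) p :=
      DFunLike.congr_fun h p
    change IsUnit (TrivSqZeroExt.fst (aeval _ p))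
    rw [h2, aeval_X_left_eq_algebraMap, isUnit_iff_ne_zero]
    simpa using nonZeroDivisors.ne_zero hp

theorem dualHom_algebraMap (p : k[X]) : dualHom k (algebraMap _ _ p) =
    aeval (TrivSqZeroExt.inl X + TrivSqZeroExt.inr 1 :
      TrivSqZeroExt (RatFunc k) (RatFunc k)) p :=
  IsLocalization.lift_eq _ p

theorem fst_dualHom (f : RatFunc k) : (dualHom k f).fst = f := by
  have h : ((TrivSqZeroExt.fstHom k (RatFunc k) (RatFunc k)).toRingHom.comp (dualHom k)) =
      RingHom.id _ := by
    refine IsLocalization.ringHom_ext (nonZeroDivisors k[X]) ?_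
    ext c
    · simp only [RingHom.coe_comp, Function.comp_apply, dualHom_algebraMap]
      simp [algebraMap_eq_C]
    · simp only [RingHom.coe_comp, Function.comp_apply, dualHom_algebraMap]
      simp
  exact DFunLike.congr_fun h f

/-- The derivation `d/dx` on rational functions. -/
noncomputable def der (k : Type*) [Field k] : Derivation k (RatFunc k) (RatFunc k) :=
  Derivation.mk'
    { toFun := fun f => (dualHom k f).snd
      map_add' := by simp
      map_smul' := by
        intro c f
        have h : dualHom k (algebraMap k (RatFunc k) c) = TrivSqZeroExt.inl (algebraMap k _ c) := by
          rw [algebraMap_eq_C, ← algebraMap_C, dualHom_algebraMap, aeval_C]; rfl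
        rw [Algebra.smul_def, map_mul, h]
        simp [Algebra.smul_def] } <| by
    intro f g
    change (dualHom k (f * g)).snd = _ • (dualHom k g).snd + _ • (dualHom k f).snd
    rw [map_mul, TrivSqZeroExt.snd_mul, fst_dualHom, fst_dualHom]
    simp [mul_comm]

@[simp] theorem der_X : der k X = 1 := by
  change (dualHom k X).snd = 1
  rw [← algebraMap_X, dualHom_algebraMap]
  simp

@[simp] theorem der_C (c : k) : der k (C c) = 0 := (der k).map_algebraMap c

theorem der_aeval (z : RatFunc k) (p : k[X]) :
    der k (aeval z p) = aeval z p.derivative * der k z := by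
  rw [Derivation.map_aeval, smul_eq_mul]

theorem der_algebraMap (p : k[X]) :
    der k (algebraMap k[X] (RatFunc k) p) = algebraMap _ _ p.derivative := by
  rw [← aeval_X_left_eq_algebraMap, der_aeval, der_X, mul_one, aeval_X_left_eq_algebraMap]

theorem der_pow_char (p : ℕ) [CharP k p] (f : RatFunc k) : der k (f ^ p) = 0 := by
  have : CharP (RatFunc k) p := charP_of_injective_algebraMap (algebraMap k (RatFunc k)).injective p
  rw [Derivation.leibniz_pow, ← Nat.cast_smul_eq_nsmul (RatFunc k), CharP.cast_eq_zero, zero_smul]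

/-- Multiplication by the `p`-th power of the denominator turns `f` into a polynomial with zero
derivative, hence a polynomial in `X ^ p`, whose coefficients have `p`-th roots because `k` is
perfect. -/
theorem exists_pow_of_der_eq_zero (p : ℕ) [Fact p.Prime] [CharP k p] [PerfectRing k p]
    {f : RatFunc k} (hf : der k f = 0) : ∃ g, f = g ^ p := by
  have hp : p ≠ 0 := (Fact.out : p.Prime).ne_zero
  have hd : algebraMap k[X] (RatFunc k) f.denom ≠ 0 := by simpa using f.denom_ne_zero
  set q : k[X] := f.num * f.denom ^ (p - 1) with hq
  have h1 : f = algebraMap _ _ q / (algebraMap _ _ f.denom) ^ p := by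
    obtain ⟨m, rfl⟩ : ∃ m, p = m + 1 := ⟨p - 1, by omega⟩
    conv_lhs => rw [← num_div_denom f]
    rw [hq, Nat.add_sub_cancel, map_mul, map_pow, pow_succ]
    field_simp
  have h2 : q.derivative = 0 := by
    have : der k (algebraMap _ _ q) = 0 := by
      have h3 : algebraMap k[X] (RatFunc k) q = f * (algebraMap _ _ f.denom) ^ p := by
                rw [eq_comm, ← eq_div_iff (pow_ne_zero _ hd)]; exact h1
      rw [h3, Derivation.leibniz, der_pow_char, hf]
      simp
    rw [der_algebraMap] at this
    simpa using this
  have h3 := Polynomial.expand_contract p h2 hp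
  have h4 : ∃ r : k[X], q = r ^ p := by
    refine ⟨(contract p q).map ((frobeniusEquiv k p).symm : k →+* k), ?_⟩
    conv_lhs => rw [← h3]
    exact polynomial_expand_eq ..
  obtain ⟨r, hr⟩ := h4
  exact ⟨algebraMap _ _ r / algebraMap _ _ f.denom, by rw [div_pow, ← map_pow, ← hr, ← h1]⟩

end Deriv

/-! ### Valuation and values at infinity. -/

section Infinity

open WithZero

/-- The valuation at infinity. -/
noncomputable def infv (k : Type*) [Field k] : Valuation (RatFunc k) ℤᵐ⁰ := by
  classical exact inftyValuation k

instance : Valuation.IsTrivialOn k (infv k) := by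
  classical exact inferInstanceAs (Valuation.IsTrivialOn k (inftyValuation k))

theorem infv_eq {f : RatFunc k} (hf : f ≠ 0) : infv k f = exp f.intDegree := by
  classical exact inftyValuation_of_nonzero k hf

@[simp] theorem infv_C {c : k} (hc : c ≠ 0) : infv k (C c) = 1 := by
  classical exact inftyValuation.C k hc

theorem infv_C_le (c : k) : infv k (C c) ≤ 1 := by
  by_cases h : c = 0
  · simp [h]
  · rw [infv_C h]

theorem one_lt_infv_iff {f : RatFunc k} :
    1 < infv k f ↔ f.denom.natDegree < f.num.natDegree := by
  by_cases hf : f = 0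
  · simp [hf]
  · rw [infv_eq hf, ← exp_zero, exp_lt_exp, intDegree]
    omega

theorem one_lt_infv_X : 1 < infv k (X : RatFunc k) := by
  simp [one_lt_infv_iff]

theorem infv_aeval {z : RatFunc k} (hz : 1 < infv k z) {p : k[X]} (hp : p ≠ 0) :
    infv k (aeval z p) = infv k z ^ p.natDegree :=
  Polynomial.valuation_aeval_eq_valuation_X_pow_natDegree_of_one_lt_valuation_X z hz hp

theorem nonconst_of_one_lt_infv {z : RatFunc k} (hz : 1 < infv k z) : ¬ ∃ c, z = C c := by
  rintro ⟨c, rfl⟩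
  exact (infv_C_le c).not_gt hz

/-- `f` takes the finite value `w` at infinity. -/
def Lim (f : RatFunc k) (w : k) : Prop := infv k (f - C w) < 1

theorem lim_C (c : k) : Lim (C c) c := by simp [Lim]

theorem Lim.le {f : RatFunc k} {w : k} (h : Lim f w) : infv k f ≤ 1 := by
  have := (infv k).map_add (f - C w) (C w)
  rw [sub_add_cancel] at this
  exact this.trans (max_le (_root_.le_of_lt (show infv k (f - C w) < 1 from h)) (infv_C_le w))

theorem Lim.add {f g : RatFunc k} {a b : k} (hf : Lim f a) (hg : Lim g b) :
    Lim (f + g) (a + b) := by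
  have : f + g - C (a + b) = (f - C a) + (g - C b) := by rw [map_add]; ring
  rw [Lim, this]
  exact (infv k).map_add_lt hf hg

theorem Lim.mul {f g : RatFunc k} {a b : k} (hf : Lim f a) (hg : Lim g b) :
    Lim (f * g) (a * b) := by
  have : f * g - C (a * b) = (f - C a) * g + C a * (g - C b) := by rw [map_mul]; ring
  rw [Lim, this]
  refine (infv k).map_add_lt ?_ ?_
  · rw [map_mul]
    exact (mul_le_of_le_one_right zero_le hg.le).trans_lt hf
  · rw [map_mul]
    exact (mul_le_of_le_one_left zero_le (infv_C_le a)).trans_lt hg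

theorem Lim.neg {f : RatFunc k} {a : k} (hf : Lim f a) : Lim (-f) (-a) := by
  have := (lim_C (-1)).mul hf
  simpa using this

theorem Lim.sub {f g : RatFunc k} {a b : k} (hf : Lim f a) (hg : Lim g b) :
    Lim (f - g) (a - b) := by
  simpa [sub_eq_add_neg] using hf.add hg.neg

theorem Lim.pow {f : RatFunc k} {a : k} (hf : Lim f a) (n : ℕ) : Lim (f ^ n) (a ^ n) := by
  induction n with
  | zero => simpa using lim_C (1 : k)
  | succ n ih => simpa [pow_succ] using ih.mul hf

theorem Lim.unique {f : RatFunc k} {a b : k} (ha : Lim f a) (hb : Lim f b) : a = b := by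
  by_contra h
  have := ha.sub hb
  rw [sub_self, Lim, zero_sub, Valuation.map_neg, infv_C (sub_ne_zero.2 h)] at this
  exact lt_irrefl _ this

theorem Lim.infv_eq_one {f : RatFunc k} {a : k} (h : Lim f a) (ha : a ≠ 0) : infv k f = 1 := by
  have := Valuation.map_add_eq_of_lt_right (infv k) (x := f - C a) (y := C a)
    (by rw [infv_C ha]; exact h)
  rwa [sub_add_cancel, infv_C ha] at this

theorem Lim.inv {f : RatFunc k} {a : k} (h : Lim f a) (ha : a ≠ 0) : Lim f⁻¹ a⁻¹ := by
  have h1 := h.infv_eq_one ha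
  have hf : f ≠ 0 := by rintro rfl; simp at h1
  have hC : (C a : RatFunc k) ≠ 0 := by simpa using ha
  have : f⁻¹ - C a⁻¹ = -((f - C a) * f⁻¹ * (C a)⁻¹) := by
    rw [map_inv₀]; field_simp; ring
  rw [Lim, this, Valuation.map_neg, map_mul, map_mul, map_inv₀, map_inv₀, h1, infv_C ha]
  simpa using (show infv k (f - C a) < 1 from h)

theorem Lim.div {f g : RatFunc k} {a b : k} (hf : Lim f a) (hg : Lim g b) (hb : b ≠ 0) :
    Lim (f / g) (a / b) := by
  simpa [div_eq_mul_inv] using hf.mul (hg.inv hb)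

theorem lim_inv_zero {f : RatFunc k} (hf : 1 < infv k f) : Lim f⁻¹ 0 := by
  rw [Lim, map_zero, sub_zero, map_inv₀]
  exact inv_lt_one_of_one_lt₀ hf

theorem lim_inv_X : Lim (X : RatFunc k)⁻¹ 0 := lim_inv_zero one_lt_infv_X

theorem Lim.aeval {z : RatFunc k} {a : k} (h : Lim z a) (p : k[X]) :
    Lim (Polynomial.aeval z p) (p.eval a) := by
  induction p using Polynomial.induction_on' with
  | add p q hp hq => simpa using hp.add hq
  | monomial n c => simpa [aeval_monomial, algebraMap_eq_C] using (lim_C c).mul (h.pow n)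

theorem exists_lim {f : RatFunc k} (hf : ¬ 1 < infv k f) : ∃ w, Lim f w := by
  rw [one_lt_infv_iff, not_lt] at hf
  -- The denominator is monic, so the value at infinity is the coefficient of the numerator in the
  -- degree of the denominator, possibly zero.
  set w := f.num.coeff f.denom.natDegree with hw
  refine ⟨w, ?_⟩
  have hd : algebraMap k[X] (RatFunc k) f.denom ≠ 0 := by simpa using f.denom_ne_zero
  set q := f.num - Polynomial.C w * f.denom with hq
  have h1 : f - C w = algebraMap _ _ q / algebraMap _ _ f.denom := by
    rw [eq_div_iff hd, sub_mul, hq, map_sub, map_mul, algebraMap_C, mul_denom]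
  by_cases h0 : q = 0
  · rw [Lim, h1, h0]; simp
  have h2 : q.natDegree < f.denom.natDegree := by
    refine lt_of_le_of_ne ?_ ?_
    · exact (natDegree_sub_le _ _).trans (max_le hf (natDegree_C_mul_le _ _))
    · intro h
      have : q.coeff f.denom.natDegree = 0 := by
        rw [hq, coeff_sub, coeff_C_mul, coeff_natDegree, f.monic_denom.leadingCoeff]
        simp [hw]
      rw [← h] at this
      exact h0 (leadingCoeff_eq_zero.1 this)
  rw [Lim, h1, map_div₀, infv_eq (by simpa using h0), infv_eq hd, intDegree_polynomial,
    intDegree_polynomial, ← exp_sub, ← exp_zero, exp_lt_exp]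
  omega

theorem Lim.comp {z f : RatFunc k} {w : k} (hz : 1 < infv k z) (h : Lim f w) :
    Lim (comp z f) w := by
  have hnc := nonconst_of_one_lt_infv hz
  have h1 : RatFunc.comp z f - C w = RatFunc.comp z (f - C w) := by
    rw [← compHom_apply z hnc, ← compHom_apply z hnc, map_sub, compHom_C]
  rw [Lim, h1]
  rw [Lim] at h
  generalize f - C w = g at h
  by_cases hg : g = 0
  · simp [hg, RatFunc.comp]
  rw [infv_eq hg, ← exp_zero, exp_lt_exp, intDegree] at h
  have h3 : g.num.natDegree < g.denom.natDegree := by omega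
  rw [RatFunc.comp, map_div₀, infv_aeval hz (num_ne_zero hg), infv_aeval hz g.denom_ne_zero]
  have h0 : infv k z ≠ 0 := (zero_lt_one.trans hz).ne'
  rw [div_lt_one₀ (pow_pos (zero_lt_one.trans hz) _)]
  exact pow_lt_pow_right₀ hz h3

end Infinity

end RatFunc

end RationalFunctions

/-! ### Degrees of compositions. -/

section RationalFunctions

open Polynomial Filter

variable {k : Type*} [Field k]

namespace RatFunc

theorem natDegree_num_of_isCoprime {f : RatFunc k} {a b : k[X]} (hb : b ≠ 0)
    (hab : IsCoprime a b) (h : f * algebraMap _ _ b = algebraMap _ _ a) :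
    f.num.natDegree = a.natDegree := by
  have hb' : algebraMap k[X] (RatFunc k) b ≠ 0 := by simpa using hb
  have h1 : f.num * b = a * f.denom := by
    rw [num_mul_eq_mul_denom_iff hb, eq_div_iff hb', h]
  have h2 : f.num ∣ a := f.isCoprime_num_denom.dvd_of_dvd_mul_right ⟨b, h1.symm⟩
  have h3 : a ∣ f.num := hab.dvd_of_dvd_mul_right ⟨f.denom, h1⟩
  exact natDegree_eq_of_degree_eq (degree_eq_degree_of_associated (associated_of_dvd_dvd h2 h3))

theorem natDegree_num_pow (f : RatFunc k) (n : ℕ) :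
    (f ^ n).num.natDegree = n * f.num.natDegree := by
  rw [natDegree_num_of_isCoprime (a := f.num ^ n) (b := f.denom ^ n)
    (pow_ne_zero _ f.denom_ne_zero) f.isCoprime_num_denom.pow, natDegree_pow]
  rw [map_pow, map_pow, ← mul_pow, mul_denom]

/-- This clears denominators in `p(c/d)`. Modulo `d` only the top term survives, which later gives
coprimality with `d`. -/
theorem exists_homogenization (p c d : k[X]) (hd : d ≠ 0) {n : ℕ} (hn : p.natDegree ≤ n) :
    ∃ q r : k[X], algebraMap _ (RatFunc k) q =
      algebraMap _ _ d ^ n * aeval (algebraMap k[X] (RatFunc k) c / algebraMap _ _ d) p ∧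
      q = Polynomial.C (p.coeff n) * c ^ n + d * r := by
  have hd' : algebraMap k[X] (RatFunc k) d ≠ 0 := by simpa using hd
  refine ⟨∑ i ∈ Finset.range (n + 1), Polynomial.C (p.coeff i) * c ^ i * d ^ (n - i),
    ∑ i ∈ Finset.range n, Polynomial.C (p.coeff i) * c ^ i * d ^ (n - i - 1), ?_, ?_⟩
  · rw [aeval_eq_sum_range' (Nat.lt_succ_of_le hn), Finset.mul_sum, map_sum]
    refine Finset.sum_congr rfl fun i hi => ?_
    have hi' : i ≤ n := Nat.lt_succ_iff.1 (Finset.mem_range.1 hi)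
    obtain ⟨j, rfl⟩ := Nat.exists_eq_add_of_le hi'
    rw [Nat.add_sub_cancel_left, map_mul, map_mul, map_pow, map_pow, algebraMap_C,
      Algebra.smul_def, algebraMap_eq_C, div_pow, pow_add]
    field_simp
  · rw [Finset.sum_range_succ, Finset.mul_sum, add_comm]
    congr 1
    · simp
    · refine Finset.sum_congr rfl fun i hi => ?_
      have hi' : i < n := Finset.mem_range.1 hi
      obtain ⟨j, rfl⟩ := Nat.exists_eq_add_of_lt hi'
      have e1 : i + j + 1 - i = j + 1 := by omega
      rw [e1, Nat.add_sub_cancel, pow_succ]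
      ring

/-- For a function with a pole at infinity the degree of the numerator is the degree of the map.
Homogenized numerator and denominator stay coprime, so no cancellation occurs, and the degree is
read from the valuation at infinity. -/
theorem natDegree_num_comp {z f : RatFunc k} (hz : 1 < infv k z) (hf : 1 < infv k f) :
    (comp z f).num.natDegree = f.num.natDegree * z.num.natDegree := by
  have hnc := nonconst_of_one_lt_infv hz
  set c := z.num with hc
  set d := z.denom with hd
  have hd0 : d ≠ 0 := z.denom_ne_zero
  have hd' : algebraMap k[X] (RatFunc k) d ≠ 0 := z.algebraMap_denom_ne_zero
  have hzcd : algebraMap k[X] (RatFunc k) c / algebraMap _ _ d = z := num_div_denom z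
  set a := f.num.natDegree with ha
  set b := f.denom.natDegree with hb
  have hab : b < a := one_lt_infv_iff.1 hf
  obtain ⟨u, w, huw⟩ := f.isCoprime_num_denom
  set M := max u.natDegree w.natDegree
  obtain ⟨A, RA, hA, hA'⟩ := exists_homogenization f.num c d hd0 (le_refl a)
  obtain ⟨B, RB, hB, -⟩ := exists_homogenization f.denom c d hd0 (le_refl b)
  obtain ⟨U, RU, hU, -⟩ := exists_homogenization u c d hd0 (le_max_left _ _ : _ ≤ M)
  obtain ⟨W, RW, hW, -⟩ := exists_homogenization w c d hd0 (le_max_right _ _ : _ ≤ M)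
  rw [hzcd] at hA hB hU hW
  have hf0 : f ≠ 0 := by rintro rfl; simp at hf
  have hlc : f.num.coeff a ≠ 0 := by
    rw [ha, coeff_natDegree]; simpa using hf0
  have hpow : algebraMap k[X] (RatFunc k) d ^ (a - b) * algebraMap k[X] (RatFunc k) d ^ b =
      algebraMap k[X] (RatFunc k) d ^ a := by rw [← pow_add]; congr 1; omega
  have hA0 : A ≠ 0 := by
    rintro rfl
    rw [map_zero, eq_comm, mul_eq_zero] at hA
    exact hA.elim (pow_ne_zero _ hd') (aeval_ne_zero hnc (num_ne_zero hf0))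
  have hB0 : B ≠ 0 := by
    rintro rfl
    rw [map_zero, eq_comm, mul_eq_zero] at hB
    exact hB.elim (pow_ne_zero _ hd') (aeval_ne_zero hnc f.denom_ne_zero)
  have hcopA : IsCoprime A (d ^ (M + a)) := by
    refine IsCoprime.pow_right ?_
    rw [hA']
    refine IsCoprime.add_mul_left_left ?_ _
    have : IsUnit (Polynomial.C (f.num.coeff a)) := by simpa using hlc
    rw [isCoprime_mul_unit_left_left this]
    exact IsCoprime.pow_left z.isCoprime_num_denom
  -- The Bezout identity of `f`, evaluated at `z` and cleared of denominators: a common factor can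
  -- only come from `d`, and `hcopA` excludes that.
  have hbez : U * A + W * (B * d ^ (a - b)) = d ^ (M + a) := by
    apply algebraMap_injective k
    simp only [map_add, map_mul, map_pow]
    rw [hU, hA, hW, hB]
    have h1 := congrArg (aeval z) huw
    rw [map_add, map_mul, map_mul, map_one] at h1
    rw [pow_add]
    linear_combination (algebraMap k[X] (RatFunc k) d ^ M * algebraMap k[X] (RatFunc k) d ^ a) * h1
      + (algebraMap k[X] (RatFunc k) d ^ M * aeval z w * aeval z f.denom) * hpow
  have hcop : IsCoprime A (B * d ^ (a - b)) := by
    obtain ⟨x, y, hxy⟩ := hcopA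
    exact ⟨x + y * U, y * W, by rw [← hxy, ← hbez]; ring⟩
  have hmain : comp z f * algebraMap _ _ (B * d ^ (a - b)) = algebraMap _ _ A := by
    have h2 : aeval z f.denom ≠ 0 := aeval_ne_zero hnc f.denom_ne_zero
    rw [map_mul, map_pow, hA, hB, comp, div_mul_eq_mul_div, div_eq_iff h2]
    linear_combination (aeval z f.num * aeval z f.denom) * hpow
  rw [natDegree_num_of_isCoprime (mul_ne_zero hB0 (pow_ne_zero _ hd0)) hcop hmain]
  have hv : infv k (algebraMap _ _ A) = infv k (algebraMap _ _ c) ^ a := by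
    rw [hA, map_mul, infv_aeval hz (num_ne_zero hf0), map_pow, ← mul_pow, ← map_mul, mul_comm,
      mul_denom]
  have hz0 : z ≠ 0 := by rintro rfl; simp at hz
  have hc0 : c ≠ 0 := num_ne_zero hz0
  rw [infv_eq (by simpa using hA0), infv_eq (by simpa using hc0), intDegree_polynomial,
    intDegree_polynomial, ← WithZero.exp_nsmul, WithZero.exp_inj] at hv
  have : (A.natDegree : ℤ) = a * c.natDegree := by simpa using hv
  exact_mod_cast this

end RatFunc

end RationalFunctions

/-! ### Addition formulas on Legendre curves. -/

section LegendrePoints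

variable {k : Type*} [Field k]

/-- The parameters for which the Legendre equation defines an elliptic curve. -/
structure IsLegendre (L : k) : Prop where
  two : (2 : k) ≠ 0
  zero : L ≠ 0
  one : L ≠ 1

set_option linter.unusedSectionVars false

variable [DecidableEq k] {L : k}

/-- The group of points of the Legendre curve. -/
abbrev LegendrePoint (L : k) := (legendreCurve L).toAffine.Point

/-- `P` is the affine point `(x, y)`. -/
def IsPt (P : LegendrePoint L) (x y : k) : Prop :=
  ∃ h, P = WeierstrassCurve.Affine.Point.some x y h

omit [DecidableEq k] in
theorem legendre_nonsingular_iff (hL : IsLegendre L) (x y : k) :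
    (legendreCurve L).toAffine.Nonsingular x y ↔ y ^ 2 = x * (x - 1) * (x - L) := by
  have h2 := hL.two
  have h0 := hL.zero
  have h1 := sub_ne_zero.2 hL.one
  rw [WeierstrassCurve.Affine.nonsingular_iff, WeierstrassCurve.Affine.equation_iff]
  simp only [legendreCurve, WeierstrassCurve.toAffine]
  constructor
  · rintro ⟨h, -⟩
    linear_combination h
  · intro h
    refine ⟨by linear_combination h, ?_⟩
    by_contra! hcon
    obtain ⟨hx, hy⟩ := hcon
    have hy0 : y = 0 := by
      have : 2 * y = 0 := by linear_combination hy
      exact (mul_eq_zero.1 this).resolve_left h2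
    subst hy0
    have hcases : x = 0 ∨ x = 1 ∨ x = L := by
      have : x * (x - 1) * (x - L) = 0 := by rw [← h]; ring
      rcases mul_eq_zero.1 this with h | h
      · rcases mul_eq_zero.1 h with h | h
        · exact Or.inl h
        · exact Or.inr (Or.inl (sub_eq_zero.1 h))
      · exact Or.inr (Or.inr (sub_eq_zero.1 h))
    rcases hcases with rfl | rfl | rfl
    · apply h0; linear_combination -hx
    · apply h1; linear_combination hx
    · refine mul_ne_zero h0 h1 ?_
      linear_combination -hx

theorem IsPt.eq (hL : IsLegendre L) {P : LegendrePoint L} {x y : k} (h : IsPt P x y) :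
    y ^ 2 = x * (x - 1) * (x - L) :=
  (legendre_nonsingular_iff hL x y).1 h.1

theorem exists_isPt (hL : IsLegendre L) {x y : k} (h : y ^ 2 = x * (x - 1) * (x - L)) :
    ∃ P : LegendrePoint L, IsPt P x y :=
  ⟨_, (legendre_nonsingular_iff hL x y).2 h, rfl⟩

theorem exists_isPt_of_x [IsAlgClosed k] (hL : IsLegendre L) (x : k) :
    ∃ (y : k) (P : LegendrePoint L), IsPt P x y := by
  obtain ⟨y, hy⟩ := IsAlgClosed.exists_pow_nat_eq (x * (x - 1) * (x - L)) (n := 2) two_pos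
  exact ⟨y, exists_isPt hL hy⟩

theorem IsPt.unique {P : LegendrePoint L} {x y x' y' : k} (h : IsPt P x y) (h' : IsPt P x' y') :
    x = x' ∧ y = y' := by
  obtain ⟨h1, rfl⟩ := h
  obtain ⟨h2, e⟩ := h'
  simpa using e

theorem IsPt.ext {P Q : LegendrePoint L} {x y : k} (h : IsPt P x y) (h' : IsPt Q x y) :
    P = Q := by
  obtain ⟨h1, rfl⟩ := h
  obtain ⟨h2, rfl⟩ := h'
  rfl

theorem IsPt.ne_zero {P : LegendrePoint L} {x y : k} (h : IsPt P x y) : P ≠ 0 := by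
  obtain ⟨h1, rfl⟩ := h
  exact WeierstrassCurve.Affine.Point.some_ne_zero h1

theorem exists_isPt_of_ne_zero {P : LegendrePoint L} (h : P ≠ 0) : ∃ x y, IsPt P x y := by
  cases P with
  | zero => exact absurd rfl h
  | some x y h' => exact ⟨x, y, h', rfl⟩

theorem IsPt.neg {P : LegendrePoint L} {x y : k} (h : IsPt P x y) : IsPt (-P) x (-y) := by
  obtain ⟨h1, rfl⟩ := h
  have hn : (legendreCurve L).toAffine.negY x y = -y := by
    simp [WeierstrassCurve.Affine.negY, legendreCurve]
  rw [WeierstrassCurve.Affine.Point.neg_some]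
  have h2 := (WeierstrassCurve.Affine.nonsingular_neg ..).2 h1
  rw [hn] at h2
  exact ⟨h2, by congr 1⟩

theorem IsPt.eq_or_neg (hL : IsLegendre L) {P Q : LegendrePoint L} {x y y' : k} (h : IsPt P x y)
    (h' : IsPt Q x y') : P = Q ∨ P = -Q := by
  have h1 : (y - y') * (y + y') = 0 := by linear_combination h.eq hL - h'.eq hL
  rcases mul_eq_zero.1 h1 with e | e
  · rw [sub_eq_zero.1 e] at h; exact Or.inl (h.ext h')
  · rw [eq_neg_of_add_eq_zero_left e] at h; exact Or.inr (h.ext h'.neg)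

theorem IsPt.add {P Q : LegendrePoint L} {x₁ y₁ x₂ y₂ : k} (h₁ : IsPt P x₁ y₁) (h₂ : IsPt Q x₂ y₂)
    (hx : x₁ ≠ x₂) {l x₃ : k} (hl : l = (y₁ - y₂) / (x₁ - x₂))
    (hx₃ : x₃ = l ^ 2 + (1 + L) - x₁ - x₂) :
    IsPt (P + Q) x₃ (-(l * (x₃ - x₁) + y₁)) := by
  obtain ⟨n₁, rfl⟩ := h₁
  obtain ⟨n₂, rfl⟩ := h₂
  rw [WeierstrassCurve.Affine.Point.add_of_X_ne hx]
  have hs : (legendreCurve L).toAffine.slope x₁ x₂ y₁ y₂ = l := by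
    rw [WeierstrassCurve.Affine.slope_of_X_ne hx, hl]
  have hX : (legendreCurve L).toAffine.addX x₁ x₂ ((legendreCurve L).toAffine.slope x₁ x₂ y₁ y₂) =
      x₃ := by
    rw [hs, hx₃]; simp [WeierstrassCurve.Affine.addX, legendreCurve]; ring
  have hY : (legendreCurve L).toAffine.addY x₁ x₂ y₁
      ((legendreCurve L).toAffine.slope x₁ x₂ y₁ y₂) = -(l * (x₃ - x₁) + y₁) := by
    rw [WeierstrassCurve.Affine.addY, WeierstrassCurve.Affine.negAddY, hX, hs]
    simp [WeierstrassCurve.Affine.negY, legendreCurve]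
  have hn := WeierstrassCurve.Affine.nonsingular_add n₁ n₂ (fun h => hx h.1)
  refine ⟨by rw [hX, hY] at hn; exact hn, ?_⟩
  simp only [WeierstrassCurve.Affine.Point.some.injEq]
  exact ⟨hX, hY⟩

/-- The `x`-coordinate of the double of a point with `x`-coordinate `x`. -/
def dupX {F : Type*} [Field F] (L x : F) : F := (x ^ 2 - L) ^ 2 / (4 * (x * (x - 1) * (x - L)))

/-- The factor by which duplication multiplies the `y`-coordinate. -/
def dupY {F : Type*} [Field F] (L x : F) : F :=
  -((3 * x ^ 2 - 2 * (1 + L) * x + L) / (2 * (x * (x - 1) * (x - L))) * (dupX L x - x) + 1)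

theorem IsPt.double (hL : IsLegendre L) {P : LegendrePoint L} {x y : k} (h : IsPt P x y)
    (hy : y ≠ 0) : IsPt (P + P) (dupX L x) (y * dupY L x) := by
  have hy2 := h.eq hL
  have h2 := hL.two
  have hg : x * (x - 1) * (x - L) ≠ 0 := by rw [← hy2]; exact pow_ne_zero _ hy
  obtain ⟨n₁, rfl⟩ := h
  have hn : (legendreCurve L).toAffine.negY x y = -y := by
    simp [WeierstrassCurve.Affine.negY, legendreCurve]
  have hyn : y ≠ (legendreCurve L).toAffine.negY x y := by
    rw [hn]
    intro h
    apply mul_ne_zero h2 hy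
    linear_combination h
  rw [WeierstrassCurve.Affine.Point.add_self_of_Y_ne hyn]
  set l := (3 * x ^ 2 - 2 * (1 + L) * x + L) / (2 * y) with hl
  have hs : (legendreCurve L).toAffine.slope x x y y = l := by
    rw [WeierstrassCurve.Affine.slope_of_Y_ne rfl hyn, hn, hl]
    simp only [legendreCurve, WeierstrassCurve.toAffine]
    congr 1 <;> ring
  have h4 : (4 : k) ≠ 0 := by
    have : (4 : k) = 2 * 2 := by norm_num
    rw [this]; exact mul_ne_zero h2 h2
  have hd : l ^ 2 + (1 + L) - x - x = dupX L x := by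
    obtain ⟨hx01, hxL⟩ := mul_ne_zero_iff.1 hg
    obtain ⟨hx0, hx1⟩ := mul_ne_zero_iff.1 hx01
    rw [dupX, hl, div_pow, mul_pow, hy2, show (2 : k) ^ 2 = 4 by norm_num]
    field_simp
    ring
  have hX : (legendreCurve L).toAffine.addX x x ((legendreCurve L).toAffine.slope x x y y) =
      dupX L x := by
    rw [hs, ← hd]; simp [WeierstrassCurve.Affine.addX, legendreCurve]; ring
  have hY : (legendreCurve L).toAffine.addY x x y
      ((legendreCurve L).toAffine.slope x x y y) = y * dupY L x := by
    rw [WeierstrassCurve.Affine.addY, WeierstrassCurve.Affine.negAddY, hX, hs, dupY, ← hy2]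
    simp only [WeierstrassCurve.Affine.negY, legendreCurve, hl]
    field_simp
    ring
  have hn := WeierstrassCurve.Affine.nonsingular_add n₁ n₁ (fun h => hyn h.2)
  refine ⟨by rw [hX, hY] at hn; exact hn, ?_⟩
  simp only [WeierstrassCurve.Affine.Point.some.injEq]
  exact ⟨hX, hY⟩

theorem IsPt.add_zero_zero (hL : IsLegendre L) {P T : LegendrePoint L} {x y : k} (h : IsPt P x y)
    (hT : IsPt T 0 0) (hx : x ≠ 0) : ∃ y', IsPt (P + T) (L / x) y' := by
  refine ⟨_, h.add hT hx rfl ?_⟩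
  have := h.eq hL
  field_simp
  simp only [sub_zero]
  linear_combination -x * this

theorem IsPt.add_one_zero (hL : IsLegendre L) {P T : LegendrePoint L} {x y : k} (h : IsPt P x y)
    (hT : IsPt T 1 0) (hx : x ≠ 1) : ∃ y', IsPt (P + T) ((x - L) / (x - 1)) y' := by
  refine ⟨_, h.add hT hx rfl ?_⟩
  have := h.eq hL
  have hx' := sub_ne_zero.2 hx
  field_simp
  simp only [sub_zero]
  linear_combination -this

theorem IsPt.add_param_zero (hL : IsLegendre L) {P T : LegendrePoint L} {x y : k} (h : IsPt P x y)
    (hT : IsPt T L 0) (hx : x ≠ L) : ∃ y', IsPt (P + T) (L * (x - 1) / (x - L)) y' := by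
  refine ⟨_, h.add hT hx rfl ?_⟩
  have := h.eq hL
  have hx' := sub_ne_zero.2 hx
  field_simp
  simp only [sub_zero]
  linear_combination -this

/-- The product is unchanged under `y₂ ↦ -y₂`, so only squares of the `y`-coordinates occur and the
curve equation removes them. The result is a recursion on `x`-coordinates alone. -/
theorem IsPt.add_mul_sub (hL : IsLegendre L) {P Q : LegendrePoint L} {x₁ y₁ x₂ y₂ : k}
    (h₁ : IsPt P x₁ y₁) (h₂ : IsPt Q x₂ y₂) (hx : x₁ ≠ x₂) :
    ∃ a b c d, IsPt (P + Q) a b ∧ IsPt (P - Q) c d ∧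
      a * c = (x₁ * x₂ - L) ^ 2 / (x₁ - x₂) ^ 2 := by
  have hm := h₁.add h₂.neg hx rfl rfl
  rw [← sub_eq_add_neg] at hm
  refine ⟨_, _, _, _, h₁.add h₂ hx rfl rfl, hm, ?_⟩
  have e1 := h₁.eq hL
  have e2 := h₂.eq hL
  have hx' := sub_ne_zero.2 hx
  have e : (((y₁ - y₂) / (x₁ - x₂)) ^ 2 + (1 + L) - x₁ - x₂) *
      (((y₁ - -y₂) / (x₁ - x₂)) ^ 2 + (1 + L) - x₁ - x₂) =
      ((y₁ ^ 2 + y₂ ^ 2) / (x₁ - x₂) ^ 2 + (1 + L) - x₁ - x₂) ^ 2 -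
        4 * y₁ ^ 2 * y₂ ^ 2 / (x₁ - x₂) ^ 4 := by
    field_simp
    ring
  rw [e, e1, e2]
  field_simp
  ring

end LegendrePoints

/-! ### Endomorphisms given by rational functions of `x`. -/

section RationalEndomorphisms

open Filter RatFunc

set_option linter.unusedSectionVars false

variable {k : Type*} [Field k] [DecidableEq k] {L : k}

/-- The endomorphism `f` is given by `(x, y) ↦ (u(x), y v(x))` at almost all points. -/
def IsRatEnd (f : AddMonoid.End (LegendrePoint L)) (u v : RatFunc k) : Prop :=
  ∀ᶠ x in cofinite, ∀ (y : k) (P : LegendrePoint L), IsPt P x y →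
    IsPt (f P) (u.ev x) (y * v.ev x)

variable [IsAlgClosed k]

theorem IsRatEnd.curve (hL : IsLegendre L) {f : AddMonoid.End (LegendrePoint L)} {u v : RatFunc k}
    (h : IsRatEnd f u v) :
    (RatFunc.X * (RatFunc.X - 1) * (RatFunc.X - C L)) * v ^ 2 = u * (u - 1) * (u - C L) := by
  apply toGerm_injective
  simp only [map_mul, map_sub, map_pow, map_one, toGerm_apply]
  refine coe_germ_eq (f := fun x => (RatFunc.X.ev x * (RatFunc.X.ev x - 1) *
    (RatFunc.X.ev x - (C L).ev x)) * v.ev x ^ 2)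
    (g := fun x => u.ev x * (u.ev x - 1) * (u.ev x - (C L).ev x)) ?_
  filter_upwards [h] with x hx
  obtain ⟨y, P, hP⟩ := exists_isPt_of_x hL x
  have h1 := (hx y P hP).eq hL
  have h2 := hP.eq hL
  simp only [ev_X, ev_C]
  rw [← h1, ← h2]; ring

/-- Points over almost all `x` have an affine image, so the kernel of `f` is finite. Were `u`
constant, `f` would agree up to sign on `P x` and a fixed `P x₀` for almost all `x`, so that one of
`P x ± P x₀` would be in the kernel; this gives infinitely many elements. -/
theorem IsRatEnd.nonconst (hL : IsLegendre L) {f : AddMonoid.End (LegendrePoint L)} {u v : RatFunc k}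
    (h : IsRatEnd f u v) : ¬ ∃ c, u = C c := by
  rintro ⟨c, rfl⟩
  choose y P hP using fun x : k => exists_isPt_of_x (L := L) hL x
  have hinf : {x : k | ∀ (y : k) (P : LegendrePoint L), IsPt P x y →
      IsPt (f P) ((C c).ev x) (y * v.ev x)}.Infinite := by
    intro hfin
    exact (Set.infinite_univ (α := k)) (by simpa using hfin.union (show Set.Finite _ from h))
  obtain ⟨x₀, hx₀⟩ := hinf.nonempty
  set s := {x : k | ¬ ∀ (y : k) (P : LegendrePoint L), IsPt P x y →
      IsPt (f P) ((C c).ev x) (y * v.ev x)} with hs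
  have hsf : s.Finite := h
  -- the points `P x ± P x₀` one of which is killed by `f`
  have hker : ∀ x ∉ s, ∃ Q : LegendrePoint L, (Q = P x - P x₀ ∨ Q = P x + P x₀) ∧ f Q = 0 := by
    intro x hx
    have hx' : ∀ (y : k) (P : LegendrePoint L), IsPt P x y →
      IsPt (f P) ((C c).ev x) (y * v.ev x) := not_not.1 hx
    have h1 := hx' _ _ (hP x)
    have h2 := hx₀ _ _ (hP x₀)
    rw [ev_C] at h1 h2
    rcases h1.eq_or_neg hL h2 with e | e
    · exact ⟨_, Or.inl rfl, by rw [map_sub, e, sub_self]⟩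
    · exact ⟨_, Or.inr rfl, by rw [map_add, e, neg_add_cancel]⟩
  -- the kernel is contained in a finite set
  have hkerf : {Q : LegendrePoint L | f Q = 0}.Finite := by
    have : {Q : LegendrePoint L | f Q = 0} ⊆
        {0} ∪ ⋃ x ∈ s, ({P x, -P x} : Set (LegendrePoint L)) := by
      intro Q hQ
      by_cases hQ0 : Q = 0
      · exact Or.inl hQ0
      · obtain ⟨x, z, hz⟩ := exists_isPt_of_ne_zero hQ0
        refine Or.inr ?_
        have hxs : x ∈ s := fun hx => (hx _ _ hz).ne_zero hQ
        simp only [Set.mem_iUnion]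
        exact ⟨x, hxs, by simpa using hz.eq_or_neg hL (hP x)⟩
    refine Set.Finite.subset ?_ this
    exact (Set.finite_singleton _).union (hsf.biUnion fun x _ => (Set.toFinite _))
  have hfin : (sᶜ : Set k).Finite := by
    choose! Q hQ using hker
    have hP_inj : Function.Injective P := fun a b hab => by
      have := hP a
      rw [hab] at this
      exact (this.unique (hP b)).1
    have : (sᶜ : Set k) ⊆ P ⁻¹' ((fun Q => Q + P x₀) '' {Q : LegendrePoint L | f Q = 0} ∪
        (fun Q => Q - P x₀) '' {Q : LegendrePoint L | f Q = 0}) := by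
      intro x hx
      rcases hQ x hx with ⟨e | e, h0⟩
      · exact Or.inl ⟨Q x, h0, by simp [e]⟩
      · exact Or.inr ⟨Q x, h0, by simp [e]⟩
    exact Set.Finite.subset (((hkerf.image _).union (hkerf.image _)).preimage
      hP_inj.injOn) this
  have := hfin.union hsf
  rw [Set.compl_union_self] at this
  exact Set.infinite_univ this

theorem IsRatEnd.neg_X (hL : IsLegendre L) {f : AddMonoid.End (LegendrePoint L)}
    {u v u' v' : RatFunc k} (h : IsRatEnd f u v) (h' : IsRatEnd (-f) u' v') : u = u' := by
  apply eq_of_eventually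
  filter_upwards [h, h'] with x hx hx'
  obtain ⟨y, P, hP⟩ := exists_isPt_of_x hL x
  exact ((hx y P hP).neg.unique (hx' y P hP)).1

theorem IsRatEnd.mul_X (hL : IsLegendre L) {f g : AddMonoid.End (LegendrePoint L)}
    {u v u' v' u'' v'' : RatFunc k} (h : IsRatEnd f u v) (h' : IsRatEnd g u' v')
    (h'' : IsRatEnd (f * g) u'' v'') :
    u'' = comp u' u := by
  refine (comp_ev ?_).symm
  filter_upwards [(tendsto_ev (h'.nonconst hL)).eventually h, h', h''] with x h1 h2 h3
  obtain ⟨y, P, hP⟩ := exists_isPt_of_x hL x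
  exact ((h1 _ _ (h2 y P hP)).unique (h3 y P hP)).1

theorem finite_two_torsion_x (L : k) : ({0, 1, L} : Set k).Finite := Set.toFinite _

theorem cubic_ne_zero {x : k} (hx : x ∉ ({0, 1, L} : Set k)) : x * (x - 1) * (x - L) ≠ 0 := by
  simp only [Set.mem_insert_iff, Set.mem_singleton_iff, not_or] at hx
  exact mul_ne_zero (mul_ne_zero hx.1 (sub_ne_zero.2 hx.2.1)) (sub_ne_zero.2 hx.2.2)

theorem eventually_notMem_two_torsion_x (L : k) :
    ∀ᶠ x in cofinite, x ∉ ({0, 1, L} : Set k) :=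
  (finite_two_torsion_x L).compl_mem_cofinite

theorem toGerm_dupX (u : RatFunc k) : toGerm k (dupX (C L) u) =
    ((fun x => dupX L (u.ev x) : k → k) : Germ _ k) := by
  have h4 : (4 : RatFunc k) = C 4 := (map_ofNat C 4).symm
  simp only [dupX, h4, map_div₀, map_mul, map_sub, map_pow, map_one, toGerm_apply, ev_C]
  rfl

theorem lim_dupX (hL : IsLegendre L) :
    Lim (dupX (C L) (RatFunc.X : RatFunc k) / RatFunc.X) (1 / 4) := by
  have h4 : (4 : k) ≠ 0 := by
    rw [show (4 : k) = 2 * 2 by norm_num]; exact mul_ne_zero hL.two hL.two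
  have hX : (RatFunc.X : RatFunc k) ≠ 0 := X_ne_zero
  have hX1 : (RatFunc.X : RatFunc k) - 1 ≠ 0 := by
    intro h
    exact nonconst_of_one_lt_infv (one_lt_infv_X (k := k)) ⟨1, by rw [map_one]; exact sub_eq_zero.1 h⟩
  have hXL : (RatFunc.X : RatFunc k) - C L ≠ 0 := by
    intro h
    exact nonconst_of_one_lt_infv one_lt_infv_X ⟨L, sub_eq_zero.1 h⟩
  have h4' : (4 : RatFunc k) = C 4 := (map_ofNat C 4).symm
  have hC4 : (C 4 : RatFunc k) ≠ 0 := by rw [_root_.map_ne_zero]; exact h4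
  have e : dupX (C L) (RatFunc.X : RatFunc k) / RatFunc.X =
      (C 1 - C L * (RatFunc.X)⁻¹ ^ 2) ^ 2 /
        (C 4 * ((C 1 - (RatFunc.X)⁻¹) * (C 1 - C L * (RatFunc.X)⁻¹))) := by
    have e1 : (C 1 - C L * (RatFunc.X)⁻¹ ^ 2 : RatFunc k) =
      (RatFunc.X ^ 2 - C L) / RatFunc.X ^ 2 := by rw [map_one]; field_simp
    have e2 : (C 1 - (RatFunc.X)⁻¹ : RatFunc k) =
      (RatFunc.X - 1) / RatFunc.X := by rw [map_one]; field_simp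
    have e3 : (C 1 - C L * (RatFunc.X)⁻¹ : RatFunc k) =
      (RatFunc.X - C L) / RatFunc.X := by rw [map_one]; field_simp
    rw [dupX, e1, e2, e3, h4']
    field_simp
  rw [e]
  have hi := lim_inv_X (k := k)
  have := (((lim_C 1).sub ((lim_C L).mul (hi.pow 2))).pow 2).div
    ((lim_C (4 : k)).mul (((lim_C 1).sub hi).mul ((lim_C 1).sub ((lim_C L).mul hi)))) (by simpa)
  simpa using this

theorem one_lt_infv_of_lim_div_X {f : RatFunc k} {c : k} (h : Lim (f / RatFunc.X) c) (hc : c ≠ 0) :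
    1 < infv k f := by
  have h1 := h.infv_eq_one hc
  have h2 : f = (f / RatFunc.X) * RatFunc.X := by
    field_simp [X_ne_zero (K := k)]
  rw [h2, map_mul, h1, one_mul]
  exact one_lt_infv_X

theorem one_lt_infv_dupX (hL : IsLegendre L) :
    1 < infv k (dupX (C L) (RatFunc.X : RatFunc k)) := by
  refine one_lt_infv_of_lim_div_X (lim_dupX hL) ?_
  rw [show (4 : k) = 2 * 2 by norm_num]
  exact one_div_ne_zero (mul_ne_zero hL.two hL.two)

/-- Endomorphisms commute with doubling; the identity is compared at points where neither the point
nor its image has order two. -/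
theorem IsRatEnd.dup (hL : IsLegendre L) {f : AddMonoid.End (LegendrePoint L)} {u v : RatFunc k}
    (h : IsRatEnd f u v) : comp (dupX (C L) RatFunc.X) u = dupX (C L) u := by
  have hd : ∀ᶠ x in (hyperfilter k : Filter k), (dupX (C L) RatFunc.X).ev x = dupX L x := by
    have := toGerm_dupX (L := L) (RatFunc.X : RatFunc k)
    rw [toGerm_apply] at this
    filter_upwards [Germ.coe_eq.1 this] with x hx
    rw [hx, ev_X]
  apply toGerm_injective
  rw [toGerm_comp, toGerm_dupX]
  refine Germ.coe_eq.2 ?_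
  filter_upwards [((tendsto_ev (nonconst_of_one_lt_infv (one_lt_infv_dupX hL))).eventually
    h).filter_mono hyperfilter_le_cofinite, h.filter_mono hyperfilter_le_cofinite, hd,
    (eventually_ev_notMem (h.nonconst hL) (finite_two_torsion_x L)).filter_mono
      hyperfilter_le_cofinite,
    (eventually_notMem_two_torsion_x L).filter_mono hyperfilter_le_cofinite] with x h1 h2 h3 h4 h5
  obtain ⟨y, P, hP⟩ := exists_isPt_of_x hL x
  have hy : y ≠ 0 := by
    rintro rfl
    exact cubic_ne_zero h5 (by rw [← hP.eq hL]; ring)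
  have hfP := h2 y P hP
  have hfy : y * v.ev x ≠ 0 := by
    intro h0
    rw [h0] at hfP
    exact cubic_ne_zero h4 (by rw [← hfP.eq hL]; ring)
  have e1 := hfP.double hL hfy
  rw [h3] at h1 ⊢
  have e2 := h1 _ _ (hP.double hL hy)
  rw [map_add] at e2
  exact (e2.unique e1).1

end RationalEndomorphisms

/-! ### Translations by points of order two, and maps of the `x`-line. -/

section KummerIsogenies

open Filter RatFunc

set_option linter.unusedSectionVars false

/-- The `x`-coordinate of `P + (0, 0)` on a Legendre curve. -/
def transZero {F : Type*} [Field F] (L x : F) : F := L / x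

/-- The `x`-coordinate of `P + (1, 0)` on a Legendre curve. -/
def transOne {F : Type*} [Field F] (L x : F) : F := (x - L) / (x - 1)

/-- The `x`-coordinate of `P + (L, 0)` on a Legendre curve. -/
def transParam {F : Type*} [Field F] (L x : F) : F := L * (x - 1) / (x - L)

variable {k : Type*} [Field k] [DecidableEq k] {L M : k} [IsAlgClosed k]

theorem toGerm_transZero (X : RatFunc k) : toGerm k (transZero (C L) X) =
    ((fun x => transZero L (X.ev x) : k → k) : Germ _ k) := by
  simp only [transZero, map_div₀, toGerm_apply, ev_C]
  rfl

theorem toGerm_transOne (X : RatFunc k) : toGerm k (transOne (C L) X) =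
    ((fun x => transOne L (X.ev x) : k → k) : Germ _ k) := by
  simp only [transOne, map_div₀, map_sub, map_one, toGerm_apply, ev_C]
  rfl

theorem toGerm_transParam (X : RatFunc k) : toGerm k (transParam (C L) X) =
    ((fun x => transParam L (X.ev x) : k → k) : Germ _ k) := by
  simp only [transParam, map_div₀, map_sub, map_mul, map_one, toGerm_apply, ev_C]
  rfl

theorem X_sub_C_ne_zero' (c : k) : (RatFunc.X : RatFunc k) - C c ≠ 0 := fun h =>
  nonconst_of_one_lt_infv one_lt_infv_X ⟨c, sub_eq_zero.1 h⟩

theorem lim_transZero {u : RatFunc k} (hu : Lim u⁻¹ 0) : Lim (transZero (C L) u) 0 := by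
  simpa [transZero, div_eq_mul_inv] using (lim_C L).mul hu

theorem lim_transOne {u : RatFunc k} (hu : Lim u⁻¹ 0) (hu0 : u ≠ 0) :
    Lim (transOne (C L) u) 1 := by
  have e : transOne (C L) u = (C 1 - C L * u⁻¹) / (C 1 - u⁻¹) := by
    have e2 : (C 1 - u⁻¹ : RatFunc k) = (u - 1) / u := by rw [map_one]; field_simp
    have e3 : (C 1 - C L * u⁻¹ : RatFunc k) = (u - C L) / u := by rw [map_one]; field_simp
    rw [transOne, e2, e3, div_div_div_cancel_right₀ hu0]
  rw [e]
  simpa using ((lim_C 1).sub ((lim_C L).mul hu)).div ((lim_C (1 : k)).sub hu) (by simp)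

theorem lim_transParam {u : RatFunc k} (hu : Lim u⁻¹ 0) (hu0 : u ≠ 0) :
    Lim (transParam (C L) u) L := by
  have e : transParam (C L) u = C L * (C 1 - u⁻¹) / (C 1 - C L * u⁻¹) := by
    have e2 : (C 1 - u⁻¹ : RatFunc k) = (u - 1) / u := by rw [map_one]; field_simp
    have e3 : (C 1 - C L * u⁻¹ : RatFunc k) = (u - C L) / u := by rw [map_one]; field_simp
    rw [transParam, e2, e3, ← mul_div_assoc, div_div_div_cancel_right₀ hu0]
  rw [e]
  simpa using ((lim_C L).mul ((lim_C (1 : k)).sub hu)).div ((lim_C 1).sub ((lim_C L).mul hu))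
    (by simp)

theorem transZero_nonconst (hL : IsLegendre L) : ¬ ∃ c, transZero (C L) (RatFunc.X : RatFunc k) = C c := by
  rintro ⟨c, hc⟩
  have h := lim_transZero (L := L) (lim_inv_X (k := k))
  rw [hc] at h
  obtain rfl := (lim_C c).unique h
  rw [transZero, map_zero, div_eq_zero_iff, map_eq_zero] at hc
  exact hc.elim hL.zero X_ne_zero

theorem transOne_nonconst (hL : IsLegendre L) : ¬ ∃ c, transOne (C L) (RatFunc.X : RatFunc k) = C c := by
  rintro ⟨c, hc⟩
  have h := lim_transOne (L := L) (lim_inv_X (k := k)) X_ne_zero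
  rw [hc] at h
  obtain rfl := (lim_C c).unique h
  have h1 := X_sub_C_ne_zero' (1 : k)
  rw [map_one] at h1
  rw [transOne, div_eq_iff h1, map_one, one_mul] at hc
  have : C L = (C 1 : RatFunc k) := by rw [map_one]; linear_combination -hc
  exact hL.one (C_injective this)

theorem transParam_nonconst (hL : IsLegendre L) :
    ¬ ∃ c, transParam (C L) (RatFunc.X : RatFunc k) = C c := by
  rintro ⟨c, hc⟩
  have h := lim_transParam (L := L) (lim_inv_X (k := k)) X_ne_zero
  rw [hc] at h
  obtain rfl := (lim_C c).unique h
  rw [transParam, div_eq_iff (X_sub_C_ne_zero' c)] at hc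
  have hc0 : (C c : RatFunc k) ≠ 0 := by rw [_root_.map_ne_zero]; exact hL.zero
  have := mul_left_cancel₀ hc0 hc
  have : C c = (C 1 : RatFunc k) := by rw [map_one]; linear_combination this
  exact hL.one (C_injective this)

/-- This is `f (P + T) = f P + T` read on `x`-coordinates. The function `t` describes translation by
`T`, and `e` is the coordinate at which its formula fails. -/
theorem IsRatEnd.comp_trans {f : AddMonoid.End (LegendrePoint L)} (hL : IsLegendre L)
    {u v z g : RatFunc k} (h : IsRatEnd f u v) {t : k → k} {e : k} {T : LegendrePoint L}
    (hT : f T = T)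
    (ht : ∀ {P : LegendrePoint L} {x y : k}, IsPt P x y → x ≠ e → ∃ y', IsPt (P + T) (t x) y')
    (hz : ¬ ∃ c, z = C c) (hzt : toGerm k z = ((fun x => t x : k → k) : Germ _ k))
    (hgt : toGerm k g = ((fun x => t (u.ev x) : k → k) : Germ _ k)) : comp z u = g := by
  apply toGerm_injective
  rw [toGerm_comp, hgt]
  rw [toGerm_apply] at hzt
  refine Germ.coe_eq.2 ?_
  filter_upwards [Germ.coe_eq.1 hzt, ((tendsto_ev hz).eventually h).filter_mono
    hyperfilter_le_cofinite, h.filter_mono hyperfilter_le_cofinite,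
    (eventually_ev_notMem (h.nonconst hL) (Set.finite_singleton e)).filter_mono
      hyperfilter_le_cofinite,
    ((Set.finite_singleton e).eventually_cofinite_notMem).filter_mono
      hyperfilter_le_cofinite] with x h1 h2 h3 h4 h5
  rw [h1] at h2 ⊢
  obtain ⟨y, P, hP⟩ := exists_isPt_of_x hL x
  obtain ⟨y', hPT⟩ := ht hP h5
  obtain ⟨y'', hfPT⟩ := ht (h3 y P hP) h4
  have h6 := h2 _ _ hPT
  rw [map_add, hT] at h6
  exact (h6.unique hfPT).1

/-- The function `u` on the line behaves like the `x`-coordinate of a homomorphism from the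
Legendre curve of parameter `L` to that of parameter `M`. -/
structure IsKummerMap (L M : k) (u : RatFunc k) : Prop where
  nonconst : ¬ ∃ c, u = C c
  curve : ∃ v, (RatFunc.X * (RatFunc.X - 1) * (RatFunc.X - C L)) * v ^ 2 = u * (u - 1) * (u - C M)
  dup : comp (dupX (C L) RatFunc.X) u = dupX (C M) u

/-- The function `u` on the line behaves like the `x`-coordinate of a homomorphism from the
Legendre curve of parameter `L` to that of parameter `M` which respects the labels of the points
of order two. -/
structure IsTorsionKummerMap (L M : k) (u : RatFunc k) : Prop extends IsKummerMap L M u where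
  zero : comp (transZero (C L) RatFunc.X) u = transZero (C M) u
  one : comp (transOne (C L) RatFunc.X) u = transOne (C M) u
  param : comp (transParam (C L) RatFunc.X) u = transParam (C M) u

theorem IsRatEnd.isKummerMap (hL : IsLegendre L) {f : AddMonoid.End (LegendrePoint L)}
    {u v : RatFunc k} (h : IsRatEnd f u v) : IsKummerMap L L u :=
  ⟨h.nonconst hL, ⟨v, h.curve hL⟩, h.dup hL⟩

theorem IsRatEnd.isTorsionKummerMap (hL : IsLegendre L) {f : AddMonoid.End (LegendrePoint L)}
    {u v : RatFunc k} (h : IsRatEnd f u v) (hf : ∀ T : LegendrePoint L, T + T = 0 → f T = T) :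
    IsTorsionKummerMap L L u := by
  have htor : ∀ {T : LegendrePoint L} {x : k}, IsPt T x 0 → f T = T := fun {T x} hT => by
    apply hf
    have := hT.neg
    rw [neg_zero] at this
    exact eq_neg_iff_add_eq_zero.1 (hT.ext this)
  obtain ⟨T₀, h₀⟩ := exists_isPt hL (x := 0) (y := 0) (by ring)
  obtain ⟨T₁, h₁⟩ := exists_isPt hL (x := 1) (y := 0) (by ring)
  obtain ⟨T₂, h₂⟩ := exists_isPt hL (x := L) (y := 0) (by ring)
  refine ⟨h.isKummerMap hL, ?_, ?_, ?_⟩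
  · exact h.comp_trans (t := transZero L) hL (htor h₀)
      (fun hP hx => hP.add_zero_zero hL h₀ hx)
      (transZero_nonconst hL)
      (by simpa only [ev_X] using toGerm_transZero (L := L) RatFunc.X)
      (toGerm_transZero u)
  · exact h.comp_trans (t := transOne L) hL (htor h₁)
      (fun hP hx => hP.add_one_zero hL h₁ hx)
      (transOne_nonconst hL)
      (by simpa only [ev_X] using toGerm_transOne (L := L) RatFunc.X)
      (toGerm_transOne u)
  · exact h.comp_trans (t := transParam L) hL (htor h₂)
      (fun hP hx => hP.add_param_zero hL h₂ hx)
      (transParam_nonconst hL)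
      (by simpa only [ev_X] using toGerm_transParam (L := L) RatFunc.X)
      (toGerm_transParam u)

end KummerIsogenies

/-! ### Kummer maps at infinity and at points of order two, and their Frobenius roots. -/

section KummerIsogenies

open Filter RatFunc

set_option linter.unusedSectionVars false

theorem map_dupX {F G : Type*} [Field F] [Field G] (φ : F →+* G) (L x : F) :
    φ (dupX L x) = dupX (φ L) (φ x) := by
  have : φ 4 = 4 := map_ofNat φ 4
  simp [dupX, this]

theorem map_transZero {F G : Type*} [Field F] [Field G] (φ : F →+* G) (L x : F) :
    φ (transZero L x) = transZero (φ L) (φ x) := by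
  simp [transZero]

theorem map_transOne {F G : Type*} [Field F] [Field G] (φ : F →+* G) (L x : F) :
    φ (transOne L x) = transOne (φ L) (φ x) := by
  simp [transOne]

theorem map_transParam {F G : Type*} [Field F] [Field G] (φ : F →+* G) (L x : F) :
    φ (transParam L x) = transParam (φ L) (φ x) := by
  simp [transParam]

variable {k : Type*} [Field k] [DecidableEq k] [IsAlgClosed k] {L M : k}

theorem sub_C_ne_zero {u : RatFunc k} (hu : ¬ ∃ c, u = C c) (c : k) : u - C c ≠ 0 := fun h =>
  hu ⟨c, sub_eq_zero.1 h⟩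

theorem ne_zero_of_nonconst {u : RatFunc k} (hu : ¬ ∃ c, u = C c) : u ≠ 0 := fun h =>
  hu ⟨0, by rw [h, map_zero]⟩

theorem sub_one_ne_zero_of_nonconst {u : RatFunc k} (hu : ¬ ∃ c, u = C c) : u - 1 ≠ 0 := by
  simpa using sub_C_ne_zero hu 1

theorem infv_X_sub_C (c : k) : infv k (RatFunc.X - C c) = infv k RatFunc.X := by
  rw [sub_eq_neg_add]
  apply Valuation.map_add_eq_of_lt_right
  rw [Valuation.map_neg]
  exact (infv_C_le c).trans_lt one_lt_infv_X

/-- The origin goes to the origin. Suppose `u` had a finite value `w` at infinity. If `w` is one of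
`0, 1, M`, the limit of the duplication identity gives `w² = M`, which is impossible. Otherwise the
right side of the curve identity has order zero at infinity while the left side, a cubic times a
square, has odd order. -/
theorem IsKummerMap.one_lt_infv (hL : IsLegendre L) (hM : IsLegendre M) {u : RatFunc k}
    (h : IsKummerMap L M u) : 1 < infv k u := by
  by_contra hcon
  obtain ⟨w, hw⟩ := exists_lim hcon
  have hnc := h.nonconst
  have hD : u * (u - 1) * (u - C M) ≠ 0 :=
    mul_ne_zero (mul_ne_zero (ne_zero_of_nonconst hnc) (sub_one_ne_zero_of_nonconst hnc))
      (sub_C_ne_zero hnc M)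
  have hlim : Lim (u * (u - 1) * (u - C M)) (w * (w - 1) * (w - M)) := by
    have := (hw.mul (hw.sub (lim_C 1))).mul (hw.sub (lim_C M))
    rwa [map_one] at this
  by_cases hw0 : w * (w - 1) * (w - M) = 0
  · have h4 : (4 : RatFunc k) = C 4 := (map_ofNat C 4).symm
    have h4' : (4 : k) ≠ 0 := by
      rw [show (4 : k) = 2 * 2 by norm_num]; exact mul_ne_zero hL.two hL.two
    have h4'' : (4 : RatFunc k) ≠ 0 := by rw [h4, _root_.map_ne_zero]; exact h4'
    have h1 := h.dup
    rw [dupX.eq_1 (C M), eq_div_iff (mul_ne_zero h4'' hD), h4] at h1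
    have h2 := (hw.comp (one_lt_infv_dupX hL)).mul ((lim_C (4 : k)).mul hlim)
    rw [h1, hw0, mul_zero, mul_zero] at h2
    have h3 := h2.unique (((hw.pow 2).sub (lim_C M)).pow 2)
    have h5 : w ^ 2 - M = 0 := by
      rw [eq_comm] at h3
      exact pow_eq_zero_iff (two_ne_zero) |>.1 h3
    rcases mul_eq_zero.1 hw0 with h6 | h6
    · rcases mul_eq_zero.1 h6 with h6 | h6
      · rw [h6] at h5
        exact hM.zero (by linear_combination -h5)
      · rw [sub_eq_zero.1 h6] at h5
        exact hM.one (by linear_combination -h5)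
    · rw [sub_eq_zero.1 h6] at h5
      exact mul_ne_zero hM.zero (sub_ne_zero.2 hM.one) (by linear_combination h5)
  · obtain ⟨v, hv⟩ := h.curve
    have hv0 : v ≠ 0 := by
      rintro rfl
      apply hD
      rw [← hv]; ring
    have h1 := hlim.infv_eq_one hw0
    have hX1 : infv k ((RatFunc.X : RatFunc k) - 1) = infv k (RatFunc.X : RatFunc k) := by
      simpa using infv_X_sub_C (1 : k)
    rw [← hv, map_mul, map_mul, map_mul, map_pow, hX1, infv_X_sub_C, infv_eq hv0,
      infv_eq X_ne_zero, intDegree_X, ← WithZero.exp_add, ← WithZero.exp_add,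
      ← WithZero.exp_nsmul, ← WithZero.exp_add, ← WithZero.exp_zero, WithZero.exp_inj] at h1
    simp only [nsmul_eq_mul, Nat.cast_ofNat] at h1
    omega

/-- Letting `x` tend to infinity in `u(z(x)) = g(x)` gives `u(a) = b`. Applied to the translations,
it evaluates `u` at the points of order two. -/
theorem num_eval_eq {u z g : RatFunc k} {a b : k} (hz : ¬ ∃ c, z = C c) (h : comp z u = g)
    (hza : Lim z a) (hgb : Lim g b) : u.num.eval a = b * u.denom.eval a := by
  have h0 := aeval_ne_zero hz u.denom_ne_zero
  rw [comp, div_eq_iff h0] at h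
  have h1 := hgb.mul (hza.aeval u.denom)
  rw [← h] at h1
  exact (hza.aeval u.num).unique h1

theorem IsTorsionKummerMap.num_eval_zero (hL : IsLegendre L) (hM : IsLegendre M) {u : RatFunc k}
    (h : IsTorsionKummerMap L M u) : u.num.eval 0 = 0 := by
  have := num_eval_eq (transZero_nonconst hL) h.zero (lim_transZero lim_inv_X)
    (lim_transZero (lim_inv_zero (h.one_lt_infv hL hM)))
  simpa using this

theorem IsTorsionKummerMap.num_eval_one (hL : IsLegendre L) (hM : IsLegendre M) {u : RatFunc k}
    (h : IsTorsionKummerMap L M u) : u.num.eval 1 = u.denom.eval 1 := by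
  have := num_eval_eq (transOne_nonconst hL) h.one (lim_transOne lim_inv_X X_ne_zero)
    (lim_transOne (lim_inv_zero (h.one_lt_infv hL hM)) (ne_zero_of_nonconst h.nonconst))
  simpa using this

theorem IsTorsionKummerMap.num_eval_param (hL : IsLegendre L) (hM : IsLegendre M) {u : RatFunc k}
    (h : IsTorsionKummerMap L M u) : u.num.eval L = M * u.denom.eval L :=
  num_eval_eq (transParam_nonconst hL) h.param (lim_transParam lim_inv_X X_ne_zero)
    (lim_transParam (lim_inv_zero (h.one_lt_infv hL hM)) (ne_zero_of_nonconst h.nonconst))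

theorem charP_ratFunc (p : ℕ) [CharP k p] : CharP (RatFunc k) p :=
  charP_of_injective_algebraMap (algebraMap k (RatFunc k)).injective p

/-- Frobenius is injective on rational functions, so each functional equation descends. Kummer maps
are defined by identities on the line for this purpose: the root goes to another curve, and no
homomorphism of points has to be constructed. -/
theorem IsTorsionKummerMap.root (p : ℕ) [hp : Fact p.Prime] [CharP k p] (hodd : p % 2 = 1)
    (hL : IsLegendre L) {u : RatFunc k} (h : IsTorsionKummerMap L (M ^ p) (u ^ p)) :
    IsTorsionKummerMap L M u := by
  have := charP_ratFunc (k := k) p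
  have hinj : ∀ a b : RatFunc k, a ^ p = b ^ p → a = b := fun a b hab => frobenius_inj _ p hab
  have hnc : ¬ ∃ c, u = C c := by
    rintro ⟨c, rfl⟩
    exact h.nonconst ⟨c ^ p, by rw [map_pow]⟩
  have hcomp : ∀ z : RatFunc k, (¬ ∃ c, z = C c) → comp z (u ^ p) = comp z u ^ p := by
    intro z hz
    rw [← compHom_apply z hz, map_pow, compHom_apply]
  have hd := map_dupX (frobenius (RatFunc k) p) (C M) u
  have h0 := map_transZero (frobenius (RatFunc k) p) (C M) u
  have h1 := map_transOne (frobenius (RatFunc k) p) (C M) u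
  have h2 := map_transParam (frobenius (RatFunc k) p) (C M) u
  simp only [frobenius_def, ← map_pow] at hd h0 h1 h2
  refine ⟨⟨hnc, ?_, hinj _ _ ?_⟩, hinj _ _ ?_, hinj _ _ ?_, hinj _ _ ?_⟩
  · obtain ⟨v, hv⟩ := h.curve
    set w := u * (u - 1) * (u - C M) with hw
    have hwp : u ^ p * (u ^ p - 1) * (u ^ p - C (M ^ p)) = w ^ p := by
      rw [hw, mul_pow, mul_pow, sub_pow_char, sub_pow_char, one_pow, map_pow]
    rw [hwp] at hv
    have hw0 : w ≠ 0 :=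
      mul_ne_zero (mul_ne_zero (ne_zero_of_nonconst hnc) (sub_one_ne_zero_of_nonconst hnc))
        (sub_C_ne_zero hnc M)
    -- For odd `p`, the power `w ^ p` is `w` times the square of `w ^ m`, which is absorbed into
    -- `v`.
    obtain ⟨m, rfl⟩ : ∃ m, p = 2 * m + 1 := ⟨p / 2, by omega⟩
    refine ⟨v / w ^ m, ?_⟩
    rw [div_pow, ← mul_div_assoc, hv, div_eq_iff (pow_ne_zero _ (pow_ne_zero _ hw0))]
    ring
  · rw [hd, ← h.dup, hcomp _ (nonconst_of_one_lt_infv (one_lt_infv_dupX hL))]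
  · rw [h0, ← h.zero, hcomp _ (transZero_nonconst hL)]
  · rw [h1, ← h.one, hcomp _ (transOne_nonconst hL)]
  · rw [h2, ← h.param, hcomp _ (transParam_nonconst hL)]

end KummerIsogenies

/-! ### Multiplication by `n` and the invariant differential. -/

section Multiplication

open Filter RatFunc

set_option linter.unusedSectionVars false

/-- The relation `D u = c * v` says that the map pulls `dx / y` back to `c * dx / y`; adding the
identity map raises `c` by one. Here `s` is the slope of the chord divided by `y`. -/
theorem der_add_generic {k F : Type*} [Field k] [Field F] [Algebra k F] (D : Derivation k F F)
    {x l u v c s : F} (hx : D x = 1) (hl : D l = 0)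
    (hc : x * (x - 1) * (x - l) * v ^ 2 = u * (u - 1) * (u - l)) (hu : D u = c * v)
    (hv : v ≠ 0) (hux : u ≠ x) (hs : s = (v - 1) / (u - x)) {u' : F}
    (hu' : u' = x * (x - 1) * (x - l) * s ^ 2 + (1 + l) - u - x) :
    D u' = (c + 1) * -(s * (u' - u) + v) := by
  have hw : u - x ≠ 0 := sub_ne_zero.2 hux
  have hsw : s * (u - x) = v - 1 := by rw [hs]; field_simp
  have hsv : v = 1 + s * (u - x) := by linear_combination -hsw
  have hDs : D s * (u - x) = D v - s * (c * v - 1) := by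
    have := congrArg D hsw
    simp only [Derivation.leibniz, map_sub, hu, hx, smul_eq_mul, Derivation.map_one_eq_zero] at this
    linear_combination this
  have hDv : 2 * (x * (x - 1) * (x - l)) * D v = c * (3 * u ^ 2 - 2 * (1 + l) * u + l) -
      (3 * x ^ 2 - 2 * (1 + l) * x + l) * v := by
    have := congrArg D hc
    simp only [Derivation.leibniz, Derivation.leibniz_pow, map_sub, hu, hx, hl, smul_eq_mul,
      Derivation.map_one_eq_zero, nsmul_eq_mul, Nat.cast_ofNat] at this
    apply mul_left_cancel₀ hv
    simp only [Nat.add_one_sub_one, pow_one] at this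
    linear_combination this
  -- The curve equation `hc` minus the cubic in `x`, divided by `u - x`.
  have hE : x * (x - 1) * (x - l) * (2 * s + s ^ 2 * (u - x)) = (3 * x ^ 2 - 2 * (1 + l) * x + l) +
      (3 * x - 1 - l) * (u - x) + (u - x) ^ 2 := by
    apply mul_left_cancel₀ hw
    rw [hsv] at hc
    linear_combination hc
  have hDu' : D u' = (3 * x ^ 2 - 2 * (1 + l) * x + l) * s ^ 2 +
      2 * (x * (x - 1) * (x - l)) * s * D s - c * v - 1 := by
    rw [hu']
    simp only [Derivation.leibniz, Derivation.leibniz_pow, map_sub, map_add, hu, hx, hl,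
      smul_eq_mul, Derivation.map_one_eq_zero, nsmul_eq_mul, Nat.cast_ofNat, Nat.add_one_sub_one,
      pow_one]
    ring
  apply mul_left_cancel₀ hw
  rw [hDu', hu']
  have e1 : (u - x) * (2 * (x * (x - 1) * (x - l)) * s * D s) =
      s * (c * (3 * u ^ 2 - 2 * (1 + l) * u + l) -
      (3 * x ^ 2 - 2 * (1 + l) * x + l) * v - 2 * (x * (x - 1) * (x - l)) * s * (c * v - 1)) := by
    linear_combination (2 * (x * (x - 1) * (x - l)) * s) * hDs + s * hDv
  rw [hsv] at e1 ⊢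
  linear_combination e1 - (c - 1) * s * hE

theorem der_dupX {k F : Type*} [Field k] [Field F] [Algebra k F] (D : Derivation k F F)
    {x l : F} (h2 : (2 : F) ≠ 0) (hx : D x = 1) (hl : D l = 0)
    (hg : x * (x - 1) * (x - l) ≠ 0) : D (dupX l x) = 2 * dupY l x := by
  have h4 : (4 : F) ≠ 0 := by
    rw [show (4 : F) = 2 * 2 by norm_num]; exact mul_ne_zero h2 h2
  have hD4 : D 4 = 0 := by exact_mod_cast D.map_natCast 4
  have h1 : dupX l x * (4 * (x * (x - 1) * (x - l))) = (x ^ 2 - l) ^ 2 := by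
    rw [dupX, div_mul_cancel₀ _ (mul_ne_zero h4 hg)]
  have h3 := congrArg D h1
  simp only [Derivation.leibniz, Derivation.leibniz_pow, map_sub, hx, hl, smul_eq_mul, hD4,
    Derivation.map_one_eq_zero, nsmul_eq_mul, Nat.cast_ofNat, Nat.add_one_sub_one, pow_one] at h3
  have h5 : dupY l x * (2 * (x * (x - 1) * (x - l))) =
      -((3 * x ^ 2 - 2 * (1 + l) * x + l) * (dupX l x - x) + 2 * (x * (x - 1) * (x - l))) := by
    rw [dupY]
    generalize dupX l x = q
    generalize x * (x - 1) * (x - l) = g at hg ⊢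
    field_simp
  apply mul_left_cancel₀ (mul_ne_zero h4 hg)
  linear_combination h3 - 4 * h5

variable {k : Type*} [Field k] [DecidableEq k] [IsAlgClosed k] {L : k}

theorem toGerm_dupY (u : RatFunc k) : toGerm k (dupY (C L) u) =
    ((fun x => dupY L (u.ev x) : k → k) : Germ _ k) := by
  have h4 : (4 : RatFunc k) = C 4 := (map_ofNat C 4).symm
  have h2 : (2 : RatFunc k) = C 2 := (map_ofNat C 2).symm
  have h3 : (3 : RatFunc k) = C 3 := (map_ofNat C 3).symm
  simp only [dupY, dupX, h4, h3, h2, map_div₀, map_mul, map_sub, map_add, map_neg, map_pow,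
    map_one, toGerm_apply, ev_C]
  rfl

theorem IsRatEnd.unique_Y (hL : IsLegendre L) {f : AddMonoid.End (LegendrePoint L)}
    {u v w : RatFunc k} (h : IsRatEnd f u v)
    {t : k → k} (ht : toGerm k w = ((fun x => t x : k → k) : Germ _ k))
    (h' : ∀ᶠ x in (hyperfilter k : Filter k), ∀ (y : k) (P : LegendrePoint L), y ≠ 0 → IsPt P x y →
      ∃ x', IsPt (f P) x' (y * t x)) : v = w := by
  apply toGerm_injective
  rw [ht, toGerm_apply]
  refine Germ.coe_eq.2 ?_
  filter_upwards [h', h.filter_mono hyperfilter_le_cofinite,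
    (eventually_notMem_two_torsion_x L).filter_mono hyperfilter_le_cofinite] with x h1 h2 h3
  obtain ⟨y, P, hP⟩ := exists_isPt_of_x hL x
  have hy : y ≠ 0 := by
    rintro rfl
    exact cubic_ne_zero h3 (by rw [← hP.eq hL]; ring)
  obtain ⟨x', hx'⟩ := h1 y P hy hP
  exact mul_left_cancel₀ hy ((h2 y P hP).unique hx').2

/-- The functions `U n` and `V n` describe multiplication by `n`. -/
structure IsMultiplication (L : k) (U V : ℕ → RatFunc k) : Prop where
  legendre : IsLegendre L
  rep : ∀ n : ℕ, n ≠ 0 → IsRatEnd (n : AddMonoid.End (LegendrePoint L)) (U n) (V n)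

namespace IsMultiplication

variable {U V : ℕ → RatFunc k} (h : IsMultiplication L U V)
include h

theorem nonconst {n : ℕ} (hn : n ≠ 0) : ¬ ∃ c, U n = C c := (h.rep n hn).nonconst h.legendre

theorem isKummerMap {n : ℕ} (hn : n ≠ 0) : IsKummerMap L L (U n) :=
  (h.rep n hn).isKummerMap h.legendre

theorem one_lt_infv {n : ℕ} (hn : n ≠ 0) : 1 < infv k (U n) :=
  (h.isKummerMap hn).one_lt_infv h.legendre h.legendre

theorem isTorsionKummerMap {n : ℕ} (hn : n % 2 = 1) : IsTorsionKummerMap L L (U n) := by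
  refine (h.rep n (by omega)).isTorsionKummerMap h.legendre fun T hT => ?_
  obtain ⟨m, rfl⟩ : ∃ m, n = 2 * m + 1 := ⟨n / 2, by omega⟩
  change (2 * m + 1) • T = T
  rw [add_smul, mul_comm, mul_smul, two_smul, hT, smul_zero, one_smul, zero_add]

theorem rep_apply {n : ℕ} (hn : n ≠ 0) : ∀ᶠ x in cofinite, ∀ (y : k) (P : LegendrePoint L),
    IsPt P x y → IsPt (n • P) ((U n).ev x) (y * (V n).ev x) := h.rep n hn

theorem smul_ne_zero {n : ℕ} (hn : n ≠ 0) : ∀ᶠ x in cofinite, ∀ (y : k) (P : LegendrePoint L),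
    IsPt P x y → n • P ≠ 0 := by
  filter_upwards [h.rep_apply hn] with x hx y P hP
  exact (hx y P hP).ne_zero

theorem U_one : U 1 = RatFunc.X := by
  apply eq_of_eventually
  filter_upwards [h.rep_apply one_ne_zero] with x hx
  obtain ⟨y, P, hP⟩ := exists_isPt_of_x h.legendre x
  have := hx y P hP
  rw [one_smul] at this
  rw [ev_X]
  exact (this.unique hP).1

theorem V_one : V 1 = 1 := by
  refine (h.rep 1 one_ne_zero).unique_Y h.legendre (t := fun _ => 1) (map_one _) ?_
  refine Eventually.of_forall fun x y P _ hP => ⟨x, ?_⟩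
  rw [mul_one, Nat.cast_one]
  exact hP

theorem U_two_mul {n : ℕ} (hn : n ≠ 0) : U (2 * n) = dupX (C L) (U n) := by
  apply toGerm_injective
  rw [toGerm_dupX, toGerm_apply]
  refine coe_germ_eq ?_
  filter_upwards [h.rep_apply hn, h.rep_apply (mul_ne_zero two_ne_zero hn),
    eventually_ev_notMem (h.nonconst hn) (finite_two_torsion_x L)] with x h1 h2 h3
  obtain ⟨y, P, hP⟩ := exists_isPt_of_x h.legendre x
  have h4 := h1 y P hP
  have hy : y * (V n).ev x ≠ 0 := fun h0 => by
    rw [h0] at h4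
    exact cubic_ne_zero h3 (by rw [← h4.eq h.legendre]; ring)
  have h5 := h2 y P hP
  rw [mul_smul, two_smul] at h5
  exact (h5.unique (h4.double h.legendre hy)).1

theorem V_two : V 2 = dupY (C L) RatFunc.X := by
  refine (h.rep 2 two_ne_zero).unique_Y h.legendre (t := fun x => dupY L x)
    ((toGerm_dupY _).trans (by simp only [ev_X])) ?_
  refine Eventually.of_forall fun x y P hy hP => ⟨dupX L x, ?_⟩
  have := hP.double h.legendre hy
  rw [← two_smul ℕ] at this
  exact this

/-- Equal `x`-coordinates mean `m • P = ± n • P`, so that the sum or the difference of `m` and `n`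
kills `P`, which fails generically. -/
theorem ev_ne {m n : ℕ} (hmn : m ≠ n) (hn : m + n ≠ 0) :
    ∀ᶠ x in cofinite, ∀ (y : k) (P : LegendrePoint L), IsPt P x y →
      ∀ a b b', IsPt (m • P) a b → ¬ IsPt (n • P) a b' := by
  wlog hlt : n < m generalizing m n
  · filter_upwards [this (m := n) (n := m) hmn.symm (by omega) (by omega)] with x hx y P hP a b b'
      h1 h2
    exact hx y P hP a b' b h2 h1
  filter_upwards [h.smul_ne_zero hn, h.smul_ne_zero (n := m - n) (by omega)] with x h1 h2 y P hP a b
    b' h3 h4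
  rcases h3.eq_or_neg h.legendre h4 with e | e
  · apply h2 y P hP
    obtain ⟨d, rfl⟩ := Nat.exists_eq_add_of_lt hlt
    have e1 : n + d + 1 - n = d + 1 := by omega
    rw [e1]
    rw [add_assoc, add_smul] at e
    exact left_eq_add.1 e.symm
  · apply h1 y P hP
    rw [add_smul, e, neg_add_cancel]

theorem U_succ_ne {n : ℕ} (hn : n ≠ 0) : U (n + 1) ≠ U n := by
  intro he
  have : ∀ᶠ x in (cofinite : Filter k), False := by
    filter_upwards [h.ev_ne (m := n + 1) (n := n) (by omega) (by omega),
      h.rep_apply hn, h.rep_apply n.succ_ne_zero] with x h1 h2 h3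
    obtain ⟨y, P, hP⟩ := exists_isPt_of_x h.legendre x
    have h4 := h3 y P hP
    rw [Nat.succ_eq_add_one, he] at h4
    exact h1 y P hP _ _ _ h4 (h2 y P hP)
  exact this.exists.elim fun _ h => h

theorem U_odd {n : ℕ} (hn : n ≠ 0) :
    U (2 * n + 1) * RatFunc.X = (U (n + 1) * U n - C L) ^ 2 / (U (n + 1) - U n) ^ 2 := by
  apply toGerm_injective
  simp only [map_mul, map_div₀, map_pow, map_sub, toGerm_apply, ev_C, ev_X]
  refine coe_germ_eq (f := fun x => (U (2 * n + 1)).ev x * x)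
    (g := fun x => ((U (n + 1)).ev x * (U n).ev x - L) ^ 2 / ((U (n + 1)).ev x - (U n).ev x) ^ 2) ?_
  filter_upwards [h.ev_ne (m := n + 1) (n := n) (by omega) (by omega),
    h.rep_apply hn, h.rep_apply n.succ_ne_zero, h.rep_apply (2 * n).succ_ne_zero] with x h1 h2 h3 h4
  obtain ⟨y, P, hP⟩ := exists_isPt_of_x h.legendre x
  have h5 := h3 y P hP
  have h6 := h2 y P hP
  have hne : (U (n + 1)).ev x ≠ (U n).ev x := fun he => by
    rw [Nat.succ_eq_add_one, he] at h5
    exact h1 y P hP _ _ _ h5 h6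
  obtain ⟨a, b, c, d, h7, h8, h9⟩ := h5.add_mul_sub h.legendre h6 hne
  have e1 : n.succ • P + n • P = (2 * n + 1) • P := by rw [← add_smul]; congr 1; omega
  have e2 : n.succ • P - n • P = P := by rw [Nat.succ_eq_add_one, add_smul, one_smul]; abel
  rw [e1] at h7
  rw [e2] at h8
  have h10 : a * x = a * c := congrArg (a * ·) (hP.unique h8).1
  rw [((h4 y P hP).unique h7).1, h10]
  exact h9

theorem der_U {n : ℕ} (hn : n ≠ 0) : der k (U n) = n * V n := by
  have h2 : (2 : RatFunc k) ≠ 0 := by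
    rw [show (2 : RatFunc k) = C 2 from (map_ofNat C 2).symm, _root_.map_ne_zero]
    exact h.legendre.two
  have hXnc : ¬ ∃ c, (RatFunc.X : RatFunc k) = C c := nonconst_of_one_lt_infv one_lt_infv_X
  have hg : (RatFunc.X : RatFunc k) * (RatFunc.X - 1) * (RatFunc.X - C L) ≠ 0 :=
    mul_ne_zero (mul_ne_zero X_ne_zero (sub_one_ne_zero_of_nonconst hXnc)) (sub_C_ne_zero hXnc L)
  induction n, Nat.one_le_iff_ne_zero.2 hn using Nat.le_induction with
  | base => rw [h.U_one, h.V_one, der_X]; simp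
  | succ n hn1 ih =>
    -- The chord formula degenerates when `P` is added to itself, so the passage from 1 to 2 uses
    -- duplication.
    by_cases hn2 : n = 1
    · subst hn2
      have := h.U_two_mul one_ne_zero
      rw [h.U_one] at this
      rw [one_add_one_eq_two]
      rw [mul_one] at this
      rw [this, h.V_two, der_dupX (der k) h2 der_X (der_C L) hg, Nat.cast_two]
    have hn0 : n ≠ 0 := by omega
    have hnc := h.nonconst hn0
    have hcur := (h.rep n hn0).curve h.legendre
    have hv : V n ≠ 0 := by
      intro h0
      rw [h0] at hcur
      refine mul_ne_zero (mul_ne_zero (ne_zero_of_nonconst hnc) (sub_one_ne_zero_of_nonconst hnc))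
        (sub_C_ne_zero hnc L) ?_
      rw [← hcur]; ring
    have hne : ∀ᶠ x in cofinite, ∀ (y : k) (P : LegendrePoint L), IsPt P x y →
        IsPt (n • P) ((U n).ev x) (y * (V n).ev x) ∧ (U n).ev x ≠ x := by
      filter_upwards [h.ev_ne (m := n) (n := 1) hn2 (by omega), h.rep_apply hn0] with x h1 h2 y P hP
      refine ⟨h2 y P hP, fun he => ?_⟩
      have h3 := h2 y P hP
      rw [he] at h3
      exact h1 y P hP _ _ _ h3 (by rw [one_smul]; exact hP)
    have hux : U n ≠ RatFunc.X := by
      intro he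
      have : ∀ᶠ x in (cofinite : Filter k), False := by
        filter_upwards [hne] with x h1
        obtain ⟨y, P, hP⟩ := exists_isPt_of_x h.legendre x
        exact (h1 y P hP).2 (by rw [he, ev_X])
      exact this.exists.elim fun _ h => h
    set s := (V n - 1) / (U n - RatFunc.X) with hs
    have hsum : ∀ᶠ x in cofinite, ∀ (y : k) (P : LegendrePoint L), IsPt P x y →
        IsPt ((n + 1) • P) (x * (x - 1) * (x - L) * (((V n).ev x - 1) / ((U n).ev x - x)) ^ 2 +
          (1 + L) - (U n).ev x - x) (y * -((((V n).ev x - 1) / ((U n).ev x - x)) *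
          ((x * (x - 1) * (x - L) * (((V n).ev x - 1) / ((U n).ev x - x)) ^ 2 +
          (1 + L) - (U n).ev x - x) - (U n).ev x) + (V n).ev x)) := by
      filter_upwards [hne] with x h1 y P hP
      obtain ⟨h3, h4⟩ := h1 y P hP
      have h5 := h3.add hP h4 rfl (x₃ := x * (x - 1) * (x - L) *
          (((V n).ev x - 1) / ((U n).ev x - x)) ^ 2 + (1 + L) - (U n).ev x - x) (by
            rw [← hP.eq h.legendre]; ring)
      rw [add_smul, one_smul]
      convert h5 using 1
      ring
    have hU : U (n + 1) = RatFunc.X * (RatFunc.X - 1) * (RatFunc.X - C L) * s ^ 2 + (1 + C L) -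
        U n - RatFunc.X := by
      apply toGerm_injective
      simp only [hs, map_mul, map_div₀, map_pow, map_sub, map_add, map_one, toGerm_apply, ev_C, ev_X]
      refine coe_germ_eq (f := fun x => (U (n + 1)).ev x)
        (g := fun x => x * (x - 1) * (x - L) * (((V n).ev x - 1) / ((U n).ev x - x)) ^ 2 +
          (1 + L) - (U n).ev x - x) ?_
      filter_upwards [hsum, h.rep_apply n.succ_ne_zero] with x h1 h2
      obtain ⟨y, P, hP⟩ := exists_isPt_of_x h.legendre x
      exact ((h2 y P hP).unique (h1 y P hP)).1
    have hV : V (n + 1) = -(s * (U (n + 1) - U n) + V n) := by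
      refine (h.rep (n + 1) n.succ_ne_zero).unique_Y h.legendre (t := fun x =>
        -((((V n).ev x - 1) / ((U n).ev x - x)) *
          ((x * (x - 1) * (x - L) * (((V n).ev x - 1) / ((U n).ev x - x)) ^ 2 +
          (1 + L) - (U n).ev x - x) - (U n).ev x) + (V n).ev x)) ?_ ?_
      · rw [hU]
        simp only [hs, map_mul, map_div₀, map_pow, map_sub, map_add, map_neg, map_one,
          toGerm_apply, ev_C, ev_X]
        rfl
      · refine (Eventually.filter_mono hyperfilter_le_cofinite hsum).mono fun x h1 y P _ hP => ?_
        exact ⟨_, h1 y P hP⟩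
    rw [hV, Nat.cast_add, Nat.cast_one]
    exact der_add_generic (der k) der_X (der_C L) hcur (ih hn0) hv hux hs hU

end IsMultiplication

end Multiplication

/-! ### Degree and leading behaviour of multiplication by `n`. -/

section Multiplication

open Filter RatFunc

set_option linter.unusedSectionVars false

variable {k : Type*} [Field k] [DecidableEq k] [IsAlgClosed k] {L : k}

theorem natDegree_num_dupX_le {u : RatFunc k} (hL : IsLegendre L) (hu : 1 < infv k u)
    (h0 : u ^ 2 ≠ C L) : (dupX (C L) u).num.natDegree ≤ 4 * u.num.natDegree := by
  set A := u.num with hA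
  set B := u.denom with hB
  have hBA : B.natDegree < A.natDegree := one_lt_infv_iff.1 hu
  have hnc := nonconst_of_one_lt_infv hu
  have hB' : algebraMap (Polynomial k) (RatFunc k) B ≠ 0 := u.algebraMap_denom_ne_zero
  have hAB := u.mul_denom
  rw [← hA, ← hB] at hAB
  have h4 : (4 : k) ≠ 0 := by
    rw [show (4 : k) = 2 * 2 by norm_num]; exact mul_ne_zero hL.two hL.two
  have h4' : (4 : RatFunc k) = C 4 := (map_ofNat C 4).symm
  have h4'' : (4 : RatFunc k) ≠ 0 := by rw [h4', _root_.map_ne_zero]; exact h4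
  have hD : u * (u - 1) * (u - C L) ≠ 0 :=
    mul_ne_zero (mul_ne_zero (ne_zero_of_nonconst hnc) (sub_one_ne_zero_of_nonconst hnc))
      (sub_C_ne_zero hnc L)
  set N := (A ^ 2 - Polynomial.C L * B ^ 2) ^ 2 with hN
  set E := Polynomial.C 4 * (A * B * (A - B) * (A - Polynomial.C L * B)) with hE
  have hNu : algebraMap (Polynomial k) (RatFunc k) N =
      (u ^ 2 - C L) ^ 2 * algebraMap _ _ B ^ 4 := by
    rw [hN]
    simp only [map_pow, map_sub, map_mul, algebraMap_C, ← hAB]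
    ring
  have hEu : algebraMap (Polynomial k) (RatFunc k) E =
      4 * (u * (u - 1) * (u - C L)) * algebraMap _ _ B ^ 4 := by
    rw [hE]
    simp only [map_sub, map_mul, algebraMap_C, ← hAB, h4']
    ring
  have hE0 : E ≠ 0 := by
    intro h
    rw [h, map_zero, eq_comm] at hEu
    exact mul_ne_zero (mul_ne_zero h4'' hD) (pow_ne_zero _ hB') hEu
  have hN0 : N ≠ 0 := by
    intro h
    rw [h, map_zero, eq_comm] at hNu
    exact mul_ne_zero (pow_ne_zero _ (sub_ne_zero.2 h0)) (pow_ne_zero _ hB') hNu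
  have hdiv : dupX (C L) u = algebraMap _ _ N / algebraMap _ _ E := by
    rw [hNu, hEu, dupX, mul_div_mul_right _ _ (pow_ne_zero _ hB')]
  refine (Polynomial.natDegree_le_of_dvd ((num_dvd hN0).2 ⟨E, hE0, hdiv⟩) hN0).trans ?_
  rw [hN]
  refine Polynomial.natDegree_pow_le.trans ?_
  have : (A ^ 2 - Polynomial.C L * B ^ 2).natDegree ≤ 2 * A.natDegree := by
    refine (Polynomial.natDegree_sub_le _ _).trans (max_le Polynomial.natDegree_pow_le ?_)
    refine (Polynomial.natDegree_C_mul_le _ _).trans (Polynomial.natDegree_pow_le.trans ?_)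
    omega
  omega

namespace IsMultiplication

variable {U V : ℕ → RatFunc k} (h : IsMultiplication L U V)
include h

/-- In the recursion `U_odd` the product of the numerator with `X` divides a square. The extra
factor `X` is coprime to the denominator because an odd multiple fixes `(0, 0)`. The resulting `+ 1`
gives exactly `(2n + 1)² = 2(n + 1)² + 2n² - 1`. -/
theorem natDegree_num_odd_le {n : ℕ} (hn : n ≠ 0) : (U (2 * n + 1)).num.natDegree + 1 ≤
    2 * (U (n + 1)).num.natDegree + 2 * (U n).num.natDegree := by
  have hodd := h.U_odd hn
  have hne := h.U_succ_ne hn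
  have hbA : (U (n + 1)).denom.natDegree < (U (n + 1)).num.natDegree :=
    one_lt_infv_iff.1 (h.one_lt_infv n.succ_ne_zero)
  have hdC : (U n).denom.natDegree < (U n).num.natDegree := one_lt_infv_iff.1 (h.one_lt_infv hn)
  have hw0 : (U (2 * n + 1)).num.eval 0 = 0 :=
    (h.isTorsionKummerMap (n := 2 * n + 1) (by omega)).num_eval_zero h.legendre h.legendre
  have hf0 : U (2 * n + 1) ≠ 0 := ne_zero_of_nonconst (h.nonconst (2 * n).succ_ne_zero)
  generalize U (2 * n + 1) = f at *
  generalize U (n + 1) = a at *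
  generalize U n = b at *
  have hA := a.mul_denom
  have hB := a.algebraMap_denom_ne_zero
  have hC := b.mul_denom
  have hD := b.algebraMap_denom_ne_zero
  have hF := f.mul_denom
  have hab : a - b ≠ 0 := sub_ne_zero.2 hne
  rw [eq_div_iff (pow_ne_zero 2 hab)] at hodd
  set N := a.num * b.num - Polynomial.C L * (a.denom * b.denom) with hN
  have hpoly : f.num * Polynomial.X * (a.num * b.denom - b.num * a.denom) ^ 2 =
      f.denom * N ^ 2 := by
    apply algebraMap_injective k
    simp only [hN, map_mul, map_pow, map_sub, algebraMap_C, algebraMap_X, ← hA, ← hC, ← hF]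
    linear_combination (algebraMap _ _ f.denom * algebraMap _ _ a.denom ^ 2 *
      algebraMap _ _ b.denom ^ 2) * hodd
  have hleft : f.num * Polynomial.X * (a.num * b.denom - b.num * a.denom) ^ 2 ≠ 0 := by
    refine mul_ne_zero (mul_ne_zero (num_ne_zero hf0) Polynomial.X_ne_zero) (pow_ne_zero _ ?_)
    intro h0
    apply hab
    have h1 := congrArg (algebraMap (Polynomial k) (RatFunc k)) h0
    rw [map_sub, map_mul, map_mul, ← hA, ← hC, map_zero] at h1
    refine mul_right_cancel₀ (mul_ne_zero hB hD) ?_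
    rw [zero_mul, ← h1]; ring
  have hcop : IsCoprime (f.num * Polynomial.X) f.denom := by
    refine IsCoprime.mul_left f.isCoprime_num_denom ?_
    rw [← sub_zero (Polynomial.X), ← Polynomial.C_0]
    refine (Polynomial.irreducible_X_sub_C (0 : k)).coprime_iff_not_dvd.2 ?_
    rw [Polynomial.dvd_iff_isRoot]
    intro hroot
    obtain ⟨s, t, hst⟩ := f.isCoprime_num_denom
    have := congrArg (Polynomial.eval 0) hst
    rw [Polynomial.eval_add, Polynomial.eval_mul, Polynomial.eval_mul, hw0, hroot.eq_zero] at this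
    simp at this
  have hdvd : f.num * Polynomial.X ∣ N ^ 2 := hcop.dvd_of_dvd_mul_left ⟨_, hpoly.symm⟩
  have hN0 : N ^ 2 ≠ 0 := by
    intro h0
    rw [hpoly, h0, mul_zero] at hleft
    exact hleft rfl
  have hdeg := Polynomial.natDegree_le_of_dvd hdvd hN0
  rw [Polynomial.natDegree_mul_X (num_ne_zero hf0)] at hdeg
  have hNd : N.natDegree ≤ a.num.natDegree + b.num.natDegree := by
    refine (Polynomial.natDegree_sub_le _ _).trans (max_le Polynomial.natDegree_mul_le ?_)
    refine (Polynomial.natDegree_C_mul_le _ _).trans (Polynomial.natDegree_mul_le.trans ?_)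
    omega
  have := Polynomial.natDegree_pow_le (p := N) (n := 2)
  omega

theorem natDegree_num_le (n : ℕ) (hn : n ≠ 0) : (U n).num.natDegree ≤ n ^ 2 := by
  induction n using Nat.strong_induction_on with
  | _ n ih =>
    obtain ⟨m, rfl | rfl⟩ : ∃ m, n = 2 * m ∨ n = 2 * m + 1 := ⟨n / 2, by omega⟩
    · have hm : m ≠ 0 := by omega
      rw [h.U_two_mul hm]
      have h0 : U m ^ 2 ≠ C L := by
        intro h0
        refine nonconst_of_one_lt_infv (z := U m ^ 2) ?_ ⟨L, h0⟩
        rw [map_pow]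
        exact one_lt_pow₀ (h.one_lt_infv hm) two_ne_zero
      have := natDegree_num_dupX_le h.legendre (h.one_lt_infv hm) h0
      have := ih m (by omega) hm
      nlinarith
    · by_cases hm : m = 0
      · subst hm
        rw [mul_zero, zero_add, h.U_one]
        simp
      · have h1 := h.natDegree_num_odd_le hm
        have h2 := ih (m + 1) (by omega) (by omega)
        have h3 := ih m (by omega) hm
        nlinarith

/-- By `U_odd` and `U 2 ~ X / 4`, the constant is `(1/4)² / (1/4 - 1)² = 1/9`. It later fixes the
leading constant of the isogeny `u`. -/
theorem lim_U_three (h3 : (3 : k) ≠ 0) : Lim (U 3 / RatFunc.X) (1 / 9) := by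
  have hodd := h.U_odd one_ne_zero
  have h2 := h.U_two_mul one_ne_zero
  rw [h.U_one] at hodd h2
  simp only [mul_one] at hodd h2
  have hX : (RatFunc.X : RatFunc k) ≠ 0 := X_ne_zero
  have hl := lim_dupX h.legendre
  rw [← h2] at hl
  have e : U 3 / RatFunc.X = ((U 2 / RatFunc.X) - C L * (RatFunc.X)⁻¹ ^ 2) ^ 2 /
      (U 2 / RatFunc.X - C 1) ^ 2 := by
    have e1 : U 2 / RatFunc.X - C L * (RatFunc.X)⁻¹ ^ 2 =
        (U 2 * RatFunc.X - C L) / RatFunc.X ^ 2 := by field_simp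
    have e2 : U 2 / RatFunc.X - C 1 = (U 2 - RatFunc.X) / RatFunc.X := by
      rw [map_one]; field_simp
    have hodd' : U 3 * RatFunc.X = (U 2 * RatFunc.X - C L) ^ 2 / (U 2 - RatFunc.X) ^ 2 := hodd
    have e3 : U 3 / RatFunc.X = (U 3 * RatFunc.X) / RatFunc.X ^ 2 := by field_simp
    rw [e3, hodd', e1, e2, div_pow, div_pow, div_div_div_eq, div_div]
    rw [div_eq_div_iff]
    · ring
    · have := sub_ne_zero.2 (h.U_succ_ne one_ne_zero)
      rw [h.U_one] at this
      exact mul_ne_zero (pow_ne_zero _ this) (pow_ne_zero _ hX)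
    · have := sub_ne_zero.2 (h.U_succ_ne one_ne_zero)
      rw [h.U_one] at this
      exact mul_ne_zero (pow_ne_zero _ (pow_ne_zero _ hX)) (pow_ne_zero _ this)
  have h4 : (4 : k) ≠ 0 := by
    rw [show (4 : k) = 2 * 2 by norm_num]; exact mul_ne_zero h.legendre.two h.legendre.two
  have h34 : (1 / 4 - 1 : k) = -3 / 4 := by field_simp; norm_num
  rw [e]
  have := ((hl.sub ((lim_C L).mul (lim_inv_X.pow 2))).pow 2).div ((hl.sub (lim_C 1)).pow 2)
    (by rw [h34]; exact pow_ne_zero _ (div_ne_zero (neg_ne_zero.2 h3) h4))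
  have e9 : ((1 / 4 - L * 0 ^ 2) ^ 2 / (1 / 4 - 1) ^ 2 : k) = 1 / 9 := by
    have h9 : (9 : k) ≠ 0 := by
      rw [show (9 : k) = 3 * 3 by norm_num]; exact mul_ne_zero h3 h3
    rw [h34]
    field_simp
    norm_num
  rwa [e9] at this

end IsMultiplication

end Multiplication

/-! ### Frobenius descent of the square root of `-3p`. -/

section Descent

open Filter RatFunc

set_option linter.unusedSectionVars false

variable {k : Type*} [Field k]

theorem RatFunc.der_comp {z : RatFunc k} (hz : ¬ ∃ c, z = C c) (f : RatFunc k) :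
    der k (comp z f) = comp z (der k f) * der k z := by
  have hd := aeval_ne_zero hz f.denom_ne_zero
  have h1 : compHom z hz f * Polynomial.aeval z f.denom = Polynomial.aeval z f.num := by
    rw [← compHom_algebraMap z hz, ← map_mul, mul_denom, compHom_algebraMap]
  have h2 := congrArg (der k) h1
  rw [Derivation.leibniz, der_aeval, der_aeval] at h2
  have h3 := congrArg (compHom z hz) (congrArg (der k) f.mul_denom)
  rw [Derivation.leibniz, der_algebraMap, der_algebraMap, smul_eq_mul, smul_eq_mul, map_add,
    map_mul, map_mul, compHom_algebraMap, compHom_algebraMap, compHom_algebraMap] at h3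
  rw [smul_eq_mul, smul_eq_mul] at h2
  rw [← compHom_apply z hz, ← compHom_apply z hz]
  apply mul_left_cancel₀ hd
  linear_combination h2 - der k z * h3

theorem RatFunc.aeval_pow_char (p : ℕ) [Fact p.Prime] [CharP k p] [PerfectRing k p] (z : RatFunc k)
    (q : Polynomial k) : Polynomial.aeval (z ^ p) q =
      Polynomial.aeval z (q.map ((frobeniusEquiv k p).symm : k →+* k)) ^ p := by
  rw [← map_pow, ← Polynomial.expand_aeval]
  congr 1
  exact polynomial_expand_eq ..

theorem RatFunc.exists_lim_div_pow {u : RatFunc k} (hu : 1 < infv k u) :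
    ∃ e : ℕ, e ≠ 0 ∧ u.num.natDegree = u.denom.natDegree + e ∧
      ∃ c, c ≠ 0 ∧ Lim (u / X ^ e) c := by
  have h1 := one_lt_infv_iff.1 hu
  have hu0 : u ≠ 0 := by rintro rfl; simp at hu
  obtain ⟨e, he⟩ := Nat.exists_eq_add_of_lt h1
  refine ⟨e + 1, e.succ_ne_zero, by omega, ?_⟩
  have hv : infv k (u / X ^ (e + 1)) = 1 := by
    rw [map_div₀, map_pow, infv_eq hu0, infv_eq X_ne_zero, intDegree_X, ← WithZero.exp_nsmul,
      ← WithZero.exp_sub, ← WithZero.exp_zero, intDegree, he]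
    congr 1
    push_cast
    simp
    ring
  obtain ⟨c, hc⟩ := exists_lim (f := u / X ^ (e + 1)) (by rw [hv]; exact lt_irrefl _)
  refine ⟨c, ?_, hc⟩
  rintro rfl
  rw [Lim, map_zero, sub_zero, hv] at hc
  exact lt_irrefl _ hc

variable [DecidableEq k] [IsAlgClosed k] {L : k} (p : ℕ) [hp : Fact p.Prime] [CharP k p]

/-- A function of degree one with a pole at infinity is affine. Its values at `0` and `1` make it
the identity, and then its value at `L` gives `M = L`. -/
theorem IsTorsionKummerMap.eq_X {L M : k} (hL : IsLegendre L) (hM : IsLegendre M) {z : RatFunc k}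
    (h : IsTorsionKummerMap L M z) (hd : z.num.natDegree ≤ 1) : z = RatFunc.X ∧ M = L := by
  have h1 := one_lt_infv_iff.1 (h.one_lt_infv hL hM)
  have hden : z.denom = 1 := z.monic_denom.natDegree_eq_zero.1 (by omega)
  have e0 := h.num_eval_zero hL hM
  have e1 := h.num_eval_one hL hM
  have e2 := h.num_eval_param hL hM
  have hnum := Polynomial.eq_X_add_C_of_natDegree_le_one hd
  rw [hnum] at e0 e1 e2
  rw [hden] at e1 e2
  simp only [Polynomial.eval_add, Polynomial.eval_mul, Polynomial.eval_C, Polynomial.eval_X,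
    mul_zero, zero_add, mul_one, Polynomial.eval_one] at e0 e1 e2
  rw [e0, add_zero] at e1 e2
  rw [e1, one_mul] at e2
  rw [e0, e1] at hnum
  refine ⟨?_, e2.symm⟩
  rw [← z.num_div_denom, hnum, hden]
  simp

namespace IsMultiplication

variable {U V : ℕ → RatFunc k} (h : IsMultiplication L U V)
include h

theorem V_ne_zero {n : ℕ} (hn : n ≠ 0) : V n ≠ 0 := by
  intro h0
  have hcur := (h.rep n hn).curve h.legendre
  have hnc := h.nonconst hn
  rw [h0] at hcur
  refine mul_ne_zero (mul_ne_zero (ne_zero_of_nonconst hnc) (sub_one_ne_zero_of_nonconst hnc))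
    (sub_C_ne_zero hnc L) ?_
  rw [← hcur]; ring

theorem U_mul {m n : ℕ} (hm : m ≠ 0) (hn : n ≠ 0) : U (m * n) = comp (U n) (U m) := by
  refine IsRatEnd.mul_X (v'' := V (m * n)) h.legendre (h.rep m hm) (h.rep n hn) ?_
  rw [← Nat.cast_mul]
  exact h.rep _ (mul_ne_zero hm hn)

theorem der_U_eq_zero {n : ℕ} (hn : n ≠ 0) (hpn : p ∣ n) : der k (U n) = 0 := by
  have := charP_ratFunc (k := k) p
  rw [h.der_U hn, (CharP.cast_eq_zero_iff (RatFunc k) p n).2 hpn, zero_mul]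

variable {a : RatFunc k} (ha : ¬ ∃ c, a = C c) (ha2 : comp a a = U (3 * p))
include ha ha2

/-- By the chain rule the derivative of `a ∘ a` is `a'(a) * a'`, and composition with a nonconstant
function is injective. -/
theorem der_eq_zero : der k a = 0 := by
  have h1 := h.der_U_eq_zero p (n := 3 * p) (mul_ne_zero three_ne_zero hp.1.ne_zero)
    (Dvd.intro_left _ rfl)
  rw [← ha2, der_comp ha, mul_eq_zero, ← compHom_apply a ha, map_eq_zero] at h1
  exact h1.elim id id

/-- Write `a = u ^ p` and `U p = z ^ p`. Taking `p`-th roots in `a(a) = U 3 (z ^ p)` gives `u(a) =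
U₃(z)`, where `U₃` is `U 3` with inverse Frobenius applied to its coefficients. The left side has
derivative zero and `U 3` is separable, so `z' = 0` and `z` is again a `p`-th power. -/
theorem exists_U_char_eq (h3 : (3 : k) ≠ 0) : ∃ z : RatFunc k, U p = (z ^ p) ^ p := by
  have hp0 := hp.1.ne_zero
  obtain ⟨u, rfl⟩ := exists_pow_of_der_eq_zero p (h.der_eq_zero p ha ha2)
  obtain ⟨z, hz⟩ := exists_pow_of_der_eq_zero p (h.der_U_eq_zero p hp0 dvd_rfl)
  have hznc : ¬ ∃ c, z = C c := by
    rintro ⟨c, rfl⟩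
    exact h.nonconst hp0 ⟨c ^ p, by rw [hz, map_pow]⟩
  have hzp : ¬ ∃ c, z ^ p = C c := hz ▸ h.nonconst hp0
  suffices hd : der k z = 0 by
    obtain ⟨y, rfl⟩ := exists_pow_of_der_eq_zero p hd
    exact ⟨y, hz⟩
  by_contra hdz
  set σ : k →+* k := ((frobeniusEquiv k p).symm : k →+* k)
  set w := comp (u ^ p) u with hw
  have hwd : der k w = 0 := by rw [hw, der_comp ha, der_pow_char, mul_zero]
  have hw3 : w ^ p = compHom (z ^ p) hzp (U 3) := by
    rw [compHom_apply, ← hz, ← h.U_mul three_ne_zero hp0, ← ha2, hw, ← compHom_apply _ ha, ← map_pow,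
      compHom_apply]
  have hn : w * Polynomial.aeval z ((U 3).denom.map σ) = Polynomial.aeval z ((U 3).num.map σ) := by
    have := charP_ratFunc (k := k) p
    apply frobenius_inj (RatFunc k) p
    rw [map_mul]
    simp only [frobenius_def]
    rw [← aeval_pow_char, ← aeval_pow_char, hw3, ← compHom_algebraMap _ hzp, ← map_mul, mul_denom,
      compHom_algebraMap]
  -- Differentiate the preceding identity and cancel the derivative of `z`, assumed nonzero; this
  -- leads to a vanishing derivative of `U 3`.
  have hn' : w * Polynomial.aeval z ((U 3).denom.derivative.map σ) =
      Polynomial.aeval z ((U 3).num.derivative.map σ) := by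
    have h1 := congrArg (der k) hn
    rw [Derivation.leibniz, der_aeval, der_aeval, hwd, smul_zero, add_zero, smul_eq_mul,
      ← mul_assoc] at h1
    rw [← Polynomial.derivative_map, ← Polynomial.derivative_map]
    exact mul_right_cancel₀ hdz h1
  have h4 : compHom (z ^ p) hzp (U 3 * algebraMap _ _ (U 3).denom.derivative) =
      compHom (z ^ p) hzp (algebraMap _ _ (U 3).num.derivative) := by
    rw [map_mul, ← hw3, compHom_algebraMap, compHom_algebraMap, aeval_pow_char, aeval_pow_char,
      ← mul_pow, hn']
  have h5 := (compHom (z ^ p) hzp).injective h4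
  have h6 := congrArg (der k) (U 3).mul_denom
  rw [Derivation.leibniz, der_algebraMap, der_algebraMap, smul_eq_mul, smul_eq_mul, h5,
    add_eq_left, mul_eq_zero] at h6
  have h7 := h6.resolve_left (U 3).algebraMap_denom_ne_zero
  rw [h.der_U three_ne_zero, mul_eq_zero] at h7
  refine h7.elim ?_ (h.V_ne_zero three_ne_zero)
  rw [Nat.cast_ofNat, show (3 : RatFunc k) = C 3 from (map_ofNat C 3).symm, map_eq_zero]
  exact h3

/-- The Frobenius descent of a torsion-preserving endomorphism whose square is `-3p`. -/
theorem exists_descent (h3 : (3 : k) ≠ 0) (hodd : p % 2 = 1) (hat : IsTorsionKummerMap L L a) :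
    ∃ (M c : k) (u : RatFunc k), M ^ p = L ∧ L ^ p = M ∧ IsLegendre M ∧ IsTorsionKummerMap L M u ∧
      u.num.natDegree ≤ 3 ∧ u.num.natDegree = u.denom.natDegree + 1 ∧ Lim (u / RatFunc.X) c ∧
      c ^ (p + p ^ 2) * 9 = 1 := by
  have hp0 := hp.1.ne_zero
  have hLroot : ∀ N : k, IsLegendre N → ∃ M, M ^ p = N ∧ IsLegendre M := by
    intro N hN
    refine ⟨(frobeniusEquiv k p).symm N, frobeniusEquiv_symm_pow_p .., hN.two, ?_, ?_⟩
    · intro h0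
      exact hN.zero (by simpa using h0)
    · intro h0
      exact hN.one (by simpa using h0)
  obtain ⟨M, hM, hMl⟩ := hLroot L h.legendre
  obtain ⟨M', hM', hMl'⟩ := hLroot M hMl
  -- multiplication by `p` is the square of Frobenius on the line
  obtain ⟨z, hz⟩ := h.exists_U_char_eq p ha ha2 h3
  have hpt := h.isTorsionKummerMap hodd
  have hzt : IsTorsionKummerMap L M' z := by
    apply IsTorsionKummerMap.root p hodd h.legendre
    apply IsTorsionKummerMap.root p hodd h.legendre
    rw [hM', hM, ← hz]
    exact hpt
  -- The degree of `U p` is `p²` times that of `z`, and is at most `p²`.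
  have hzd : z.num.natDegree ≤ 1 := by
    have h1 := h.natDegree_num_le p hp0
    rw [hz, natDegree_num_pow, natDegree_num_pow] at h1
    have h2 : 0 < p ^ 2 := by positivity
    by_contra! hcon
    nlinarith
  obtain ⟨rfl, rfl⟩ := hzt.eq_X h.legendre hMl' hzd
  -- the endomorphism itself
  obtain ⟨u, rfl⟩ := exists_pow_of_der_eq_zero p (h.der_eq_zero p ha ha2)
  have hut : IsTorsionKummerMap M' M u := by
    apply IsTorsionKummerMap.root p hodd h.legendre
    rw [hM]; exact hat
  have huv := hut.one_lt_infv h.legendre hMl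
  obtain ⟨e, he0, hed, c, hc0, hc⟩ := exists_lim_div_pow huv
  have hav : 1 < infv k (u ^ p) := by rw [map_pow]; exact one_lt_pow₀ huv hp0
  have hX : (RatFunc.X : RatFunc k) ≠ 0 := X_ne_zero
  have hu0 : u ≠ 0 := by rintro rfl; simp at huv
  have hXpv : 1 < infv k ((RatFunc.X : RatFunc k) ^ p ^ 2) := by
    rw [map_pow]; exact one_lt_pow₀ one_lt_infv_X (pow_ne_zero _ hp0)
  have hXpp : ((RatFunc.X : RatFunc k) ^ p) ^ p = RatFunc.X ^ p ^ 2 := by rw [← pow_mul, sq]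
  have hl1 : Lim (U (3 * p) / RatFunc.X ^ p ^ 2) (1 / 9) := by
    have h1 := (h.lim_U_three h3).comp hXpv
    rw [← compHom_apply _ (nonconst_of_one_lt_infv hXpv), map_div₀, compHom_X, compHom_apply] at h1
    rw [h.U_mul three_ne_zero hp0, hz, hXpp]
    exact h1
  -- From `u ~ c X ^ e` follows `u(u ^ p) ~ c (c X ^ e) ^ (p e)`; its `p`-th power is `U (3 * p)`.
  -- Comparison with `hl1` gives `e² = 1` and the value of `c ^ (p + p²)`.
  have hl2 : Lim (U (3 * p) / RatFunc.X ^ (p ^ 2 * e ^ 2)) (c ^ (p + p ^ 2 * e)) := by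
    have h1 := (hc.comp hav).mul (hc.pow (p * e))
    have h2 := h1.pow p
    rw [← compHom_apply _ ha, map_div₀, map_pow, compHom_X] at h2
    have e1 : (compHom (u ^ p) ha u / (u ^ p) ^ e * (u / RatFunc.X ^ e) ^ (p * e)) ^ p =
        U (3 * p) / RatFunc.X ^ (p ^ 2 * e ^ 2) := by
      rw [← ha2, ← compHom_apply _ ha, map_pow, div_pow u, ← pow_mul, div_mul_div_cancel₀
        (pow_ne_zero _ hu0), div_pow, ← pow_mul, ← pow_mul]
      congr 2
      ring
    have e2 : (c * c ^ (p * e)) ^ p = c ^ (p + p ^ 2 * e) := by ring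
    rwa [e1, e2] at h2
  have h9 : (9 : k) ≠ 0 := by
    rw [show (9 : k) = 3 * 3 by norm_num]; exact mul_ne_zero h3 h3
  have he1 : e = 1 := by
    have v1 := hl1.infv_eq_one (one_div_ne_zero h9)
    have v2 := hl2.infv_eq_one (pow_ne_zero _ hc0)
    have hvX : infv k (RatFunc.X : RatFunc k) ≠ 0 := (zero_lt_one.trans one_lt_infv_X).ne'
    rw [map_div₀, map_pow, div_eq_one_iff_eq (pow_ne_zero _ hvX)] at v1 v2
    rw [v1] at v2
    have v3 := (pow_right_injective₀ (zero_lt_one.trans one_lt_infv_X) one_lt_infv_X.ne') v2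
    have hpp : 0 < p ^ 2 := by positivity
    have v4 : e ^ 2 = 1 := by
      apply Nat.eq_of_mul_eq_mul_left hpp
      rw [← v3, mul_one]
    exact (Nat.pow_eq_one.1 v4).resolve_right two_ne_zero
  subst he1
  rw [pow_one] at hc
  rw [one_pow, mul_one] at hl2
  have hcp := hl2.unique hl1
  refine ⟨M, c, u, hM, hM', hMl, hut, ?_, hed, hc, ?_⟩
  -- Degrees multiply: `(p * deg u)²` is at most `(3p)²`.
  · have h1 := h.natDegree_num_le (3 * p) (mul_ne_zero three_ne_zero hp0)
    rw [← ha2, natDegree_num_comp hav hav, natDegree_num_pow] at h1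
    have hpp : 0 < p ^ 2 := by positivity
    by_contra! hcon
    nlinarith [Nat.mul_le_mul hcon hcon]
  · rw [hcp]; field_simp

end IsMultiplication

end Descent

/-! ### Isogenies of degree three respecting the points of order two. -/

section ThreeIsogenies

open Polynomial

set_option linter.unusedSectionVars false

theorem RatFunc.lim_div_X_pow {k : Type*} [Field k] (q : k[X]) :
    Lim (algebraMap k[X] (RatFunc k) q / X ^ q.natDegree) q.leadingCoeff := by
  have hX : (X : RatFunc k) ≠ 0 := X_ne_zero
  have h1 := (lim_inv_X (k := k)).aeval q.reverse
  have h2 : aeval (X : RatFunc k)⁻¹ q.reverse = algebraMap k[X] (RatFunc k) q / X ^ q.natDegree := by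
    let _ := invertibleOfNonzero hX
    have := eval₂_reverse_mul_pow (algebraMap k (RatFunc k)) (X : RatFunc k) q
    rw [invOf_eq_inv] at this
    rw [eq_div_iff (pow_ne_zero _ hX), aeval_def, this, ← aeval_def, ← algebraMap_X,
      aeval_algebraMap_apply, aeval_X_left_apply]
  rw [h2, ← coeff_zero_eq_eval_zero, coeff_zero_reverse] at h1
  exact h1

theorem RatFunc.leadingCoeff_num_eq {k : Type*} [Field k] {u : RatFunc k} {c : k}
    (hd : u.num.natDegree = u.denom.natDegree + 1) (hc : RatFunc.Lim (u / RatFunc.X) c) :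
    u.num.leadingCoeff = c := by
  have h1 := lim_div_X_pow u.num
  have h2 := hc.mul (lim_div_X_pow u.denom)
  have hX : (RatFunc.X : RatFunc k) ≠ 0 := X_ne_zero
  rw [u.monic_denom.leadingCoeff, mul_one] at h2
  refine h1.unique ?_
  convert h2 using 1
  rw [hd, ← u.mul_denom, pow_succ]
  field_simp

namespace Polynomial

theorem exists_eq_mul_of_monic_of_natDegree_eq_two {k : Type*} [Field k] [IsAlgClosed k] {q : k[X]}
    (hq : q.Monic) (hd : q.natDegree = 2) : ∃ a b, q = (X - C a) * (X - C b) := by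
  obtain ⟨a, ha⟩ := IsAlgClosed.exists_root q (by
    rw [degree_eq_natDegree hq.ne_zero, hd]; norm_num)
  obtain ⟨r, rfl⟩ := dvd_iff_isRoot.2 ha
  have hr : r.Monic := (monic_X_sub_C a).of_mul_monic_left hq
  rw [(monic_X_sub_C a).natDegree_mul hr, natDegree_X_sub_C] at hd
  refine ⟨a, -r.coeff 0, ?_⟩
  rw [C_neg, sub_neg_eq_add]
  congr 1
  exact hr.eq_X_add_C (by omega)

/-- The multiplicity of `r` is even on the left and odd on the right. -/
theorem false_of_simple_root {k : Type*} [Field k] {g s w P Q : k[X]} {r : k} (h : g * s ^ 2 = P * w ^ 2)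
    (hP : P = (X - C r) * Q) (hQ : Q.eval r ≠ 0) (hg : g.eval r ≠ 0) (hw : w ≠ 0) : False := by
  have hQ0 : Q ≠ 0 := by rintro rfl; simp at hQ
  have hg0 : g ≠ 0 := by rintro rfl; simp at hg
  have hX : (X - C r : k[X]) ≠ 0 := X_sub_C_ne_zero r
  have hP0 : P ≠ 0 := hP ▸ mul_ne_zero hX hQ0
  have hs : s ≠ 0 := by
    rintro rfl
    apply mul_ne_zero hP0 (pow_ne_zero 2 hw)
    rw [← h]; ring
  have h1 := congrArg (rootMultiplicity r) h
  rw [hP, sq, sq, rootMultiplicity_mul (mul_ne_zero hg0 (mul_ne_zero hs hs)),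
    rootMultiplicity_mul (mul_ne_zero hs hs),
    rootMultiplicity_mul (mul_ne_zero (mul_ne_zero hX hQ0) (mul_ne_zero hw hw)),
    rootMultiplicity_mul (mul_ne_zero hw hw), rootMultiplicity_mul (mul_ne_zero hX hQ0),
    rootMultiplicity_X_sub_C_self, rootMultiplicity_eq_zero hg, rootMultiplicity_eq_zero hQ] at h1
  omega

theorem quadratic_eq_zero {k : Type*} [Field k] {a b c : k} (h : C a * X ^ 2 + C b * X + C c = 0) :
    a = 0 ∧ b = 0 ∧ c = 0 := by
  have e2 := congrArg (fun q => coeff q 2) h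
  have e1 := congrArg (fun q => coeff q 1) h
  have e0 := congrArg (fun q => coeff q 0) h
  simp [coeff_X, coeff_C] at e2 e1 e0
  exact ⟨e2, e1, e0⟩

end Polynomial

variable {k : Type*} [Field k] [DecidableEq k] [IsAlgClosed k] {L M : k}

theorem IsKummerMap.exists_square {u : RatFunc k} (h : IsKummerMap L M u) : ∃ s w : k[X], w ≠ 0 ∧
    (X * (X - 1) * (X - C L)) * s ^ 2 =
      (u.num * u.denom * (u.num - u.denom) * (u.num - C M * u.denom)) * w ^ 2 := by
  obtain ⟨v, hv⟩ := h.curve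
  refine ⟨v.num * u.denom ^ 2, v.denom, v.denom_ne_zero, ?_⟩
  apply RatFunc.algebraMap_injective k
  simp only [map_mul, map_pow, map_sub, map_one, RatFunc.algebraMap_X, RatFunc.algebraMap_C,
    ← RatFunc.mul_denom]
  linear_combination ((algebraMap _ _ v.denom) ^ 2 * (algebraMap _ _ u.denom) ^ 4) * hv

/-- The shape of an isogeny of degree three that respects the labels of the points of order two. -/
theorem IsTorsionKummerMap.exists_param {u : RatFunc k} {c : k} (hL : IsLegendre L)
    (hM : IsLegendre M) (h : IsTorsionKummerMap L M u) (hd : u.num.natDegree ≤ 3)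
    (hd' : u.num.natDegree = u.denom.natDegree + 1) (hc : RatFunc.Lim (u / RatFunc.X) c) (hc1 : c ≠ 1) :
    ∃ n : k, n ^ 2 * c = 1 ∧ 16 * n * L = (3 - n) * (1 + n) ^ 3 ∧
      16 * n ^ 3 * M = (3 - n) ^ 3 * (1 + n) := by
  have hlc := RatFunc.leadingCoeff_num_eq hd' hc
  have e0 := h.num_eval_zero hL hM
  have e1 := h.num_eval_one hL hM
  have e2 := h.num_eval_param hL hM
  have hcop : ∀ x, u.denom.eval x = 0 → u.num.eval x ≠ 0 := fun x hx hx' => by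
    obtain ⟨a, b, hab⟩ := u.isCoprime_num_denom
    have := congrArg (eval x) hab
    rw [eval_add, eval_mul, eval_mul, hx, hx', mul_zero, mul_zero, eval_one, add_zero] at this
    exact zero_ne_one this
  have hB0 : u.denom.eval 0 ≠ 0 := fun h => hcop 0 h e0
  have hB1 : u.denom.eval 1 ≠ 0 := fun h => hcop 1 h (e1.trans h)
  have hBL : u.denom.eval L ≠ 0 := fun h => hcop L h (by rw [e2, h, mul_zero])
  have hz := h.zero
  obtain ⟨s, w, hw, hsq⟩ := h.toIsKummerMap.exists_square
  have hBm := u.monic_denom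
  have hu0 : u ≠ 0 := ne_zero_of_nonconst h.nonconst
  have hA0 : u.num ≠ 0 := RatFunc.num_ne_zero hu0
  have hznc := transZero_nonconst hL
  have hzd := RatFunc.aeval_ne_zero hznc u.denom_ne_zero
  rw [transZero] at hzd
  rw [RatFunc.comp, transZero, transZero, div_eq_div_iff hzd hu0] at hz
  have hz' : aeval (RatFunc.C L / RatFunc.X) u.num * algebraMap _ (RatFunc k) u.num =
      RatFunc.C M * (aeval (RatFunc.C L / RatFunc.X) u.denom * algebraMap _ (RatFunc k) u.denom) := by
    rw [← u.mul_denom]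
    linear_combination (algebraMap _ _ u.denom) * hz
  clear hz
  have hc0 : c ≠ 0 := hlc ▸ leadingCoeff_ne_zero.2 hA0
  -- Ramification: a point over `0, 1, M, ∞` other than `0, 1, L, ∞` cannot be a simple point of its
  -- fibre.
  have hsimple : ∀ (r : k) (Q : k[X]),
      u.num * u.denom * (u.num - u.denom) * (u.num - C M * u.denom) = (X - C r) * Q →
      r ≠ 0 → r ≠ 1 → r ≠ L → Q.eval r = 0 := by
    intro r Q hQ h0 h1 h2
    by_contra hne
    refine false_of_simple_root hsq hQ hne ?_ hw
    simp only [eval_mul, eval_sub, eval_X, eval_one, eval_C]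
    exact mul_ne_zero (mul_ne_zero h0 (sub_ne_zero.2 h1)) (sub_ne_zero.2 h2)
  clear hsq hw s w h hc hu0 hznc hzd
  generalize u.num = A at *
  generalize u.denom = B at *
  obtain ⟨A', rfl⟩ : X ∣ A := X_dvd_iff.2 (by rw [coeff_zero_eq_eval_zero, e0])
  have hA'0 : A' ≠ 0 := right_ne_zero_of_mul hA0
  rw [natDegree_X_mul hA'0] at hd hd'
  rw [leadingCoeff_mul, leadingCoeff_X, one_mul] at hlc
  have hrootB : ∀ r, B.eval r = 0 → r ≠ 0 ∧ r ≠ 1 ∧ r ≠ L := by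
    intro r hr
    refine ⟨?_, ?_, ?_⟩ <;> (rintro rfl; contradiction)
  -- Degree one gives `u = X`, against `c ≠ 1`; degree two would give a simple pole; in degree three
  -- the pole at `t` and the remaining zeros and ones of `u` are double.
  obtain h0 | h1 | h2 : A'.natDegree = 0 ∨ A'.natDegree = 1 ∨ A'.natDegree = 2 := by omega
  · exfalso
    have hB : B = 1 := hBm.natDegree_eq_zero.1 (by omega)
    rw [eq_C_of_natDegree_eq_zero h0, leadingCoeff_C] at hlc
    rw [eq_C_of_natDegree_eq_zero h0, hlc, hB] at e1
    apply hc1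
    simpa using e1
  · exfalso
    have hB := hBm.eq_X_add_C (by omega)
    set t := -B.coeff 0 with ht
    have hBt : B = X - C t := by rw [hB, ht]; simp
    have hB0 : B.eval t = 0 := by rw [hBt]; simp
    obtain ⟨t0, t1, t2⟩ := hrootB t hB0
    have h3 := hsimple t (X * A' * (X * A' - B) * (X * A' - C M * B))
      (by rw [hBt]; ring) t0 t1 t2
    simp only [eval_mul, eval_sub, eval_X, hB0, mul_zero, sub_zero] at h3
    have h4 := hcop t hB0
    rw [eval_mul, eval_X] at h4
    exact mul_ne_zero (mul_ne_zero h4 h4) h4 h3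
  obtain ⟨t, t', hB⟩ := exists_eq_mul_of_monic_of_natDegree_eq_two hBm (by omega)
  have hcA : c ≠ 0 := hc0
  have hA'm : (C c⁻¹ * A').Monic := by
    rw [Monic, leadingCoeff_mul, leadingCoeff_C, hlc, inv_mul_cancel₀ hc0]
  obtain ⟨a, a', hA⟩ := exists_eq_mul_of_monic_of_natDegree_eq_two hA'm
    (by rw [natDegree_C_mul (inv_ne_zero hc0), h2])
  have hA : A' = C c * ((X - C a) * (X - C a')) := by
    rw [← hA, ← mul_assoc, ← C_mul, mul_inv_cancel₀ hc0, C_1, one_mul]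
  have htt : t = t' := by
    by_contra hne
    have hBt : B.eval t = 0 := by rw [hB]; simp
    obtain ⟨t0, t1, t2⟩ := hrootB t hBt
    have h3 := hsimple t ((X - C t') * (X * A') * (X * A' - B) * (X * A' - C M * B))
      (by rw [hB]; ring) t0 t1 t2
    simp only [eval_mul, eval_sub, eval_X, hBt, mul_zero, sub_zero, eval_C] at h3
    have h4 := hcop t hBt
    rw [eval_mul, eval_X] at h4
    exact mul_ne_zero (mul_ne_zero (mul_ne_zero (sub_ne_zero.2 hne) h4) h4) h4 h3
  subst htt
  have haa : ∀ a a' : k, A' = C c * ((X - C a) * (X - C a')) → a ≠ 0 → a = a' := by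
    intro a a' hA ha0
    by_contra hne
    have hAa : A'.eval a = 0 := by rw [hA]; simp
    have hBa : B.eval a ≠ 0 := fun h => hcop a h (by simp [hAa])
    have h3 := hsimple a (X * (C c * (X - C a')) * B * (X * A' - B) * (X * A' - C M * B))
      (by rw [hA]; ring) ha0
      (by rintro rfl; apply hB1; rw [← e1]; simp [hAa])
      (by
        rintro rfl
        rw [eval_mul, hAa, mul_zero] at e2
        exact mul_ne_zero hM.zero hBL e2.symm)
    simp only [eval_mul, eval_sub, eval_X, hAa, mul_zero, zero_sub, eval_C] at h3
    exact mul_ne_zero (mul_ne_zero (mul_ne_zero (mul_ne_zero ha0 (mul_ne_zero hc0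
      (sub_ne_zero.2 hne))) hBa) (neg_ne_zero.2 hBa)) (neg_ne_zero.2 (mul_ne_zero hM.zero hBa)) h3
  have haa' : a = a' := by
    by_cases ha : a = 0
    · by_contra hne
      exact hne (haa a' a (by rw [hA]; ring) (fun h => hne (ha.trans h.symm))).symm
    · exact haa a a' hA ha
  subst haa'
  clear haa
  -- the fibre over `1`
  have hD1 : (X * A' - B).natDegree = 3 := by
    have h3 : (X * A').natDegree = 3 := by rw [natDegree_X_mul hA'0, h2]
    rw [natDegree_sub_eq_left_of_natDegree_lt (by omega), h3]
  have hDlc : (X * A' - B).leadingCoeff = c := by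
    rw [leadingCoeff_sub_of_degree_lt, leadingCoeff_mul, leadingCoeff_X, one_mul, hlc]
    apply degree_lt_degree
    rw [natDegree_X_mul hA'0]; omega
  obtain ⟨D, hD⟩ : (X - C 1) ∣ X * A' - B := dvd_iff_isRoot.2 (by
    rw [IsRoot, eval_sub, e1, sub_self])
  have hD0 : D ≠ 0 := by rintro rfl; rw [mul_zero] at hD; rw [hD] at hD1; simp at hD1
  rw [hD, (monic_X_sub_C 1).natDegree_mul' hD0, natDegree_X_sub_C] at hD1
  rw [hD, leadingCoeff_mul, leadingCoeff_X_sub_C, one_mul] at hDlc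
  have hDm : (C c⁻¹ * D).Monic := by
    rw [Monic, leadingCoeff_mul, leadingCoeff_C, hDlc, inv_mul_cancel₀ hc0]
  obtain ⟨b, b', hb⟩ := exists_eq_mul_of_monic_of_natDegree_eq_two hDm
    (by rw [natDegree_C_mul (inv_ne_zero hc0)]; omega)
  have hDb : D = C c * ((X - C b) * (X - C b')) := by
    rw [← hb, ← mul_assoc, ← C_mul, mul_inv_cancel₀ hc0, C_1, one_mul]
  have hbb : ∀ b b' : k, D = C c * ((X - C b) * (X - C b')) → b ≠ 1 → b = b' := by
    intro b b' hDb hb1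
    by_contra hne
    have hev : (X * A').eval b = B.eval b := by
      rw [← sub_eq_zero, ← eval_sub, hD, hDb]; simp
    have hBb : B.eval b ≠ 0 := fun h => hcop b h (hev.trans h)
    have h3 := hsimple b (X * A' * B * ((X - C 1) * (C c * (X - C b'))) * (X * A' - C M * B))
      (by rw [hD, hDb]; ring)
      (by rintro rfl; apply hBb; rw [← hev]; simp)
      hb1
      (by
        rintro rfl
        apply mul_ne_zero (sub_ne_zero.2 hM.one) hBb
        rw [sub_mul, ← e2, hev, one_mul, sub_self])
    simp only [eval_mul, eval_sub, eval_X, eval_C] at h3 hev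
    rw [hev] at h3
    refine mul_ne_zero (mul_ne_zero (mul_ne_zero hBb hBb) (mul_ne_zero (sub_ne_zero.2 hb1)
      (mul_ne_zero hc0 (sub_ne_zero.2 hne)))) ?_ h3
    intro h
    apply mul_ne_zero (sub_ne_zero.2 hM.one) hBb
    linear_combination -h
  have hbb' : b = b' := by
    by_cases hb1 : b = 1
    · by_contra hne
      exact hne (hbb b' b (by rw [hDb]; ring) (fun h => hne (hb1.trans h.symm))).symm
    · exact hbb b b' hDb hb1
  subst hbb'
  clear hbb hsimple
  -- comparison of coefficients
  rw [hDb, hA, hB] at hD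
  obtain ⟨f2, f1, f0⟩ : (-2 * a * c - 1 + c * (1 + 2 * b) = 0) ∧
      (c * a ^ 2 + 2 * t - c * (b ^ 2 + 2 * b) = 0) ∧ (c * b ^ 2 - t ^ 2 = 0) := by
    apply quadratic_eq_zero
    simp only [map_mul, map_add, map_sub, map_neg, map_pow, map_one, map_ofNat]
    rw [C_1] at hD
    linear_combination hD
  -- Compatibility with translation by `(0, 0)` reads `u(L / x) * u(x) = M`.
  have hfun : C (c ^ 2 * L) * (C L - C a * X) ^ 2 * (X - C a) ^ 2 =
      C M * (C L - C t * X) ^ 2 * (X - C t) ^ 2 := by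
    apply RatFunc.algebraMap_injective k
    have hX : (RatFunc.X : RatFunc k) ≠ 0 := RatFunc.X_ne_zero
    rw [hA, hB] at hz'
    simp only [map_mul, map_pow, map_sub, RatFunc.algebraMap_X, RatFunc.algebraMap_C, aeval_X,
      aeval_C, RatFunc.algebraMap_eq_C] at hz' ⊢
    field_simp at hz'
    linear_combination hz'
  have ht0 : t ≠ 0 := by
    rintro rfl
    apply hB0
    rw [hB]; simp
  have hta : t ≠ a := by
    rintro rfl
    exact hcop t (by rw [hB]; simp) (by rw [hA]; simp)
  have g1 := congrArg (eval t) hfun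
  have g2 := congrArg (eval 0) hfun
  simp only [eval_mul, eval_pow, eval_sub, eval_X, eval_C, sub_self, mul_zero, ne_eq,
    OfNat.ofNat_ne_zero, not_false_eq_true, zero_pow, sub_zero, zero_sub] at g1 g2
  have hLat : L = a * t := by
    simp only [mul_eq_zero, pow_eq_zero_iff, ne_eq, OfNat.ofNat_ne_zero, not_false_eq_true, hc0,
      hL.zero, false_or, sub_eq_zero, hta, or_false] at g1
    exact g1
  have hMat : c ^ 2 * L * a ^ 2 = M * t ^ 2 := by
    apply mul_left_cancel₀ (pow_ne_zero 2 hL.zero)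
    linear_combination g2
  have hb0 : b ≠ 0 := by
    rintro rfl
    apply pow_ne_zero 2 ht0
    linear_combination -f0
  have h2' := hL.two
  -- The parameter is the square root of `1 / c` supplied by `c * b² = t²`.
  refine ⟨b / t, ?_, ?_⟩
  · field_simp; linear_combination f0
  obtain ⟨n, hn⟩ : ∃ n, n = b / t := ⟨_, rfl⟩
  have hbn : b = n * t := by rw [hn]; field_simp
  have hcn : n ^ 2 * c = 1 := by rw [hn]; field_simp; linear_combination f0
  have hn0 : n ≠ 0 := by rintro rfl; simp at hcn
  have hn1 : n ≠ 1 := by rintro rfl; apply hc1; simpa using hcn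
  rw [← hn]
  have h4 : (4 : k) ≠ 0 := by
    rw [show (4 : k) = 2 * 2 by norm_num]; exact mul_ne_zero h2' h2'
  have k1 : 2 * a = 1 + 2 * n * t - n ^ 2 := by
    rw [hbn] at f2
    linear_combination -(n ^ 2) * f2 + (-2 * a + 1 + 2 * n * t) * hcn
  have k2 : (n - 1) ^ 2 * (4 * n * t) = (n - 1) ^ 2 * (1 + n) ^ 2 := by
    rw [hbn] at f1
    have k3 : a ^ 2 + 2 * t * n ^ 2 = n ^ 2 * t ^ 2 + 2 * n * t := by
      linear_combination n ^ 2 * f1 - (a ^ 2 - n ^ 2 * t ^ 2 - 2 * n * t) * hcn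
    linear_combination -4 * k3 + (2 * a + 1 + 2 * n * t - n ^ 2) * k1
  have k3 : 4 * n * t = (1 + n) ^ 2 :=
    mul_left_cancel₀ (pow_ne_zero 2 (sub_ne_zero.2 hn1)) k2
  have k4 : 4 * a = (3 - n) * (1 + n) := by linear_combination 2 * k1 + k3
  refine ⟨?_, ?_⟩
  · rw [hLat]; linear_combination (4 * n * t) * k4 + ((3 - n) * (1 + n)) * k3
  · have h1n : (1 + n) ≠ 0 := by
      intro h
      rw [h] at k3
      have : (4 * n * t) ≠ 0 := mul_ne_zero (mul_ne_zero h4 hn0) ht0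
      exact this (by rw [k3]; ring)
    have k5 : n ^ 4 * (c ^ 2 * (a * t) * a ^ 2) = a ^ 3 * t := by
      linear_combination (a ^ 3 * t) * (n ^ 2 * c + 1) * hcn
    rw [← hLat, hMat] at k5
    have k6 : n ^ 4 * M * t = a ^ 3 := by
      apply mul_right_cancel₀ ht0
      linear_combination k5
    apply mul_left_cancel₀ (pow_ne_zero 2 h1n)
    rw [← k3]
    apply mul_left_cancel₀ h4
    have k7 : (4 * a) ^ 3 = (3 - n) ^ 3 * (1 + n) ^ 3 := by rw [k4]; ring
    linear_combination 256 * k6 + 4 * k7 - 4 * (3 - n) ^ 3 * (1 + n) * k3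

end ThreeIsogenies

/-! ### The parameter `n` and the formula for `Λ`. -/

section Parameter

set_option linter.unusedSectionVars false

variable {k : Type*} [Field k] (p : ℕ) [hp : Fact p.Prime] [CharP k p]

/-- The two numbers conjugate under Frobenius which parametrize an isogeny of degree three
from a Legendre curve to its Frobenius conjugate. -/
theorem pow_mul_eq_neg_three {L M n : k} (h2 : (2 : k) ≠ 0) (h3 : (3 : k) ≠ 0)
    (hM : L ^ p = M) (hn1 : n ^ 2 ≠ 1) (hn : n ^ (2 * (p + p ^ 2)) = 9)
    (hL : 16 * n * L = (3 - n) * (1 + n) ^ 3)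
    (hM' : 16 * n ^ 3 * M = (3 - n) ^ 3 * (1 + n)) : n ^ p * n = -3 := by
  have hnum : ∀ m : ℕ, (m : k) ^ p = m := fun m => by
    rw [← frobenius_def, map_natCast]
  have hp3 : (3 : k) ^ p = 3 := by exact_mod_cast hnum 3
  have hp16 : (16 : k) ^ p = 16 := by exact_mod_cast hnum 16
  have hp18 : (18 : k) ^ p = 18 := by exact_mod_cast hnum 18
  have hp27 : (27 : k) ^ p = 27 := by exact_mod_cast hnum 27
  have hp9 : (9 : k) ^ p = 9 := by exact_mod_cast hnum 9
  have h8 : (24 : k) ≠ 0 := by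
    rw [show (24 : k) = 2 * (2 * (2 * 3)) by norm_num]
    exact mul_ne_zero h2 (mul_ne_zero h2 (mul_ne_zero h2 h3))
  have e1 : (n ^ p * n) ^ 2 = 9 := by
    apply frobenius_inj k p
    rw [frobenius_def, frobenius_def, hp9, ← hn]
    ring
  have e2 : (n ^ p * n - 3) * (n ^ p * n + 3) = 0 := by linear_combination e1
  rcases mul_eq_zero.1 e2 with e | e
  -- If `n ^ p * n = 3`, the Frobenius conjugate of `hL` compared with `hM'` gives a quartic for
  -- `n`. Conjugating it and substituting `n ^ p = 3 / n` gives a second quartic, and their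
  -- difference is `24 (n² - 1)`.
  · exfalso
    have e3 := congrArg (· ^ p) hL
    simp only [mul_pow, sub_pow_char, hp3, hp16, hM] at e3
    rw [← pow_mul (1 + n), mul_comm 3 p, pow_mul, add_pow_char, one_pow] at e3
    generalize hq : n ^ p = q at *
    have hqn : q * n = 3 := sub_eq_zero.1 e
    have e4 : n ^ 4 + 18 * n ^ 2 - 27 = 0 := by
      have h1 : 16 * (q * n) * n ^ 3 * M = (3 * n - q * n) * (n + q * n) ^ 3 := by
        linear_combination n ^ 4 * e3
      rw [hqn] at h1
      apply (mul_eq_zero.1 (?_ : (2 * 3 : k) * (n ^ 4 + 18 * n ^ 2 - 27) = 0)).resolve_left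
        (mul_ne_zero h2 h3)
      linear_combination 3 * hM' - h1
    have e5 : q ^ 4 + 18 * q ^ 2 - 27 = 0 := by
      have h1 := congrArg (frobenius k p) e4
      simp only [map_sub, map_add, map_mul, map_pow, map_zero, map_ofNat, frobenius_def, hq] at h1
      exact h1
    have e6 : n ^ 4 - 6 * n ^ 2 - 3 = 0 := by
      have h1 : (q * n) ^ 4 + 18 * (q * n) ^ 2 * n ^ 2 - 27 * n ^ 4 = 0 := by
        linear_combination n ^ 4 * e5
      rw [hqn] at h1
      apply (mul_eq_zero.1 (?_ : (3 ^ 3 : k) * (n ^ 4 - 6 * n ^ 2 - 3) = 0)).resolve_left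
        (pow_ne_zero _ h3)
      linear_combination -h1
    apply hn1
    apply sub_eq_zero.1
    apply (mul_eq_zero.1 (?_ : (24 : k) * (n ^ 2 - 1) = 0)).resolve_left h8
    linear_combination e4 - e6
  · exact eq_neg_of_add_eq_zero_left e

/-- With `q = n ^ p = -3 / n`, take `l = (n + q + 2) / 4` and the root `(n - q) / 4`. Then `l + (n -
q) / 4 = (1 + n) / 2` and `1 - l = (3 - n)(1 + n) / (4 n)`, which recovers `L`. -/
theorem exists_bigLambda_eq [Algebra (ZMod p) k] {L n : k} (hodd : p % 2 = 1) (h2 : (2 : k) ≠ 0)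
    (hn0 : n ≠ 0) (hn : n ^ p * n = -3) (hL : 16 * n * L = (3 - n) * (1 + n) ^ 3)
    (sq : ZMod p → k)
    (hsq : ∀ l : ZMod p, sq l ^ 2 = algebraMap (ZMod p) k (l ^ 2 - l + 1)) :
    ∃ l : ZMod p, ∃ ε : ℤˣ, L = bigLambda (algebraMap (ZMod p) k l) (((ε : ℤ) : k) * sq l) := by
  have hnum : ∀ m : ℕ, (m : k) ^ p = m := fun m => by
    rw [← frobenius_def, map_natCast]
  have hp3 : (3 : k) ^ p = 3 := by exact_mod_cast hnum 3
  have h4 : (4 : k) ≠ 0 := by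
    rw [show (4 : k) = 2 * 2 by norm_num]; exact mul_ne_zero h2 h2
  have h16 : (16 : k) ≠ 0 := by
    rw [show (16 : k) = 4 * 4 by norm_num]; exact mul_ne_zero h4 h4
  have hq : (n ^ p) ^ p = n := by
    have h1 := congrArg (· ^ p) hn
    simp only [mul_pow] at h1
    rw [Odd.neg_pow (Nat.odd_iff.2 hodd), hp3, ← hn] at h1
    apply mul_right_cancel₀ (pow_ne_zero p hn0)
    rw [h1, mul_comm]
  generalize hqd : n ^ p = q at *
  -- Frobenius exchanges `n` and `q`, so this symmetric expression is in the prime field.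
  have hfix : ((n + q + 2) / 4) ^ p = (n + q + 2) / 4 := by
    rw [← frobenius_def, map_div₀, map_add, map_add, map_ofNat, map_ofNat, frobenius_def,
      frobenius_def, hqd, hq]
    ring
  rw [← Subfield.mem_bot_iff_pow_eq_self k p, ← ZMod.fieldRange_castHom_eq_bot p] at hfix
  obtain ⟨l, hl⟩ := hfix
  have hl' : algebraMap (ZMod p) k l = (n + q + 2) / 4 := by
    rw [← hl]
    exact congrArg (fun f : ZMod p →+* k => f l) (Subsingleton.elim _ _)
  have hs : sq l ^ 2 = ((n - q) / 4) ^ 2 := by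
    rw [hsq, map_add, map_sub, map_pow, map_one, hl']
    field_simp
    linear_combination 4 * hn
  have key : ∀ s, s = (n - q) / 4 → L = bigLambda ((n + q + 2) / 4) s := by
    rintro s rfl
    rw [bigLambda]
    have e1 : (n + q + 2) / 4 + (n - q) / 4 = (1 + n) / 2 := by field_simp; ring
    have e2 : 1 - (n + q + 2) / 4 = (3 - n) * (1 + n) / (4 * n) := by
      field_simp; linear_combination -hn
    rw [e1, e2]
    field_simp
    linear_combination hL
  refine ⟨l, ?_⟩
  rw [hl']
  rcases sq_eq_sq_iff_eq_or_eq_neg.1 hs with h | h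
  · exact ⟨1, key _ (by rw [h]; simp)⟩
  · exact ⟨-1, key _ (by rw [h]; simp)⟩

end Parameter

/-! ### Changes of coordinates as isomorphisms of groups of points. -/

section Transport

open WeierstrassCurve

variable {k : Type*} [Field k] (W : WeierstrassCurve k) (C : VariableChange k)

namespace WeierstrassCurve.VariableChange

/-- The first coordinate on `W` of the point of `C • W` with first coordinate `x`. -/
def mapX (x : k) : k := (C.u : k) ^ 2 * x + C.r

/-- The second coordinate on `W` of a point of `C • W`. -/
def mapY (x y : k) : k := (C.u : k) ^ 3 * y + (C.u : k) ^ 2 * C.s * x + C.t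

theorem u_ne_zero : (C.u : k) ≠ 0 := C.u.ne_zero

theorem mapX_injective : Function.Injective C.mapX := fun _ _ h =>
  mul_left_cancel₀ (pow_ne_zero 2 C.u_ne_zero) (add_right_cancel h)

theorem mapY_injective (x : k) : Function.Injective (C.mapY x) := fun _ _ h =>
  mul_left_cancel₀ (pow_ne_zero 3 C.u_ne_zero) (add_right_cancel (add_right_cancel h))

theorem exists_map_eq (X Y₀ : k) : ∃ x y, C.mapX x = X ∧ C.mapY x y = Y₀ := by
  have := C.u_ne_zero
  refine ⟨(X - C.r) / (C.u : k) ^ 2,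
    (Y₀ - (C.u : k) ^ 2 * C.s * ((X - C.r) / (C.u : k) ^ 2) - C.t) / (C.u : k) ^ 3, ?_, ?_⟩
  · rw [mapX]; field_simp; ring
  · rw [mapY]; field_simp; ring

theorem equation_map_iff (x y : k) :
    W.toAffine.Equation (C.mapX x) (C.mapY x y) ↔ (C • W).toAffine.Equation x y := by
  have hu := C.u_ne_zero
  rw [Affine.equation_iff', Affine.equation_iff']
  simp only [variableChange_a₁, variableChange_a₂, variableChange_a₃, variableChange_a₄,
    variableChange_a₆, Units.val_inv_eq_inv_val, mapX, mapY]
  rw [← mul_right_inj' (pow_ne_zero 6 (inv_ne_zero hu)), mul_zero]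
  refine Eq.congr_left ?_
  field_simp
  ring

theorem negY_map (x y : k) : W.toAffine.negY (C.mapX x) (C.mapY x y) =
    C.mapY x ((C • W).toAffine.negY x y) := by
  have hu := C.u_ne_zero
  simp only [Affine.negY, variableChange_a₁, variableChange_a₃, Units.val_inv_eq_inv_val, mapX,
    mapY]
  field_simp
  ring

theorem addX_map (x₁ x₂ l : k) : W.toAffine.addX (C.mapX x₁) (C.mapX x₂) (C.u * l + C.s) =
    C.mapX ((C • W).toAffine.addX x₁ x₂ l) := by
  have hu := C.u_ne_zero
  simp only [Affine.addX, variableChange_a₁, variableChange_a₂, Units.val_inv_eq_inv_val, mapX]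
  field_simp
  ring

theorem addY_map (x₁ x₂ y₁ l : k) :
    W.toAffine.addY (C.mapX x₁) (C.mapX x₂) (C.mapY x₁ y₁) (C.u * l + C.s) =
      C.mapY ((C • W).toAffine.addX x₁ x₂ l) ((C • W).toAffine.addY x₁ x₂ y₁ l) := by
  rw [Affine.addY, Affine.negAddY, addX_map, Affine.addY, Affine.negAddY, ← negY_map]
  congr 1
  simp only [mapX, mapY]
  ring

variable [DecidableEq k]

theorem slope_map {x₁ x₂ y₁ y₂ : k} (h₁ : (C • W).toAffine.Equation x₁ y₁)
    (h₂ : (C • W).toAffine.Equation x₂ y₂) (h : ¬(x₁ = x₂ ∧ y₁ = (C • W).toAffine.negY x₂ y₂)) :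
    W.toAffine.slope (C.mapX x₁) (C.mapX x₂) (C.mapY x₁ y₁) (C.mapY x₂ y₂) =
      C.u * (C • W).toAffine.slope x₁ x₂ y₁ y₂ + C.s := by
  have hu := C.u_ne_zero
  by_cases hx : x₁ = x₂
  · subst hx
    have hy : y₁ ≠ (C • W).toAffine.negY x₁ y₂ := fun e => h ⟨rfl, e⟩
    obtain rfl := Affine.Y_eq_of_Y_ne h₁ h₂ rfl hy
    have hy' : C.mapY x₁ y₁ ≠ W.toAffine.negY (C.mapX x₁) (C.mapY x₁ y₁) := by
      rw [negY_map]
      exact fun e => hy (C.mapY_injective _ e)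
    rw [Affine.slope_of_Y_ne rfl hy, Affine.slope_of_Y_ne rfl hy']
    have e1 := sub_ne_zero.2 hy
    have e2 : C.mapY x₁ y₁ - W.toAffine.negY (C.mapX x₁) (C.mapY x₁ y₁) =
        (C.u : k) ^ 3 * (y₁ - (C • W).toAffine.negY x₁ y₁) := by
      rw [negY_map]
      simp only [mapY]
      ring
    rw [e2]
    generalize hd : y₁ - (C • W).toAffine.negY x₁ y₁ = d at *
    simp only [Affine.negY, variableChange_a₁, variableChange_a₃, Units.val_inv_eq_inv_val] at hd
    rw [div_eq_iff (mul_ne_zero (pow_ne_zero 3 hu) e1), add_mul, mul_assoc, mul_assoc,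
      ← mul_assoc (_ / d), mul_comm (_ / d), mul_assoc, div_mul_cancel₀ _ e1, ← hd]
    simp only [variableChange_a₁, variableChange_a₂, variableChange_a₄, Units.val_inv_eq_inv_val,
      mapX, mapY]
    field_simp
    ring
  · have hx' : C.mapX x₁ ≠ C.mapX x₂ := fun e => hx (C.mapX_injective e)
    rw [Affine.slope_of_X_ne hx, Affine.slope_of_X_ne hx']
    have e1 := sub_ne_zero.2 hx
    have e2 : C.mapX x₁ - C.mapX x₂ = (C.u : k) ^ 2 * (x₁ - x₂) := by simp only [mapX]; ring
    rw [e2]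
    simp only [mapY]
    field_simp
    ring

variable [W.IsElliptic]

omit [DecidableEq k] in
theorem nonsingular_map_iff (x y : k) :
    W.toAffine.Nonsingular (C.mapX x) (C.mapY x y) ↔ (C • W).toAffine.Nonsingular x y := by
  rw [← Affine.equation_iff_nonsingular, ← Affine.equation_iff_nonsingular, equation_map_iff]

/-- The map on points induced by a change of coordinates. -/
def pointMap : (C • W).toAffine.Point → W.toAffine.Point
  | .zero => .zero
  | .some x y h => .some (C.mapX x) (C.mapY x y) ((nonsingular_map_iff W C x y).2 h)

theorem pointMap_add (P Q : (C • W).toAffine.Point) :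
    pointMap W C (P + Q) = pointMap W C P + pointMap W C Q := by
  cases P with
  | zero => exact congrArg (pointMap W C) (zero_add Q) |>.trans (zero_add _).symm
  | some x₁ y₁ h₁ =>
    cases Q with
    | zero => exact congrArg (pointMap W C) (add_zero _) |>.trans (add_zero _).symm
    | some x₂ y₂ h₂ =>
      by_cases h : x₁ = x₂ ∧ y₁ = (C • W).toAffine.negY x₂ y₂
      · rw [Affine.Point.add_of_Y_eq h.1 h.2]
        refine (Affine.Point.add_of_Y_eq (congrArg C.mapX h.1) ?_).symm
        rw [negY_map, h.2, h.1]
      · have h' : ¬(C.mapX x₁ = C.mapX x₂ ∧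
            C.mapY x₁ y₁ = W.toAffine.negY (C.mapX x₂) (C.mapY x₂ y₂)) := by
          rintro ⟨e1, e2⟩
          have e1 := C.mapX_injective e1
          subst e1
          rw [negY_map] at e2
          exact h ⟨rfl, C.mapY_injective _ e2⟩
        rw [Affine.Point.add_some h]
        simp only [pointMap]
        rw [Affine.Point.add_some h']
        simp only [Affine.Point.some.injEq]
        rw [slope_map W C h₁.1 h₂.1 h, addX_map, addY_map]
        exact ⟨rfl, rfl⟩

omit [DecidableEq k] in
theorem pointMap_bijective : Function.Bijective (pointMap W C) := by
  constructor
  · rintro (_ | ⟨x, y, h⟩) (_ | ⟨x', y', h'⟩) e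
    · rfl
    · simp [pointMap] at e
    · simp [pointMap] at e
    · simp only [pointMap, Affine.Point.some.injEq] at e
      obtain rfl := C.mapX_injective e.1
      obtain rfl := C.mapY_injective _ e.2
      rfl
  · rintro (_ | ⟨x, y, h⟩)
    · exact ⟨.zero, rfl⟩
    · obtain ⟨x', y', rfl, rfl⟩ := C.exists_map_eq x y
      exact ⟨.some x' y' ((nonsingular_map_iff W C x' y').1 h), rfl⟩

/-- The isomorphism of groups of points induced by a change of coordinates. -/
noncomputable def pointEquiv : (C • W).toAffine.Point ≃+ W.toAffine.Point :=
  AddEquiv.ofBijective (AddMonoidHom.mk' (pointMap W C) (pointMap_add W C))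
    (pointMap_bijective W C)

end WeierstrassCurve.VariableChange

end Transport

/-! ### From rational functions on the curve to rational functions of `x`. -/

section RegularFunctions

open Polynomial Filter

variable {k : Type*} [Field k] {L : k}

/-- The function `F` of two variables agrees on the affine Legendre curve with `p(x) + q(x) y` for
two polynomials `p` and `q`. -/
def IsRegularOn (L : k) (F : k → k → k) : Prop :=
  ∃ p q : k[X], ∀ x y, y ^ 2 = x * (x - 1) * (x - L) → F x y = p.eval x + q.eval x * y

namespace IsRegularOn

theorem const (c : k) : IsRegularOn L fun _ _ => c := ⟨C c, 0, fun x y _ => by simp⟩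

theorem fst : IsRegularOn L fun x _ => x := ⟨X, 0, fun x y _ => by simp⟩

theorem snd : IsRegularOn L fun _ y => y := ⟨0, 1, fun x y _ => by simp⟩

theorem add {F G : k → k → k} (hF : IsRegularOn L F) (hG : IsRegularOn L G) :
    IsRegularOn L fun x y => F x y + G x y := by
  obtain ⟨p, q, h⟩ := hF
  obtain ⟨p', q', h'⟩ := hG
  refine ⟨p + p', q + q', fun x y hxy => ?_⟩
  simp only [h x y hxy, h' x y hxy, eval_add]
  ring

theorem mul {F G : k → k → k} (hF : IsRegularOn L F) (hG : IsRegularOn L G) :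
    IsRegularOn L fun x y => F x y * G x y := by
  obtain ⟨p, q, h⟩ := hF
  obtain ⟨p', q', h'⟩ := hG
  refine ⟨p * p' + q * q' * (X * (X - 1) * (X - C L)), p * q' + q * p', fun x y hxy => ?_⟩
  simp only [h x y hxy, h' x y hxy, eval_add, eval_mul, eval_sub, eval_X, eval_one, eval_C]
  linear_combination (q.eval x * q'.eval x) * hxy

theorem sub {F G : k → k → k} (hF : IsRegularOn L F) (hG : IsRegularOn L G) :
    IsRegularOn L fun x y => F x y - G x y := by
  have := hF.add ((const (-1)).mul hG)
  simpa [sub_eq_add_neg] using this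

theorem eval {F : k → k → k} (hF : IsRegularOn L F) (p : k[X]) :
    IsRegularOn L fun x y => p.eval (F x y) := by
  induction p using Polynomial.induction_on with
  | C a => simpa using const a
  | add p q hp hq => simpa using hp.add hq
  | monomial n a h =>
    have := h.mul hF
    simp only [eval_mul, eval_C, eval_pow, eval_X] at this ⊢
    simpa only [pow_succ, mul_assoc] using this

theorem evalEval {F G : k → k → k} (hF : IsRegularOn L F) (hG : IsRegularOn L G) (p : k[X][Y]) :
    IsRegularOn L fun x y => p.evalEval (F x y) (G x y) := by
  induction p using Polynomial.induction_on with
  | C a => simpa only [evalEval_C] using hF.eval a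
  | add p q hp hq => simpa using hp.add hq
  | monomial n a h =>
    have := h.mul hG
    simp only [evalEval_mul, evalEval_C, evalEval_pow, evalEval_X] at this ⊢
    simpa only [pow_succ, mul_assoc] using this

theorem conj {F : k → k → k} (hF : IsRegularOn L F) : IsRegularOn L fun x y => F x (-y) := by
  obtain ⟨p, q, h⟩ := hF
  refine ⟨p, -q, fun x y hxy => ?_⟩
  simp only [h x (-y) (by rw [neg_sq, hxy]), eval_neg]
  ring

end IsRegularOn

theorem RatFunc.ev_div {p q : k[X]} {x : k} (hq : q.eval x ≠ 0) :
    (algebraMap k[X] (RatFunc k) p / algebraMap _ _ q).ev x = p.eval x / q.eval x := by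
  have hq0 : q ≠ 0 := by rintro rfl; simp at hq
  set f := algebraMap k[X] (RatFunc k) p / algebraMap _ _ q with hf
  have h1 : f.num * q = p * f.denom := by
    apply RatFunc.algebraMap_injective k
    rw [map_mul, map_mul, ← RatFunc.mul_denom, hf]
    have := RatFunc.algebraMap_ne_zero hq0
    field_simp
  have h2 := congrArg (Polynomial.eval x) h1
  rw [Polynomial.eval_mul, Polynomial.eval_mul] at h2
  have h3 : f.denom.eval x ≠ 0 := by
    intro h
    rw [h, mul_zero] at h2
    have h4 := (mul_eq_zero.1 h2).resolve_right hq
    obtain ⟨a, b, hab⟩ := f.isCoprime_num_denom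
    have := congrArg (Polynomial.eval x) hab
    rw [Polynomial.eval_add, Polynomial.eval_mul, Polynomial.eval_mul, h, h4, mul_zero, mul_zero, Polynomial.eval_one, add_zero] at this
    exact zero_ne_one this
  rw [RatFunc.ev, RatFunc.eval, eval₂_id, eval₂_id, div_eq_div_iff h3 hq, h2]

variable [DecidableEq k] [IsAlgClosed k]

/-- An endomorphism given at almost all points by quotients of regular functions. -/
theorem IsRegularOn.exists_isRatEnd (hL : IsLegendre L) {f : AddMonoid.End (LegendrePoint L)}
    {A B D : k → k → k} (hA : IsRegularOn L A) (hB : IsRegularOn L B) (hD : IsRegularOn L D)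
    (h : ∀ᶠ x in cofinite, ∀ (y : k) (P : LegendrePoint L), IsPt P x y →
      D x y ≠ 0 ∧ IsPt (f P) (A x y / D x y) (B x y / D x y)) :
    ∃ u v, IsRatEnd f u v := by
  -- Multiplication by the conjugate of `D` makes the denominator its norm `N`, a function of `x`
  -- alone.
  obtain ⟨a₀, a₁, ha⟩ := hA.mul hD.conj
  obtain ⟨b₀, b₁, hb⟩ := hB.mul hD.conj
  obtain ⟨N, hN⟩ : ∃ N : k[X], ∀ x y, y ^ 2 = x * (x - 1) * (x - L) →
      D x y * D x (-y) = N.eval x := by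
    obtain ⟨p, q, h⟩ := hD
    refine ⟨p ^ 2 - X * (X - 1) * (X - C L) * q ^ 2, fun x y hxy => ?_⟩
    rw [h x y hxy, h x (-y) (by rw [neg_sq, hxy])]
    simp only [eval_sub, eval_mul, eval_pow, eval_X, eval_one, eval_C]
    linear_combination -(q.eval x) ^ 2 * hxy
  refine ⟨algebraMap _ _ a₀ / algebraMap _ _ N, algebraMap _ _ b₁ / algebraMap _ _ N, ?_⟩
  filter_upwards [h, eventually_notMem_two_torsion_x L] with x hx hx2 y P hP
  have hxy := hP.eq hL
  have hxy' := hP.neg.eq hL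
  have hy : y ≠ 0 := by
    rintro rfl
    apply cubic_ne_zero hx2
    rw [← hxy]; ring
  obtain ⟨hD1, h1⟩ := hx y P hP
  obtain ⟨hD2, h2⟩ := hx (-y) (-P) hP.neg
  have hNx : N.eval x ≠ 0 := by rw [← hN x y hxy]; exact mul_ne_zero hD1 hD2
  -- Since `f (-P) = -f P`, the first coordinate is even in `y` and the second odd; `a₁` and `b₀`
  -- therefore vanish at `x`.
  rw [map_neg] at h2
  obtain ⟨e1, e2⟩ := h1.neg.unique h2
  have ha1 := ha x y hxy
  have ha2 := ha x (-y) hxy'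
  have hb1 := hb x y hxy
  have hb2 := hb x (-y) hxy'
  simp only [neg_neg] at ha1 ha2 hb1 hb2
  have hN1 := hN x y hxy
  rw [div_eq_div_iff hD1 hD2] at e1
  rw [← neg_div, div_eq_div_iff hD1 hD2] at e2
  have h2y : 2 * y ≠ 0 := mul_ne_zero hL.two hy
  have ha1y : a₁.eval x = 0 := by
    apply (mul_eq_zero.1 (?_ : a₁.eval x * (2 * y) = 0)).resolve_right h2y
    linear_combination e1 - ha1 + ha2
  have hb0 : b₀.eval x = 0 := by
    apply (mul_eq_zero.1 (?_ : b₀.eval x * 2 = 0)).resolve_right hL.two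
    linear_combination -e2 - hb1 - hb2
  rw [ha1y, zero_mul, add_zero] at ha1
  rw [hb0, zero_add] at hb1
  rw [RatFunc.ev_div hNx, RatFunc.ev_div hNx, ← mul_div_assoc, mul_comm y, ← hb1, ← ha1, ← hN1,
    mul_div_mul_right _ _ hD2, mul_div_mul_right _ _ hD2]
  exact h1

omit [IsAlgClosed k] in
theorem finite_setOf_isPt_mem {S : Set (LegendrePoint L)} (hS : S.Finite) :
    {x | ∃ y P, IsPt P x y ∧ P ∈ S}.Finite := by
  classical
  refine (hS.image fun P => if h : ∃ x y, IsPt P x y then h.choose else 0).subset ?_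
  rintro x ⟨y, P, hP, hPS⟩
  refine ⟨P, hPS, ?_⟩
  have h : ∃ x y, IsPt P x y := ⟨x, y, hP⟩
  simp only [dif_pos h]
  obtain ⟨y', h'⟩ := h.choose_spec
  exact (h'.unique hP).1

/-- A nonzero endomorphism of an elliptic curve, transported to a Legendre model. -/
theorem IsCurveEndomorphism.exists_isRatEnd (hL : IsLegendre L) {E : WeierstrassCurve k}
    {c : WeierstrassCurve.VariableChange k}
    {f : AddMonoid.End E.toAffine.Point} (hf : IsCurveEndomorphism E f) (hf0 : f ≠ 0)
    (θ : LegendrePoint L ≃+ E.toAffine.Point)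
    (hθ : ∀ x y h, ∃ h', θ (.some x y h) = .some (c.mapX x) (c.mapY x y) h')
    {g : AddMonoid.End (LegendrePoint L)} (hg : ∀ P, θ (g P) = f (θ P)) :
    ∃ u v, IsRatEnd g u v := by
  obtain ⟨u, v, d, S, hS, hf⟩ := hf.resolve_left hf0
  have hX : IsRegularOn L fun x _ => c.mapX x := ((IsRegularOn.const _).mul .fst).add (.const _)
  have hY : IsRegularOn L fun x y => c.mapY x y :=
    (((IsRegularOn.const _).mul .snd).add ((IsRegularOn.const _).mul .fst)).add (.const _)
  have hu := hX.evalEval hY u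
  have hv := hX.evalEval hY v
  have hd := hX.evalEval hY d
  have hc0 := c.u_ne_zero
  -- The inverse change of coordinates, `(X - r) / u²` and `(Y - s (X - r) - t) / u³`, over a common
  -- denominator.
  have hDr := (IsRegularOn.const ((c.u : k) ^ 3)).mul hd
  have hAr := (IsRegularOn.const (c.u : k)).mul (hu.sub ((IsRegularOn.const c.r).mul hd))
  have hBr := (hv.sub ((IsRegularOn.const c.s).mul (hu.sub ((IsRegularOn.const c.r).mul hd)))).sub
    ((IsRegularOn.const c.t).mul hd)
  refine hAr.exists_isRatEnd hL hBr hDr ?_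
  have hS' := finite_setOf_isPt_mem (L := L) (hS.preimage θ.injective.injOn)
  filter_upwards [hS'.compl_mem_cofinite] with x hx y P hP
  have hPS : θ P ∉ S := fun h => hx ⟨y, P, hP, h⟩
  obtain ⟨hn, rfl⟩ := hP
  obtain ⟨hn', e⟩ := hθ x y hn
  rw [e] at hPS
  obtain ⟨hd0, hn'', e'⟩ := hf _ _ hn' hPS
  refine ⟨mul_ne_zero (pow_ne_zero 3 hc0) hd0, ?_⟩
  have h1 := hg (.some x y hn)
  rw [e, e'] at h1
  have hg0 : g (.some x y hn) ≠ 0 := by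
    intro h0
    rw [h0, map_zero] at h1
    exact WeierstrassCurve.Affine.Point.some_ne_zero _ h1.symm
  obtain ⟨x', y', hn3, e3⟩ := exists_isPt_of_ne_zero hg0
  obtain ⟨hn4, e4⟩ := hθ x' y' hn3
  rw [e3, e4] at h1
  simp only [WeierstrassCurve.Affine.Point.some.injEq] at h1
  obtain ⟨h1, h2⟩ := h1
  rw [eq_div_iff hd0] at h1 h2
  replace h1 : ((c.u : k) ^ 2 * x' + c.r) * d.evalEval (c.mapX x) (c.mapY x y) = _ := h1
  replace h2 : ((c.u : k) ^ 3 * y' + (c.u : k) ^ 2 * c.s * x' + c.t) *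
    d.evalEval (c.mapX x) (c.mapY x y) = _ := h2
  have hx' : x' = (c.u : k) * (u.evalEval (c.mapX x) (c.mapY x y) -
      c.r * d.evalEval (c.mapX x) (c.mapY x y)) /
      ((c.u : k) ^ 3 * d.evalEval (c.mapX x) (c.mapY x y)) := by
    rw [eq_div_iff (mul_ne_zero (pow_ne_zero 3 hc0) hd0)]
    generalize Polynomial.evalEval _ _ u = u₀ at *
    generalize Polynomial.evalEval _ _ d = d₀ at *
    linear_combination (c.u : k) * h1
  have hy' : y' = (v.evalEval (c.mapX x) (c.mapY x y) -
      c.s * (u.evalEval (c.mapX x) (c.mapY x y) - c.r * d.evalEval (c.mapX x) (c.mapY x y)) -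
      c.t * d.evalEval (c.mapX x) (c.mapY x y)) /
      ((c.u : k) ^ 3 * d.evalEval (c.mapX x) (c.mapY x y)) := by
    rw [eq_div_iff (mul_ne_zero (pow_ne_zero 3 hc0) hd0)]
    generalize Polynomial.evalEval _ _ u = u₀ at *
    generalize Polynomial.evalEval _ _ v = v₀ at *
    generalize Polynomial.evalEval _ _ d = d₀ at *
    linear_combination h2 - c.s * h1
  rw [← hx', ← hy']
  exact ⟨hn3, e3⟩

end RegularFunctions

/-! ### Existence of a Legendre form. -/

section LegendreForm

open WeierstrassCurve

variable {k : Type*} [Field k]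

theorem WeierstrassCurve.VariableChange.exists_pointEquiv [DecidableEq k] {W W' : WeierstrassCurve k}
    [W.IsElliptic] {c : VariableChange k} (hc : c • W = W') :
    ∃ θ : W'.toAffine.Point ≃+ W.toAffine.Point, ∀ x y h, ∃ h',
      θ (.some x y h) = .some (c.mapX x) (c.mapY x y) h' := by
  subst hc
  exact ⟨c.pointEquiv W, fun x y h => ⟨(c.nonsingular_map_iff W x y).2 h, rfl⟩⟩

/-- Away from characteristic two, an elliptic curve over an algebraically closed field has a
Legendre form. -/
theorem WeierstrassCurve.exists_legendre [IsAlgClosed k] (h2 : (2 : k) ≠ 0) (E : WeierstrassCurve k)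
    [E.IsElliptic] : ∃ (c : VariableChange k) (L : k), c • E = legendreCurve L ∧ IsLegendre L := by
  have : Invertible (2 : k) := invertibleOfNonzero h2
  obtain ⟨c₁, hc₁⟩ := E.exists_variableChange_isCharNeTwoNF
  obtain ⟨W, hW⟩ : ∃ W, W = c₁ • E := ⟨_, rfl⟩
  have hWe : W.IsElliptic := by rw [hW]; infer_instance
  rw [← hW] at hc₁
  set q : Polynomial k := Polynomial.X ^ 3 + Polynomial.C W.a₂ * Polynomial.X ^ 2 +
    Polynomial.C W.a₄ * Polynomial.X + Polynomial.C W.a₆ with hq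
  obtain ⟨e₁, e₂, e₃, s1, s2, s3⟩ : ∃ e₁ e₂ e₃, W.a₂ = -(e₁ + e₂ + e₃) ∧
      W.a₄ = e₁ * e₂ + e₁ * e₃ + e₂ * e₃ ∧ W.a₆ = -(e₁ * e₂ * e₃) := by
    have hqm : q.Monic := by rw [hq]; monicity!
    have hqd : q.natDegree = 3 := by rw [hq]; compute_degree!
    obtain ⟨e₁, h1⟩ := IsAlgClosed.exists_root q (by
      rw [Polynomial.degree_eq_natDegree hqm.ne_zero, hqd]; norm_num)
    obtain ⟨r, hr⟩ := Polynomial.dvd_iff_isRoot.2 h1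
    have hrm : r.Monic := (Polynomial.monic_X_sub_C e₁).of_mul_monic_left (hr ▸ hqm)
    obtain ⟨e₂, e₃, h2⟩ := Polynomial.exists_eq_mul_of_monic_of_natDegree_eq_two hrm (by
      rw [hr, (Polynomial.monic_X_sub_C e₁).natDegree_mul hrm, Polynomial.natDegree_X_sub_C] at hqd
      omega)
    refine ⟨e₁, e₂, e₃, ?_⟩
    obtain ⟨f2, f1, f0⟩ : W.a₂ + (e₁ + e₂ + e₃) = 0 ∧ W.a₄ - (e₁ * e₂ + e₁ * e₃ + e₂ * e₃) = 0 ∧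
        W.a₆ + e₁ * e₂ * e₃ = 0 := by
      apply Polynomial.quadratic_eq_zero
      rw [h2, hq] at hr
      simp only [map_mul, map_add, map_sub]
      linear_combination hr
    exact ⟨by linear_combination f2, by linear_combination f1, by linear_combination f0⟩
  have ha1 : W.a₁ = 0 := hc₁.a₁
  have ha3 : W.a₃ = 0 := hc₁.a₃
  have hΔ : W.Δ = 16 * ((e₁ - e₂) ^ 2 * ((e₁ - e₃) ^ 2 * (e₂ - e₃) ^ 2)) := by
    simp only [WeierstrassCurve.Δ, b₂, b₄, b₆, b₈, ha1, ha3, s1, s2, s3]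
    ring
  have hΔ0 : W.Δ ≠ 0 := W.isUnit_Δ.ne_zero
  rw [hΔ] at hΔ0
  have h12 : e₁ - e₂ ≠ 0 := by intro h; apply hΔ0; rw [h]; ring
  have h13 : e₁ - e₃ ≠ 0 := by intro h; apply hΔ0; rw [h]; ring
  have h23 : e₂ - e₃ ≠ 0 := by intro h; apply hΔ0; rw [h]; ring
  obtain ⟨d, hd⟩ := IsAlgClosed.exists_pow_nat_eq (e₂ - e₁) (n := 2) two_pos
  have h21 : e₂ - e₁ ≠ 0 := sub_ne_zero.2 (sub_ne_zero.1 h12).symm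
  have hd0 : d ≠ 0 := by rintro rfl; apply h21; rw [← hd]; ring
  -- Moves `e₁` to `0` and, as `d² = e₂ - e₁`, also `e₂` to `1`; the third root becomes the
  -- parameter.
  refine ⟨⟨Units.mk0 d hd0, e₁, 0, 0⟩ * c₁, (e₃ - e₁) / (e₂ - e₁), ?_, ⟨h2, ?_, ?_⟩⟩
  · rw [mul_smul, ← hW]
    have hd' : e₂ = e₁ + d ^ 2 := by linear_combination -hd
    ext
    · simp [variableChange_a₁, legendreCurve]
    · simp only [variableChange_a₂, legendreCurve, ha1, s1, Units.val_inv_eq_inv_val, Units.val_mk0,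
        hd']
      field_simp
      ring
    · simp [variableChange_a₃, legendreCurve]
    · simp only [variableChange_a₄, legendreCurve, ha1, ha3, s1, s2, Units.val_inv_eq_inv_val,
        Units.val_mk0, hd']
      field_simp
      ring
    · simp only [variableChange_a₆, legendreCurve, ha1, ha3, s1, s2, s3, Units.val_inv_eq_inv_val,
        Units.val_mk0]
      field_simp
      ring
  · exact div_ne_zero (sub_ne_zero.2 (sub_ne_zero.1 h13).symm) h21
  · rw [Ne, div_eq_one_iff_eq h21]
    intro h
    apply h23
    linear_combination -h

end LegendreForm

/-! ### The action of the order on the Legendre model, and the conclusion. -/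

section Conclusion

open RatFunc

variable {k : Type*} [Field k] [DecidableEq k] [IsAlgClosed k]

/-- Transport of an action on a curve to a Legendre model. -/
theorem EndomorphismRingContains.exists_isRatEnd {E : WeierstrassCurve k} [E.IsElliptic] {R : Type*}
    [Ring R] (hE : EndomorphismRingContains E R) {L : k} (hL : IsLegendre L)
    {c : WeierstrassCurve.VariableChange k} (hc : c • E = legendreCurve L) :
    ∃ ψ : R →+* AddMonoid.End (LegendrePoint L), ∀ r, r ≠ 0 → ∃ u v, IsRatEnd (ψ r) u v := by
  obtain ⟨φ, hinj, hφ⟩ := hE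
  obtain ⟨θ, hθ⟩ := WeierstrassCurve.VariableChange.exists_pointEquiv hc
  let ψ : R →+* AddMonoid.End (LegendrePoint L) :=
    { toFun := fun r => (θ.symm : E.toAffine.Point →+ LegendrePoint L).comp
        ((φ r : E.toAffine.Point →+ E.toAffine.Point).comp (θ : LegendrePoint L →+ _))
      map_one' := by
        ext P
        rw [map_one]
        exact θ.symm_apply_apply P
      map_zero' := by
        ext P
        rw [map_zero]
        exact map_zero θ.symm
      map_mul' := fun r s => by
        ext P
        rw [map_mul]
        exact congrArg θ.symm (congrArg (φ r) (θ.apply_symm_apply _).symm)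
      map_add' := fun r s => by
        ext P
        rw [map_add]
        exact map_add θ.symm _ _ }
  refine ⟨ψ, fun r hr => (hφ r).exists_isRatEnd hL ?_ θ hθ fun P => θ.apply_symm_apply _⟩
  rwa [Ne, map_eq_zero_iff φ hinj]

theorem exists_sq_eq_neg_three (p : ℕ) : ∃ ω : orderSqrtNegThree p,
    (2 * ω - 1) * (2 * ω - 1) = -((3 * p : ℕ) : orderSqrtNegThree p) := by
  refine ⟨⟨_, Algebra.subset_adjoin rfl⟩, Subtype.ext ?_⟩
  have h2 : ((2 : orderSqrtNegThree p) : ℂ) = 2 := rfl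
  have h3 : ((3 : orderSqrtNegThree p) : ℂ) = 3 := rfl
  push_cast
  rw [h2, h3]
  have h : ((Real.sqrt (3 * (p : ℝ)) : ℝ) : ℂ) ^ 2 = 3 * p := by
    rw [← Complex.ofReal_pow, Real.sq_sqrt (by positivity)]
    push_cast
    rfl
  have hI := Complex.I_sq
  linear_combination Complex.I ^ 2 * h + 3 * (p : ℂ) * hI

end Conclusion

theorem proposition5p4 (p : ℕ) [Fact p.Prime] (hp : p % 4 = 1)
    {k : Type*} [Field k] [DecidableEq k] [Algebra (ZMod p) k] [IsAlgClosure (ZMod p) k]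
    (sq : ZMod p → k)
    (hsq : ∀ l : ZMod p, sq l ^ 2 = algebraMap (ZMod p) k (l ^ 2 - l + 1))
    (E : WeierstrassCurve k) [E.IsElliptic]
    (hE : EndomorphismRingContains E (orderSqrtNegThree p)) :
    ∃ l : ZMod p, ∃ ε : ℤˣ, ∃ C : WeierstrassCurve.VariableChange k,
      C • E = legendreCurve (bigLambda (algebraMap (ZMod p) k l) (((ε : ℤ) : k) * sq l)) := by
  have hprime : p.Prime := Fact.out
  have hk : IsAlgClosed k := IsAlgClosure.isAlgClosed (ZMod p)
  have hchar : CharP k p := charP_of_injective_algebraMap (algebraMap (ZMod p) k).injective p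
  have hnum : ∀ m : ℕ, m ≠ 0 → m < p → (m : k) ≠ 0 := fun m hm0 hm h =>
    hm0 (Nat.eq_zero_of_dvd_of_lt ((CharP.cast_eq_zero_iff k p m).1 h) hm)
  have hp5 : 5 ≤ p := by
    have := hprime.two_le
    omega
  have h2 : (2 : k) ≠ 0 := by exact_mod_cast hnum 2 two_ne_zero (by omega)
  have h3 : (3 : k) ≠ 0 := by exact_mod_cast hnum 3 three_ne_zero (by omega)
  have hodd : p % 2 = 1 := by omega
  obtain ⟨c, L, hc, hL⟩ := E.exists_legendre h2
  obtain ⟨ψ, hψ⟩ := hE.exists_isRatEnd hL hc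
  have hz : CharZero (orderSqrtNegThree p) := inferInstance
  have hn0 : ∀ n : ℕ, n ≠ 0 → (n : orderSqrtNegThree p) ≠ 0 := fun n hn => Nat.cast_ne_zero.2 hn
  -- A nonzero natural number is a nonzero element of the order, so the hypothesis on `E` itself
  -- provides rational functions for multiplication by it.
  obtain ⟨U, V, hUV⟩ : ∃ U V, IsMultiplication L U V := by
    have h1 : ∀ n : ℕ, ∃ uv : RatFunc k × RatFunc k, n ≠ 0 →
        IsRatEnd (n : AddMonoid.End (LegendrePoint L)) uv.1 uv.2 := fun n => by
      by_cases hn : n = 0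
      · exact ⟨0, fun h => absurd hn h⟩
      · obtain ⟨u, v, h⟩ := hψ n (hn0 n hn)
        rw [map_natCast] at h
        exact ⟨⟨u, v⟩, fun _ => h⟩
    choose uv huv using h1
    exact ⟨fun n => (uv n).1, fun n => (uv n).2, hL, huv⟩
  obtain ⟨ω, hω⟩ := exists_sq_eq_neg_three p
  have h3p : 3 * p ≠ 0 := mul_ne_zero three_ne_zero hprime.ne_zero
  have hα0 : 2 * ω - 1 ≠ 0 := by
    intro h
    rw [h, mul_zero, eq_comm, neg_eq_zero] at hω
    exact hn0 _ h3p hω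
  obtain ⟨a, b, hab⟩ := hψ _ hα0
  -- The square of `α` is `-3p`, which has the same `x`-coordinate function as `3p`.
  have ha2 : RatFunc.comp a a = U (3 * p) := by
    obtain ⟨u, v, huv⟩ := hψ _ (neg_ne_zero.2 (hn0 _ h3p))
    rw [map_neg, map_natCast] at huv
    rw [(hUV.rep _ h3p).neg_X hL huv]
    refine (hab.mul_X hL hab (v'' := v) ?_).symm
    rw [← map_mul, hω, map_neg, map_natCast]
    exact huv
  have hat : IsTorsionKummerMap L L a := by
    refine hab.isTorsionKummerMap hL fun T hT => ?_
    -- The relation `α + 1 = 2ω` gives `α T = -T = T` when `2T = 0`; this is where `ω`, and not only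
    -- `√(-3p)`, is needed.
    have h1 : ψ (2 * ω - 1) T + T = ψ ω (T + T) := by
      rw [map_sub, map_mul, map_one, map_ofNat, map_add]
      change (2 : ℕ) • (ψ ω T) - T + T = _
      rw [sub_add_cancel, two_smul]
    rw [hT, map_zero] at h1
    rw [← eq_neg_iff_add_eq_zero] at hT h1
    rw [h1, ← hT]
  obtain ⟨M, γ, u, -, hLM, hM, hu, hd, hd', hγ, hγ9⟩ :=
    hUV.exists_descent p (hab.nonconst hL) ha2 h3 hodd hat
  -- Otherwise `9 = 1` in `k`, that is `8 = 0`.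
  have hγ1 : γ ≠ 1 := by
    rintro rfl
    rw [one_pow, one_mul] at hγ9
    refine mul_ne_zero (mul_ne_zero h2 h2) h2 ?_
    linear_combination hγ9
  obtain ⟨n, hnγ, hnL, hnM⟩ := hu.exists_param hL hM hd hd' hγ hγ1
  have hn0 : n ≠ 0 := by rintro rfl; simp at hnγ
  have hn1 : n ^ 2 ≠ 1 := fun h => hγ1 (by rw [← hnγ, h, one_mul])
  have hn9 : n ^ (2 * (p + p ^ 2)) = 9 := by
    have h1 : n ^ (2 * (p + p ^ 2)) * γ ^ (p + p ^ 2) = 1 := by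
      rw [pow_mul, ← mul_pow, hnγ, one_pow]
    linear_combination 9 * h1 - n ^ (2 * (p + p ^ 2)) * hγ9
  have hnp := pow_mul_eq_neg_three p h2 h3 hLM hn1 hn9 hnL hnM
  obtain ⟨l, ε, h⟩ := exists_bigLambda_eq p hodd h2 hn0 hnp hnL sq hsq
  exact ⟨l, ε, c, by rw [hc, h]⟩
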